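/- **The theory KP.** Formulas are in negation normal form, built from $a\in b$, $a\notin b$ by $\wedge,\vee,\forall x,\exists x,(\forall x\in a),(\exists x\in a)$, where bounded quantifiers are primitive; $\neg A$ is defined by dualizing, $A\to B:=\neg A\vee B$, and $a=b$ abbreviates $(\forall x\in a)(x\in b)\wedge(\forall x\in b)(x\in a)$. A formula is $\Delta_0$ if it has no unbounded quantifiers, and $\Sigma$ if it has no unbounded universal quantifiers. KP derives finite sets (sequents) of formulas; $\Gamma,A$ denotes $\Gamma\cup\{A\}$. The axioms are $\Gamma,A,\neg A$; $\;\Gamma,(a=b\wedge B(a))\to B(b)$; $\;\Gamma,\exists z(a\in z\wedge b\in z)$; $\;\Gamma,\exists z(\forall y\in a)(\forall x\in y)(x\in z)$; $\;\Gamma,\exists y[(\forall x\in y)(x\in a\wedge B(x))\wedge(\forall x\in a)(B(x)\to x\in y)]$ for $B\in\Delta_0$; $\;\Gamma,\forall x[(\forall y\in x)F(y)\to F(x)]\to\forall xF(x)$; $\;\Gamma,\exists x[(\exists z\in x)(z\in x)\wedge(\forall y\in x)(\exists z\in x)(y\in z)]$; $\;\Gamma,(\forall x\in a)\exists yG(x,y)\to\exists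 z(\forall x\in a)(\exists y\in z)G(x,y)$ for $G\in\Delta_0$. The rules are: $(\wedge)$ from $\Gamma,A$ and $\Gamma,B$ infer $\Gamma,A\wedge B$; $(\vee)$ from $\Gamma,A$ or from $\Gamma,B$ infer $\Gamma,A\vee B$; $(b\exists)$ from $\Gamma,a\in b\wedge F(a)$ infer $\Gamma,(\exists x\in b)F(x)$; $(\exists)$ from $\Gamma,F(a)$ infer $\Gamma,\exists xF(x)$; $(b\forall)$ from $\Gamma,a\in b\to F(a)$ infer $\Gamma,(\forall x\in b)F(x)$ and $(\forall)$ from $\Gamma,F(a)$ infer $\Gamma,\forall xF(x)$, in both of which $a$ does not occur in the conclusion; (Cut) from $\Gamma,A$ and $\Gamma,\neg A$ infer $\Gamma$. **Ordinals.** Let $X$ be a set, $\theta$ its rank, and $\Omega$ the least uncountable cardinal greater than $\theta$. Let $\varphi$ be the Veblen function with $\varphi0\beta=\omega^\beta$, and let $\Gamma_\beta$ enumerate the nonzero ordinals closed under $\varphi$. By recursion on $\alpha$, $B(\alpha)$ is the closure of $\{0,\Omega\}\cup\{\Gamma_\beta:\beta\le\theta\}$ under $+$, $\varphi$ and $\psi$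 restricted to arguments below $\alpha$, and $\psi(\alpha)$ is the least ordinal not in $B(\alpha)$. Write $\alpha=_{NF}\alpha_1+\dots+\alpha_n$ if equality holds, $n>1$, and $\alpha_1\ge\dots\ge\alpha_n$ are additive principal (powers of $\omega$); write $\alpha=_{NF}\varphi\gamma\delta$ if $\alpha=\varphi\gamma\delta$ and $\gamma,\delta<\alpha$. Let $R$ be the least set of ordinals such that: $0,\Omega\in R$ and $\Gamma_\beta\in R$ for $\beta\le\theta$; if $\alpha=_{NF}\alpha_1+\dots+\alpha_n$ with all $\alpha_i\in R$ then $\alpha\in R$; if $\alpha=_{NF}\varphi\gamma\delta$ with $\gamma,\delta\in R\cap\Omega$ then $\alpha\in R$; if $\alpha=_{NF}\varphi0\gamma$ with $\Omega\le\gamma\in R$ then $\alpha\in R$; if $\gamma\in R\cap B(\gamma)$ then $\psi(\gamma)\in R$. All ordinals used below as indices of terms, as heights of derivations, and as $\alpha$ in (H2), (H3) are taken from $R$. **Terms and formulas of $\mathbf{RS}_\Omega(X)$**, with levels $|t|$: $\bar u$ for $u\in TC(\{X\})$, with $|\bar u|=\Gamma_{\mathrm{rank}(u)}$; $\mathbb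 L_\alpha(X)$ for $\alpha<\Omega$, with level $\Gamma_{\theta+1}+\alpha$; and, for $\alpha<\Omega$, a KP formula $A(a,b_1,\dots,b_n)$ and terms $s_i$ of level $<\Gamma_{\theta+1}+\alpha$, the term $[x\in\mathbb L_\alpha(X)\mid A(x,s_1,\dots,s_n)^{\mathbb L_\alpha(X)}]$ of level $\Gamma_{\theta+1}+\alpha$, where $A^z$ is $A$ with all unbounded quantifiers bounded by $z$. Formulas are $A(s_1,\dots,s_n)$ with $A$ a KP formula whose free variables are replaced by terms. A formula $r\in t$ or $r\notin t$ is basic if both $r,t$ have the form $\bar u$. For a term, $k(t)$ is the set of levels of $t$ and all its subterms; $k(A)$ is the union of $k(t)$ over the terms $t$ in $A$, together with $\Omega$ if $A$ has an unbounded quantifier; $k(\Gamma)=\bigcup_{A\in\Gamma}k(A)$. For $\Diamond\in\{\wedge,\to\}$ and $|s|<|t|$, $\;s\mathrel{\dot\in}t\,\Diamond\,A$ means $s\in t\,\Diamond\,A$ if $t=\bar u$, $\;A$ if $t=\mathbb L_\alpha(X)$, and $B(s)\,\Diamond\,A$ if $t=[x\in\mathbb L_\alpha(X)\mid B(x)]$.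 **Rank.** $rk(\bar u)=\Gamma_{\mathrm{rank}(u)}$; $rk(\mathbb L_\alpha(X))=\Gamma_{\theta+1}+\omega\alpha$; $rk([x\in\mathbb L_\alpha(X)\mid F(x)])=\max(\Gamma_{\theta+1}+\omega\alpha+1,rk(F(\bar\emptyset))+2)$; $rk(s\in t)=rk(s\notin t)=\max(rk(t)+1,rk(s)+6)$; for $Q\in\{\forall,\exists\}$, $rk((Qx\in t)F(x))$ is $\max(rk(t)+3,rk(F(\bar\emptyset))+2)$ if $t$ has the form $\bar u$ and $\max(rk(t),rk(F(\bar\emptyset))+2)$ otherwise; $rk(QxF(x))=\max(\Omega,rk(F(\bar\emptyset))+1)$; $rk(A\wedge B)=rk(A\vee B)=\max(rk(A),rk(B))+1$. **Operators.** An operator is a map $\mathcal H$ from sets of ordinals to sets of ordinals such that for all $Y,Y'$: (H1) $0\in\mathcal H(Y)$ and $\Gamma_\beta\in\mathcal H(Y)$ for $\beta\le\theta+1$; (H2) if $\alpha=_{NF}\alpha_1+\dots+\alpha_n$ then $\alpha\in\mathcal H(Y)$ iff all $\alpha_i\in\mathcal H(Y)$; (H3) if $\alpha=_{NF}\varphi\alpha_1\alpha_2$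 then $\alpha\in\mathcal H(Y)$ iff $\alpha_1,\alpha_2\in\mathcal H(Y)$; (H4) $Y\subseteq\mathcal H(Y)$; (H5) $Y'\subseteq\mathcal H(Y)$ implies $\mathcal H(Y')\subseteq\mathcal H(Y)$. Put $\mathcal H[s_1,\dots,s_n](Y):=\mathcal H(Y\cup k(s_1)\cup\dots\cup k(s_n))$. **Derivability** $\mathcal H\vdash^\alpha_\rho\Gamma$, for finite sets $\Gamma$ of $\mathbf{RS}_\Omega(X)$ formulas, is defined inductively, always requiring $\{\alpha\}\cup k(\Gamma)\subseteq\mathcal H(\emptyset)$. The axioms are $\Gamma,\bar u\in\bar v$ if $u\in v$, and $\Gamma,\bar u\notin\bar v$ if $u\notin v$ ($u,v\in TC(\{X\})$). The rules (premises on the left; $\alpha_0,\alpha_1,\alpha_s<\alpha$): - $(\wedge)$: $\mathcal H\vdash^{\alpha_0}_\rho\Gamma,A$ and $\mathcal H\vdash^{\alpha_1}_\rho\Gamma,B$ give $\mathcal H\vdash^\alpha_\rho\Gamma,A\wedge B$. - $(\vee)$: $\mathcal H\vdash^{\alpha_0}_\rho\Gamma,C$ with $C\in\{A,B\}$ gives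 $\mathcal H\vdash^\alpha_\rho\Gamma,A\vee B$. - $(\notin)$: $\mathcal H[s]\vdash^{\alpha_s}_\rho\Gamma,s\mathrel{\dot\in}t\to r\ne s$ for all $|s|<|t|$ gives $\mathcal H\vdash^\alpha_\rho\Gamma,r\notin t$, if $r\in t$ is not basic. - $(\in)$: $\mathcal H\vdash^{\alpha_0}_\rho\Gamma,s\mathrel{\dot\in}t\wedge r=s$ gives $\mathcal H\vdash^\alpha_\rho\Gamma,r\in t$, if $|s|<|t|$, $|s|<\Gamma_{\theta+1}+\alpha$ and $r\in t$ is not basic. - $(b\forall)$: $\mathcal H[s]\vdash^{\alpha_s}_\rho\Gamma,s\mathrel{\dot\in}t\to A(s)$ for all $|s|<|t|$ gives $\mathcal H\vdash^\alpha_\rho\Gamma,(\forall x\in t)A(x)$. - $(b\exists)$: $\mathcal H\vdash^{\alpha_0}_\rho\Gamma,s\mathrel{\dot\in}t\wedge A(s)$ gives $\mathcal H\vdash^\alpha_\rho\Gamma,(\exists x\in t)A(x)$, if $|s|<|t|$ and $|s|<\Gamma_{\theta+1}+\alpha$. - $(\forall)$: $\mathcal H[s]\vdash^{\alpha_s}_\rho\Gamma,A(s)$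 for all terms $s$ gives $\mathcal H\vdash^\alpha_\rho\Gamma,\forall xA(x)$. - $(\exists)$: $\mathcal H\vdash^{\alpha_0}_\rho\Gamma,A(s)$ gives $\mathcal H\vdash^\alpha_\rho\Gamma,\exists xA(x)$, if $|s|<\Gamma_{\theta+1}+\alpha$. - (Cut): $\mathcal H\vdash^{\alpha_0}_\rho\Gamma,A$ and $\mathcal H\vdash^{\alpha_0}_\rho\Gamma,\neg A$ give $\mathcal H\vdash^\alpha_\rho\Gamma$, if $rk(A)<\rho$. - ($\Sigma$-Ref): $\mathcal H\vdash^{\alpha_0}_\rho\Gamma,A$ gives $\mathcal H\vdash^\alpha_\rho\Gamma,\exists zA^z$, if $A$ is a $\Sigma$ formula and $\Omega<\alpha$. **Theorem.** From every KP derivation one can compute a number $m<\omega$ (that is, there is a computable function of the Gödel number of the derivation with value $m$) such that the following holds. If the derivation derives $\Gamma(a_1,\dots,a_n)$, a finite set of formulas whose free variables are among $a_1,\dots,a_n$, then $$\mathcal H[s_1,\dots,s_n]\vdash^{\Omega\cdot\omega^m}_{\Omega+m}\Gamma(s_1,\dots,s_n)$$ for every set $X$, every operator $\mathcal H$ (relative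 to $X$) with $\Omega\in\mathcal H(\emptyset)$, and all $\mathbf{RS}_\Omega(X)$ terms $s_1,\dots,s_n$. -/

import Mathlib

open Ordinal

universe u v

noncomputable section

namespace KPEmbed

/-! ### First-order formulas of set theory in negation normal form

Free variables (or, in the infinitary system, closed terms) are drawn from a type `T`. Bound
variables are de Bruijn indices: in `Fml T n` the indices `0, …, n - 1` are available, and every
quantifier binds index `0` of its body. -/

/-- What may stand at an argument place: an element of `T` or a bound variable. -/
inductive Ref (T : Type v) : ℕ → Type v
  | par {n : ℕ} (t : T) : Ref T n
  | bv {n : ℕ} (i : Fin (n + 1)) : Ref T (n + 1)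

/-- Formulas built from `∈`, `∉`, `∧`, `∨`, bounded and unbounded quantifiers, with elements of `T`
in the place of free variables and with `n` bound variables in scope. -/
inductive Fml (T : Type v) : ℕ → Type v
  | mem {n : ℕ} (s t : Ref T n) : Fml T n
  | nmem {n : ℕ} (s t : Ref T n) : Fml T n
  | and {n : ℕ} (A B : Fml T n) : Fml T n
  | or {n : ℕ} (A B : Fml T n) : Fml T n
  | ball {n : ℕ} (t : Ref T n) (A : Fml T (n + 1)) : Fml T n
  | bex {n : ℕ} (t : Ref T n) (A : Fml T (n + 1)) : Fml T n
  | all {n : ℕ} (A : Fml T (n + 1)) : Fml T n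
  | ex {n : ℕ} (A : Fml T (n + 1)) : Fml T n

instance Fml.decEq {T : Type v} {n : ℕ} : DecidableEq (Fml T n) := Classical.decEq _

namespace Ref

variable {T : Type v} {S : Type u}

/-- Replace the elements of `T` along `f`. -/
def map (f : T → S) : {n : ℕ} → Ref T n → Ref S n
  | _, par t => par (f t)
  | _, bv i => bv i

/-- Substitute for the bound variables. -/
def subst : {n m : ℕ} → (Fin n → Ref T m) → Ref T n → Ref T m
  | _, _, _, par t => par t
  | _, _, σ, bv i => σ i

/-- Move below one more quantifier. -/
def shift {n : ℕ} (r : Ref T n) : Ref T (n + 1) := r.subst fun i => bv i.succ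

/-- The elements of `T` that occur. -/
def params : {n : ℕ} → Ref T n → Set T
  | _, par t => {t}
  | _, bv _ => ∅

/-- Gödel number of a variable. -/
def code : {n : ℕ} → Ref ℕ n → ℕ
  | _, par a => Nat.pair 0 a
  | _, bv i => Nat.pair 1 i

end Ref

/-- A substitution, moved below one more quantifier. -/
def liftSubst {T : Type v} {n m : ℕ} (σ : Fin n → Ref T m) : Fin (n + 1) → Ref T (m + 1) :=
  Fin.cases (Ref.bv 0) fun i => (σ i).shift

namespace Fml

variable {T : Type v} {S : Type u}

/-- Replace the elements of `T` along `f`. -/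
def map (f : T → S) : {n : ℕ} → Fml T n → Fml S n
  | _, mem s t => mem (s.map f) (t.map f)
  | _, nmem s t => nmem (s.map f) (t.map f)
  | _, and A B => and (A.map f) (B.map f)
  | _, or A B => or (A.map f) (B.map f)
  | _, ball t A => ball (t.map f) (A.map f)
  | _, bex t A => bex (t.map f) (A.map f)
  | _, all A => all (A.map f)
  | _, ex A => ex (A.map f)

/-- Substitute for the bound variables in scope. -/
def subst : {n m : ℕ} → (Fin n → Ref T m) → Fml T n → Fml T m
  | _, _, σ, mem s t => mem (s.subst σ) (t.subst σ)
  | _, _, σ, nmem s t => nmem (s.subst σ) (t.subst σ)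
  | _, _, σ, and A B => and (A.subst σ) (B.subst σ)
  | _, _, σ, or A B => or (A.subst σ) (B.subst σ)
  | _, _, σ, ball t A => ball (t.subst σ) (A.subst (liftSubst σ))
  | _, _, σ, bex t A => bex (t.subst σ) (A.subst (liftSubst σ))
  | _, _, σ, all A => all (A.subst (liftSubst σ))
  | _, _, σ, ex A => ex (A.subst (liftSubst σ))

/-- `F(t)`, for a formula `F(x)` with one place `x`. -/
def inst (F : Fml T 1) (t : T) : Fml T 0 := F.subst fun _ => Ref.par t

/-- `F(x)` for a formula with one place and a bound variable (or element of `T`) `x`. -/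
def at' {n : ℕ} (F : Fml T 1) (x : Ref T n) : Fml T n := F.subst fun _ => x

/-- Negation. -/
def neg : {n : ℕ} → Fml T n → Fml T n
  | _, mem s t => nmem s t
  | _, nmem s t => mem s t
  | _, and A B => or A.neg B.neg
  | _, or A B => and A.neg B.neg
  | _, ball t A => bex t A.neg
  | _, bex t A => ball t A.neg
  | _, all A => ex A.neg
  | _, ex A => all A.neg

/-- `A → B` abbreviates `¬A ∨ B`. -/
def imp {n : ℕ} (A B : Fml T n) : Fml T n := or A.neg B

/-- `s = t` abbreviates `(∀ x ∈ s)(x ∈ t) ∧ (∀ x ∈ t)(x ∈ s)`. -/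
def eq {n : ℕ} (s t : Ref T n) : Fml T n :=
  and (ball s (mem (Ref.bv 0) t.shift)) (ball t (mem (Ref.bv 0) s.shift))

/-- `A^z`: every unbounded quantifier of `A` is restricted to `z`. -/
def rel : {n : ℕ} → Fml T n → Ref T n → Fml T n
  | _, mem s t, _ => mem s t
  | _, nmem s t, _ => nmem s t
  | _, and A B, z => and (A.rel z) (B.rel z)
  | _, or A B, z => or (A.rel z) (B.rel z)
  | _, ball t A, z => ball t (A.rel z.shift)
  | _, bex t A, z => bex t (A.rel z.shift)
  | _, all A, z => ball z (A.rel z.shift)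
  | _, ex A, z => bex z (A.rel z.shift)

/-- `∃ z A^z`. -/
def exRel (A : Fml T 0) : Fml T 0 := ex ((A.subst Fin.elim0 : Fml T 1).rel (Ref.bv 0))

/-- No unbounded quantifiers. -/
def IsDelta0 : {n : ℕ} → Fml T n → Prop
  | _, mem _ _ => True
  | _, nmem _ _ => True
  | _, and A B => A.IsDelta0 ∧ B.IsDelta0
  | _, or A B => A.IsDelta0 ∧ B.IsDelta0
  | _, ball _ A => A.IsDelta0
  | _, bex _ A => A.IsDelta0
  | _, all _ => False
  | _, ex _ => False

/-- No unbounded universal quantifiers. -/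
def IsSigma : {n : ℕ} → Fml T n → Prop
  | _, mem _ _ => True
  | _, nmem _ _ => True
  | _, and A B => A.IsSigma ∧ B.IsSigma
  | _, or A B => A.IsSigma ∧ B.IsSigma
  | _, ball _ A => A.IsSigma
  | _, bex _ A => A.IsSigma
  | _, all _ => False
  | _, ex A => A.IsSigma

/-- The elements of `T` that occur in a formula (free variables, respectively closed terms). -/
def params : {n : ℕ} → Fml T n → Set T
  | _, mem s t => s.params ∪ t.params
  | _, nmem s t => s.params ∪ t.params
  | _, and A B => A.params ∪ B.params
  | _, or A B => A.params ∪ B.params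
  | _, ball t A => t.params ∪ A.params
  | _, bex t A => t.params ∪ A.params
  | _, all A => A.params
  | _, ex A => A.params

/-- Gödel number of a formula of set theory. -/
def code : {n : ℕ} → Fml ℕ n → ℕ
  | _, mem s t => Nat.pair 0 (Nat.pair s.code t.code)
  | _, nmem s t => Nat.pair 1 (Nat.pair s.code t.code)
  | _, and A B => Nat.pair 2 (Nat.pair A.code B.code)
  | _, or A B => Nat.pair 3 (Nat.pair A.code B.code)
  | _, ball t A => Nat.pair 4 (Nat.pair t.code A.code)
  | _, bex t A => Nat.pair 5 (Nat.pair t.code A.code)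
  | _, all A => Nat.pair 6 A.code
  | _, ex A => Nat.pair 7 A.code

end Fml

/-! ### The Tait-style sequent calculus for Kripke–Platek set theory -/

/-- Formulas of `KP`: the free variables are `a_0, a_1, …`, given by their indices. -/
abbrev KPFml := Fml ℕ 0

/-- `a ∈ b` for free variables. -/
abbrev vmem (a b : ℕ) : KPFml := .mem (.par a) (.par b)

/-- The free variable `c` does not occur in the sequent `Γ`. -/
def Fresh (c : ℕ) (Γ : Finset KPFml) : Prop := ∀ A ∈ Γ, c ∉ A.params

/-- `∃ z (a ∈ z ∧ b ∈ z)`. -/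
def pairAx (a b : ℕ) : KPFml :=
  .ex (.and (.mem (.par a) (.bv 0)) (.mem (.par b) (.bv 0)))

/-- `∃ z (∀ y ∈ a)(∀ x ∈ y)(x ∈ z)`. -/
def unionAx (a : ℕ) : KPFml :=
  .ex (.ball (.par a) (.ball (.bv 0) (.mem (.bv 0) (.bv 2))))

/-- `∃ y [(∀ x ∈ y)(x ∈ a ∧ B(x)) ∧ (∀ x ∈ a)(B(x) → x ∈ y)]`. -/
def sepAx (a : ℕ) (B : Fml ℕ 1) : KPFml :=
  .ex (.and
    (.ball (.bv 0) (.and (.mem (.bv 0) (.par a)) (B.at' (.bv 0))))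
    (.ball (.par a) (.imp (B.at' (.bv 0)) (.mem (.bv 0) (.bv 1)))))

/-- `∀ x [(∀ y ∈ x) F(y) → F(x)] → ∀ x F(x)`. -/
def indAx (F : Fml ℕ 1) : KPFml :=
  .imp (.all (.imp (.ball (.bv 0) (F.at' (.bv 0))) F)) (.all F)

/-- `∃ x [(∃ z ∈ x)(z ∈ x) ∧ (∀ y ∈ x)(∃ z ∈ x)(y ∈ z)]`. -/
def infAx : KPFml :=
  .ex (.and
    (.bex (.bv 0) (.mem (.bv 0) (.bv 1)))
    (.ball (.bv 0) (.bex (.bv 1) (.mem (.bv 1) (.bv 0)))))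

/-- `(∀ x ∈ a) ∃ y G(x, y) → ∃ z (∀ x ∈ a)(∃ y ∈ z) G(x, y)`; in `G` the place of `y` is index `0`
and the place of `x` is index `1`. -/
def collAx (a : ℕ) (G : Fml ℕ 2) : KPFml :=
  .imp (.ball (.par a) (.ex G))
    (.ex (.ball (.par a) (.bex (.bv 1) (G.subst ![.bv 0, .bv 1]))))

/-- Derivations of `KP`, as finite trees; `KPDer Γ` is the type of derivations of the finite set of
formulas `Γ`. Here `insert A Γ` is the sequent `Γ, A`. -/
inductive KPDer : Finset KPFml → Type
  | logAx (Γ : Finset KPFml) (A : KPFml) : KPDer (insert A (insert A.neg Γ))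
  | extAx (Γ : Finset KPFml) (a b : ℕ) (B : Fml ℕ 1) :
      KPDer (insert (.imp (.and (.eq (.par a) (.par b)) (B.inst a)) (B.inst b)) Γ)
  | pairAx (Γ : Finset KPFml) (a b : ℕ) : KPDer (insert (pairAx a b) Γ)
  | unionAx (Γ : Finset KPFml) (a : ℕ) : KPDer (insert (unionAx a) Γ)
  | sepAx (Γ : Finset KPFml) (a : ℕ) (B : Fml ℕ 1) (hB : B.IsDelta0) :
      KPDer (insert (sepAx a B) Γ)
  | indAx (Γ : Finset KPFml) (F : Fml ℕ 1) : KPDer (insert (indAx F) Γ)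
  | infAx (Γ : Finset KPFml) : KPDer (insert infAx Γ)
  | collAx (Γ : Finset KPFml) (a : ℕ) (G : Fml ℕ 2) (hG : G.IsDelta0) :
      KPDer (insert (collAx a G) Γ)
  | and (Γ : Finset KPFml) (A B : KPFml) (d : KPDer (insert A Γ)) (e : KPDer (insert B Γ)) :
      KPDer (insert (.and A B) Γ)
  | orLeft (Γ : Finset KPFml) (A B : KPFml) (d : KPDer (insert A Γ)) :
      KPDer (insert (.or A B) Γ)
  | orRight (Γ : Finset KPFml) (A B : KPFml) (d : KPDer (insert B Γ)) :
      KPDer (insert (.or A B) Γ)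
  | bex (Γ : Finset KPFml) (a b : ℕ) (F : Fml ℕ 1)
      (d : KPDer (insert (.and (vmem a b) (F.inst a)) Γ)) :
      KPDer (insert (.bex (.par b) F) Γ)
  | ex (Γ : Finset KPFml) (a : ℕ) (F : Fml ℕ 1) (d : KPDer (insert (F.inst a) Γ)) :
      KPDer (insert (.ex F) Γ)
  | ball (Γ : Finset KPFml) (a b : ℕ) (F : Fml ℕ 1)
      (ha : Fresh a (insert (.ball (.par b) F) Γ))
      (d : KPDer (insert (.imp (vmem a b) (F.inst a)) Γ)) :
      KPDer (insert (.ball (.par b) F) Γ)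
  | all (Γ : Finset KPFml) (a : ℕ) (F : Fml ℕ 1) (ha : Fresh a (insert (.all F) Γ))
      (d : KPDer (insert (F.inst a) Γ)) : KPDer (insert (.all F) Γ)
  | cut (Γ : Finset KPFml) (A : KPFml) (d : KPDer (insert A Γ)) (e : KPDer (insert A.neg Γ)) :
      KPDer Γ

/-- Gödel number of a finite set of formulas: the binary digits of value one stand at the Gödel
numbers of its elements. -/
def seqCode (Γ : Finset KPFml) : ℕ := ∑ c ∈ Γ.image Fml.code, 2 ^ c

/-- Gödel number of a derivation. -/
def KPDer.code : {Γ : Finset KPFml} → KPDer Γ → ℕ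
  | _, .logAx Γ A => Nat.pair 0 (Nat.pair (seqCode Γ) A.code)
  | _, .extAx Γ a b B => Nat.pair 1 (Nat.pair (seqCode Γ) (Nat.pair a (Nat.pair b B.code)))
  | _, .pairAx Γ a b => Nat.pair 2 (Nat.pair (seqCode Γ) (Nat.pair a b))
  | _, .unionAx Γ a => Nat.pair 3 (Nat.pair (seqCode Γ) a)
  | _, .sepAx Γ a B _ => Nat.pair 4 (Nat.pair (seqCode Γ) (Nat.pair a B.code))
  | _, .indAx Γ F => Nat.pair 5 (Nat.pair (seqCode Γ) F.code)
  | _, .infAx Γ => Nat.pair 6 (seqCode Γ)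
  | _, .collAx Γ a G _ => Nat.pair 7 (Nat.pair (seqCode Γ) (Nat.pair a G.code))
  | _, .and Γ A B d e => Nat.pair 8 (Nat.pair (seqCode Γ)
      (Nat.pair (Nat.pair A.code B.code) (Nat.pair d.code e.code)))
  | _, .orLeft Γ A B d => Nat.pair 9 (Nat.pair (seqCode Γ)
      (Nat.pair (Nat.pair A.code B.code) d.code))
  | _, .orRight Γ A B d => Nat.pair 10 (Nat.pair (seqCode Γ)
      (Nat.pair (Nat.pair A.code B.code) d.code))
  | _, .bex Γ a b F d => Nat.pair 11 (Nat.pair (seqCode Γ)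
      (Nat.pair (Nat.pair a (Nat.pair b F.code)) d.code))
  | _, .ex Γ a F d => Nat.pair 12 (Nat.pair (seqCode Γ) (Nat.pair (Nat.pair a F.code) d.code))
  | _, .ball Γ a b F _ d => Nat.pair 13 (Nat.pair (seqCode Γ)
      (Nat.pair (Nat.pair a (Nat.pair b F.code)) d.code))
  | _, .all Γ a F _ d => Nat.pair 14 (Nat.pair (seqCode Γ) (Nat.pair (Nat.pair a F.code) d.code))
  | _, .cut Γ A d e => Nat.pair 15 (Nat.pair (seqCode Γ)
      (Nat.pair A.code (Nat.pair d.code e.code)))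

/-! ### The ordinal notation system relative to `θ`

`veblen` is the Veblen function `φ` with `φ 0 β = ω ^ β`, and `Γ_ β` enumerates the strongly
critical ordinals. -/

/-- The least uncountable cardinal greater than `θ`, as an ordinal. -/
def Om (θ : Ordinal.{u}) : Ordinal.{u} := (Order.succ (max Cardinal.aleph0 θ.card)).ord

/-- The closure of `{0, Ω} ∪ {Γ_β : β ≤ θ}` under `+`, `φ` and the function `ψ` on the ordinals
below `α`. -/
inductive Closure (θ α : Ordinal.{u}) (ψ : (β : Ordinal.{u}) → β < α → Ordinal.{u}) :
    Ordinal.{u} → Prop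
  | zero : Closure θ α ψ 0
  | Om : Closure θ α ψ (Om θ)
  | gamma (β : Ordinal.{u}) (hβ : β ≤ θ) : Closure θ α ψ (Γ_ β)
  | add (β γ : Ordinal.{u}) (hβ : Closure θ α ψ β) (hγ : Closure θ α ψ γ) : Closure θ α ψ (β + γ)
  | veblen (β γ : Ordinal.{u}) (hβ : Closure θ α ψ β) (hγ : Closure θ α ψ γ) :
      Closure θ α ψ (veblen β γ)
  | psi (β : Ordinal.{u}) (hβ : β < α) (h : Closure θ α ψ β) : Closure θ α ψ (ψ β hβ)

/-- The collapsing function `ψ_θ`: `ψ_θ(α)` is the least ordinal outside `B_θ(α)`. -/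
def psi (θ : Ordinal.{u}) (α : Ordinal.{u}) : Ordinal.{u} :=
  sInf {β | ¬ Closure θ α (fun γ _ => psi θ γ) β}
termination_by α

/-- `B_θ(α)`. -/
def B (θ α : Ordinal.{u}) : Set Ordinal.{u} := {β | Closure θ α (fun γ _ => psi θ γ) β}

/-- `l` is a list `α_1 ≥ … ≥ α_n` of additive principal numbers with `n > 1`, and `α` is their sum:
`α =_NF α_1 + … + α_n`. -/
def NFSum (α : Ordinal.{u}) (l : List Ordinal.{u}) : Prop :=
  1 < l.length ∧ (∀ β ∈ l, ∃ γ : Ordinal.{u}, β = ω ^ γ) ∧ l.Pairwise (· ≥ ·) ∧ α = l.sum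

/-- `α =_NF φ γ δ`. -/
def NFVeblen (α γ δ : Ordinal.{u}) : Prop := α = veblen γ δ ∧ γ < α ∧ δ < α

/-- The set `R(θ)` of the ordinals with a notation in `T(θ)`. -/
inductive R (θ : Ordinal.{u}) : Ordinal.{u} → Prop
  | zero : R θ 0
  | Om : R θ (Om θ)
  | gamma (β : Ordinal.{u}) (hβ : β ≤ θ) : R θ (Γ_ β)
  | sum (α : Ordinal.{u}) (l : List Ordinal.{u}) (h : NFSum α l) (hl : ∀ β ∈ l, R θ β) : R θ α
  | veblen (α γ δ : Ordinal.{u}) (hγ : γ < KPEmbed.Om θ) (hδ : δ < KPEmbed.Om θ)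
      (h : NFVeblen α γ δ) (rγ : R θ γ) (rδ : R θ δ) : R θ α
  | opow (α γ : Ordinal.{u}) (hγ : KPEmbed.Om θ ≤ γ) (h : NFVeblen α 0 γ) (rγ : R θ γ) : R θ α
  | psi (γ : Ordinal.{u}) (h : γ ∈ B θ γ) (rγ : R θ γ) : R θ (psi θ γ)

/-! ### Terms and formulas of the infinitary system `RS_Ω(X)` -/

/-- Raw terms: `ū`, `L_α(X)` and `[x ∈ L_α(X) | B(x)]`. -/
inductive RTerm : Type (u + 1)
  | bar (x : ZFSet.{u}) : RTerm
  | L (α : Ordinal.{u}) : RTerm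
  | compr (α : Ordinal.{u}) (B : Fml RTerm 1) : RTerm

/-- Formulas over raw terms. -/
abbrev RFml := Fml RTerm.{u} 0

/-- Membership in the transitive closure of `{X}`. -/
def InTC (X x : ZFSet.{u}) : Prop := Relation.ReflTransGen (fun y z : ZFSet.{u} => y ∈ z) x X

/-- The level of a term; `θ` is the rank of `X`. -/
def level (θ : Ordinal.{u}) : RTerm.{u} → Ordinal.{u}
  | .bar x => Γ_ x.rank
  | .L α => Γ_ (θ + 1) + α
  | .compr α _ => Γ_ (θ + 1) + α

/-- The terms of `RS_Ω(X)`. In the last clause `A` is a formula of `KP` in which the free variables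
other than `x` have been replaced by terms, and the term is `[x ∈ L_α(X) | A(x)^{L_α(X)}]`. -/
inductive IsTerm (X : ZFSet.{u}) : RTerm.{u} → Prop
  | bar (x : ZFSet.{u}) (hx : InTC X x) : IsTerm X (.bar x)
  | L (α : Ordinal.{u}) (hα : α < Om X.rank) (rα : R X.rank α) : IsTerm X (.L α)
  | compr (α : Ordinal.{u}) (hα : α < Om X.rank) (rα : R X.rank α) (A : Fml RTerm.{u} 1)
      (hA : ∀ s ∈ A.params, IsTerm X s)
      (hl : ∀ s ∈ A.params, level X.rank s < Γ_ (X.rank + 1) + α) :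
      IsTerm X (.compr α (A.rel (.par (.L α))))

/-- The formulas of `RS_Ω(X)`. -/
def IsFormula (X : ZFSet.{u}) (A : RFml.{u}) : Prop := ∀ s ∈ A.params, IsTerm X s

/-- `Subterm s t`: the term `s` is `t` or occurs inside `t`. -/
inductive Subterm : RTerm.{u} → RTerm.{u} → Prop
  | refl (t : RTerm.{u}) : Subterm t t
  | compr (s r : RTerm.{u}) (α : Ordinal.{u}) (B : Fml RTerm.{u} 1) (hr : r ∈ B.params)
      (h : Subterm s r) : Subterm s (.compr α B)

/-- `k(t)`: the levels of all subterms of the term `t`, including `t` itself. -/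
def kTerm (θ : Ordinal.{u}) (t : RTerm.{u}) : Set Ordinal.{u} := {α | ∃ s, Subterm s t ∧ α = level θ s}

/-- `k(A)`: the levels of all terms occurring in `A`, subterms included, together with `Ω` if `A`
contains an unbounded quantifier. -/
def kFml (θ : Ordinal.{u}) (A : RFml.{u}) : Set Ordinal.{u} :=
  {α | ∃ t ∈ A.params, α ∈ kTerm θ t} ∪ {α | ¬ A.IsDelta0 ∧ α = Om θ}

/-- `k(Γ)` for a finite set of formulas. -/
def kSeq (θ : Ordinal.{u}) (Γ : Finset RFml.{u}) : Set Ordinal.{u} := {α | ∃ A ∈ Γ, α ∈ kFml θ A}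

mutual

/-- The rank of a term. -/
def rkTerm (θ : Ordinal.{u}) : RTerm.{u} → Ordinal.{u}
  | .bar x => Γ_ x.rank
  | .L α => Γ_ (θ + 1) + ω * α
  | .compr α B => max (Γ_ (θ + 1) + ω * α + 1) (rkFml θ B + 2)

/-- The rank of an argument; in the recursion for the rank of a formula a bound variable is replaced
by the term for the empty set. -/
def rkRef (θ : Ordinal.{u}) : {n : ℕ} → Ref RTerm.{u} n → Ordinal.{u}
  | _, .par t => rkTerm θ t
  | _, .bv _ => Γ_ 0

/-- The rank of a formula, with the term for the empty set in the place of each bound variable in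
scope; so the recursive call on the body `F` of a quantifier computes the rank of `F(∅̄)`. -/
def rkFml (θ : Ordinal.{u}) : {n : ℕ} → Fml RTerm.{u} n → Ordinal.{u}
  | _, .mem s t => max (rkRef θ t + 1) (rkRef θ s + 6)
  | _, .nmem s t => max (rkRef θ t + 1) (rkRef θ s + 6)
  | _, .and A B => max (rkFml θ A) (rkFml θ B) + 1
  | _, .or A B => max (rkFml θ A) (rkFml θ B) + 1
  | _, .ball (.par (.bar x)) F => max (Γ_ x.rank + 3) (rkFml θ F + 2)
  | _, .ball (.bv _) F => max (Γ_ 0 + 3) (rkFml θ F + 2)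
  | _, .ball t F => max (rkRef θ t) (rkFml θ F + 2)
  | _, .bex (.par (.bar x)) F => max (Γ_ x.rank + 3) (rkFml θ F + 2)
  | _, .bex (.bv _) F => max (Γ_ 0 + 3) (rkFml θ F + 2)
  | _, .bex t F => max (rkRef θ t) (rkFml θ F + 2)
  | _, .all F => max (Om θ) (rkFml θ F + 1)
  | _, .ex F => max (Om θ) (rkFml θ F + 1)

end

/-! ### Operators and operator-controlled derivability -/

/-- Operators relative to `θ`. As throughout, the ordinals are those of the notation system. -/
structure IsOperator (θ : Ordinal.{u}) (H : Set Ordinal.{u} → Set Ordinal.{u}) : Prop where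
  zero_mem : ∀ Y, 0 ∈ H Y
  gamma_mem : ∀ Y, ∀ β ≤ θ + 1, Γ_ β ∈ H Y
  sum_iff : ∀ Y α l, R θ α → NFSum α l → (α ∈ H Y ↔ ∀ β ∈ l, β ∈ H Y)
  veblen_iff : ∀ Y α γ δ, R θ α → NFVeblen α γ δ → (α ∈ H Y ↔ γ ∈ H Y ∧ δ ∈ H Y)
  subset : ∀ Y, Y ⊆ H Y
  closed : ∀ Y Y', Y' ⊆ H Y → H Y' ⊆ H Y

/-- `H[Z](Y) = H(Y ∪ Z)`. -/
def ext (H : Set Ordinal.{u} → Set Ordinal.{u}) (Z : Set Ordinal.{u}) :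
    Set Ordinal.{u} → Set Ordinal.{u} := fun Y => H (Y ∪ Z)

/-- `s ∈̇ t ∧ A`. -/
def dotAnd (s t : RTerm.{u}) (A : RFml.{u}) : RFml.{u} :=
  match t with
  | .bar x => .and (.mem (.par s) (.par (.bar x))) A
  | .L _ => A
  | .compr _ B => .and (B.inst s) A

/-- `s ∈̇ t → A`. -/
def dotImp (s t : RTerm.{u}) (A : RFml.{u}) : RFml.{u} :=
  match t with
  | .bar x => .imp (.mem (.par s) (.par (.bar x))) A
  | .L _ => A
  | .compr _ B => .imp (B.inst s) A

/-- `r ∈ t` is basic: both terms are of the form `ū`. -/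
def IsBasic (r t : RTerm.{u}) : Prop := (∃ x, r = .bar x) ∧ ∃ y, t = .bar y

/-- The standing requirements on `H ⊢^α Γ`: `Γ` consists of formulas of `RS_Ω(X)`, `α` belongs to
the notation system, and `{α} ∪ k(Γ) ⊆ H(∅)`. -/
structure Controlled (X : ZFSet.{u}) (H : Set Ordinal.{u} → Set Ordinal.{u}) (α : Ordinal.{u})
    (Γ : Finset RFml.{u}) : Prop where
  formula : ∀ A ∈ Γ, IsFormula X A
  notation_mem : R X.rank α
  mem : α ∈ H ∅
  k_subset : kSeq X.rank Γ ⊆ H ∅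

/-- `RSDer X ρ H α Γ` is `H ⊢^α_ρ Γ`: there is an `H`-controlled derivation of `Γ` in `RS_Ω(X)` of
height `α` in which all cut formulas have rank less than `ρ`. -/
inductive RSDer (X : ZFSet.{u}) (ρ : Ordinal.{u}) :
    (Set Ordinal.{u} → Set Ordinal.{u}) → Ordinal.{u} → Finset RFml.{u} → Prop
  | axMem {H α} (Γ : Finset RFml.{u}) (x y : ZFSet.{u})
      (hc : Controlled X H α (insert (.mem (.par (.bar x)) (.par (.bar y))) Γ)) (h : x ∈ y) :
      RSDer X ρ H α (insert (.mem (.par (.bar x)) (.par (.bar y))) Γ)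
  | axNmem {H α} (Γ : Finset RFml.{u}) (x y : ZFSet.{u})
      (hc : Controlled X H α (insert (.nmem (.par (.bar x)) (.par (.bar y))) Γ)) (h : x ∉ y) :
      RSDer X ρ H α (insert (.nmem (.par (.bar x)) (.par (.bar y))) Γ)
  | and {H α} (Γ : Finset RFml.{u}) (A B : RFml.{u})
      (hc : Controlled X H α (insert (.and A B) Γ))
      (α₀ α₁ : Ordinal.{u}) (h₀ : α₀ < α) (h₁ : α₁ < α)
      (d₀ : RSDer X ρ H α₀ (insert A Γ)) (d₁ : RSDer X ρ H α₁ (insert B Γ)) :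
      RSDer X ρ H α (insert (.and A B) Γ)
  | or {H α} (Γ : Finset RFml.{u}) (A B C : RFml.{u})
      (hc : Controlled X H α (insert (.or A B) Γ)) (hC : C = A ∨ C = B)
      (α₀ : Ordinal.{u}) (h₀ : α₀ < α) (d : RSDer X ρ H α₀ (insert C Γ)) :
      RSDer X ρ H α (insert (.or A B) Γ)
  | nmem {H α} (Γ : Finset RFml.{u}) (r t : RTerm.{u})
      (hc : Controlled X H α (insert (.nmem (.par r) (.par t)) Γ)) (hb : ¬ IsBasic r t)
      (β : RTerm.{u} → Ordinal.{u})
      (hβ : ∀ s, IsTerm X s → level X.rank s < level X.rank t → β s < α)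
      (d : ∀ s, IsTerm X s → level X.rank s < level X.rank t →
        RSDer X ρ (ext H (kTerm X.rank s)) (β s)
          (insert (dotImp s t (Fml.neg (.eq (.par r) (.par s)))) Γ)) :
      RSDer X ρ H α (insert (.nmem (.par r) (.par t)) Γ)
  | mem {H α} (Γ : Finset RFml.{u}) (r t s : RTerm.{u})
      (hc : Controlled X H α (insert (.mem (.par r) (.par t)) Γ)) (hb : ¬ IsBasic r t)
      (hs : IsTerm X s) (hst : level X.rank s < level X.rank t)
      (hsα : level X.rank s < Γ_ (X.rank + 1) + α)
      (α₀ : Ordinal.{u}) (h₀ : α₀ < α)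
      (d : RSDer X ρ H α₀ (insert (dotAnd s t (.eq (.par r) (.par s))) Γ)) :
      RSDer X ρ H α (insert (.mem (.par r) (.par t)) Γ)
  | ball {H α} (Γ : Finset RFml.{u}) (t : RTerm.{u}) (A : Fml RTerm.{u} 1)
      (hc : Controlled X H α (insert (.ball (.par t) A) Γ))
      (β : RTerm.{u} → Ordinal.{u})
      (hβ : ∀ s, IsTerm X s → level X.rank s < level X.rank t → β s < α)
      (d : ∀ s, IsTerm X s → level X.rank s < level X.rank t →
        RSDer X ρ (ext H (kTerm X.rank s)) (β s) (insert (dotImp s t (A.inst s)) Γ)) :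
      RSDer X ρ H α (insert (.ball (.par t) A) Γ)
  | bex {H α} (Γ : Finset RFml.{u}) (t s : RTerm.{u}) (A : Fml RTerm.{u} 1)
      (hc : Controlled X H α (insert (.bex (.par t) A) Γ))
      (hs : IsTerm X s) (hst : level X.rank s < level X.rank t)
      (hsα : level X.rank s < Γ_ (X.rank + 1) + α)
      (α₀ : Ordinal.{u}) (h₀ : α₀ < α)
      (d : RSDer X ρ H α₀ (insert (dotAnd s t (A.inst s)) Γ)) :
      RSDer X ρ H α (insert (.bex (.par t) A) Γ)
  | all {H α} (Γ : Finset RFml.{u}) (A : Fml RTerm.{u} 1)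
      (hc : Controlled X H α (insert (.all A) Γ))
      (β : RTerm.{u} → Ordinal.{u}) (hβ : ∀ s, IsTerm X s → β s < α)
      (d : ∀ s, IsTerm X s →
        RSDer X ρ (ext H (kTerm X.rank s)) (β s) (insert (A.inst s) Γ)) :
      RSDer X ρ H α (insert (.all A) Γ)
  | ex {H α} (Γ : Finset RFml.{u}) (s : RTerm.{u}) (A : Fml RTerm.{u} 1)
      (hc : Controlled X H α (insert (.ex A) Γ))
      (hs : IsTerm X s) (hsα : level X.rank s < Γ_ (X.rank + 1) + α)
      (α₀ : Ordinal.{u}) (h₀ : α₀ < α) (d : RSDer X ρ H α₀ (insert (A.inst s) Γ)) :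
      RSDer X ρ H α (insert (.ex A) Γ)
  | cut {H α} (Γ : Finset RFml.{u}) (A : RFml.{u}) (hc : Controlled X H α Γ)
      (hA : rkFml X.rank A < ρ) (α₀ : Ordinal.{u}) (h₀ : α₀ < α)
      (d₀ : RSDer X ρ H α₀ (insert A Γ)) (d₁ : RSDer X ρ H α₀ (insert A.neg Γ)) :
      RSDer X ρ H α Γ
  | sigmaRef {H α} (Γ : Finset RFml.{u}) (A : RFml.{u})
      (hc : Controlled X H α (insert A.exRel Γ)) (hA : A.IsSigma) (hα : Om X.rank < α)
      (α₀ : Ordinal.{u}) (h₀ : α₀ < α) (d : RSDer X ρ H α₀ (insert A Γ)) :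
      RSDer X ρ H α (insert A.exRel Γ)

/-- `Γ(s_1, …, s_n)`: in each formula of `Γ` the free variables `a_1, …, a_n` are replaced by the
terms `s_1, …, s_n` (and any other variable by the term for the empty set). -/
def substSeq {n : ℕ} (a : Fin n → ℕ) (s : Fin n → RTerm.{u}) (Γ : Finset KPFml) :
    Finset RFml.{u} :=
  Γ.image (Fml.map (Function.extend a s fun _ => RTerm.bar ∅))

end KPEmbed

end

universe w

namespace KPEmbed

/-! ### Ordinals -/

section Ordinals

variable {θ : Ordinal.{u}}

-- A KP derivation is translated inference by inference, with controlled terms in place of the free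
-- variables (`Pf.of_KPDer`). Each inference costs finitely many steps above the base height
-- $\Omega\cdot 6$, and each cut formula has rank at most $\Omega$ plus twice its size (`rkFml_le`).
-- Sizes and numbers of steps are bounded linearly in the Gödel number, so a linear $m$ works:
-- $\Omega\cdot 6+k\le\Omega\cdot 7\le\Omega\cdot\omega^m$ for finite $k$.
--
-- The base height comes from inductions on levels. Their heights have the form $\Omega\cdot
-- i+\omega^{|s|}+n$. Passing to a term of smaller level lowers $\omega^{|s|}$ beyond any finite
-- number of steps, because powers of $\omega$ are additive principal; and $\omega^{|s|}<\Omega$, so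
-- one more $\Omega$ absorbs the whole induction. In this way `taut_delta0` derives $A,\neg A$ for
-- $\Delta_0$ formulas from height $\Omega\cdot 2$ on, `Pf.sub_self` and `Pf.mem_congr_left` give
-- the laws of equality from $\Omega\cdot 3$ on, and `Pf.congr` extends them to all formulas, with
-- the general tautology as a special case. Set induction ends at $\Omega\cdot 5$.
--
-- The set existence axioms need explicit witnesses: $\mathbb L_M(X)$ with $M$ above all parameters
-- for pairing and union, a comprehension term over $\mathbb L_M(X)$ for separation, $\mathbb
-- L_\omega(X)$ for infinity. Collection is $\Sigma$-reflection applied to a tautology. A bounded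
-- existential inference has a further difficulty: the KP witness may have too large a level, so it
-- is replaced by an equal term of smaller level.
--
-- Heights must lie in $R\cap\mathcal H(\emptyset)$. Closure of these ordinals under $+$ and
-- $\omega^{\cdot}$ follows from (H2) and (H3) (`Good.avail_add`, `Good.avail_opow`). The ordinal
-- $\Gamma_{\theta+1}$, from which the levels of the terms other than $\bar u$ start, lies in $R$
-- because it equals $\psi(0)$. The predicate `Pf` asks for derivability at every available height
-- from $b+n$ on, so heights may be raised freely and only finite counts have to be tracked.

theorem aleph0_lt_succ_max (θ : Ordinal.{u}) :
    Cardinal.aleph0 < Order.succ (max Cardinal.aleph0 θ.card) :=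
  (le_max_left _ _).trans_lt (Order.lt_succ _)

theorem isRegular_succ_max (θ : Ordinal.{u}) :
    (Order.succ (max Cardinal.aleph0 θ.card)).IsRegular :=
  Cardinal.isRegular_succ (le_max_left _ _)

theorem lt_Om_self (θ : Ordinal.{u}) : θ < Om θ := by
  rw [Om, Cardinal.lt_ord]
  exact (le_max_right _ _).trans_lt (Order.lt_succ _)

theorem omega0_lt_Om (θ : Ordinal.{u}) : ω < Om θ := by
  rw [Om, Cardinal.lt_ord, card_omega0]
  exact aleph0_lt_succ_max θ

theorem isSuccLimit_Om (θ : Ordinal.{u}) : Order.IsSuccLimit (Om θ) :=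
  Cardinal.isSuccLimit_ord (isRegular_succ_max θ).1

/-- Indexing by `o.ToType` makes the cardinality of the index type equal to `o.card`, which can be
compared with the regular cardinal behind $\Omega$. -/
theorem veblen_eq_derivFamily_toType {o : Ordinal.{u}} (h : o ≠ 0) :
    veblen o = derivFamily fun x : o.ToType => veblen ((ToType.mk (o := o)).symm x).1 := by
  rw [veblen_of_ne_zero h, derivFamily_eq_enumOrd fun i => isNormal_veblen _,
    derivFamily_eq_enumOrd fun i => isNormal_veblen _]
  congr 1
  exact ((ToType.mk (o := o)).symm.toEquiv.iInf_congr fun _ => rfl).symm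

/-- $\Omega$ comes from a regular uncountable cardinal, and $\varphi_a$ is the derivative of a
family of fewer than $\Omega$ functions, each preserving $\Omega$ by induction on $a$. -/
theorem veblen_lt_Om {a b : Ordinal.{u}} (ha : a < Om θ) (hb : b < Om θ) :
    veblen a b < Om θ := by
  have hκ := (aleph0_lt_succ_max θ).ne'
  induction a using WellFoundedLT.induction generalizing b with
  | ind a ih =>
    rcases eq_or_ne a 0 with rfl | h0
    · rw [veblen_zero_apply]
      rw [Om, Cardinal.lt_ord] at hb ⊢
      refine (card_opow_le _ _).trans_lt (max_lt (aleph0_lt_succ_max θ) (max_lt ?_ hb))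
      rw [card_omega0]
      exact aleph0_lt_succ_max θ
    · rw [veblen_eq_derivFamily_toType h0]
      refine Cardinal.derivFamily_lt_ord (isRegular_succ_max θ) ?_ hκ (fun i c hc => ?_) hb
      · rw [Cardinal.mk_toType]
        exact Cardinal.lt_ord.1 ha
      · have hi := ((ToType.mk (o := a)).symm i).2
        exact ih _ hi (lt_trans hi ha) hc

theorem gamma_lt_Om {a : Ordinal.{u}} (ha : a < Om θ) : Γ_ a < Om θ :=
  Cardinal.deriv_lt_ord (isRegular_succ_max θ) (aleph0_lt_succ_max θ).ne'
    (fun i hi => veblen_lt_Om hi ((zero_le (a := i)).trans_lt hi)) ha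

theorem gamma_succ_lt_Om (θ : Ordinal.{u}) : Γ_ (θ + 1) < Om θ :=
  gamma_lt_Om ((isSuccLimit_Om θ).succ_lt (lt_Om_self θ))

theorem opow_Om (θ : Ordinal.{u}) : ω ^ Om θ = Om θ := by
  refine le_antisymm ?_ (right_le_opow _ one_lt_omega0)
  rw [opow_le_of_isSuccLimit omega0_ne_zero (isSuccLimit_Om θ)]
  intro b hb
  have := veblen_lt_Om (θ := θ) (a := 0) ((zero_le (a := b)).trans_lt hb) hb
  rw [veblen_zero_apply] at this
  exact this.le

theorem opow_gamma (a : Ordinal.{u}) : ω ^ Γ_ a = Γ_ a := by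
  have := veblen_veblen_of_lt (gamma_pos (o := a)) 0
  rwa [veblen_gamma_zero, veblen_zero_apply] at this

theorem add_lt_Om {a b : Ordinal.{u}} (ha : a < Om θ) (hb : b < Om θ) : a + b < Om θ := by
  rw [← opow_Om] at *
  exact isPrincipal_add_omega0_opow _ ha hb

theorem veblen_lt_gamma {a b c : Ordinal.{u}} (ha : a < Γ_ c) (hb : b < Γ_ c) :
    veblen a b < Γ_ c := by
  rw [← veblen_gamma_zero c, veblen_lt_veblen_iff]
  exact .inr (.inl ⟨ha, by rwa [veblen_gamma_zero]⟩)

theorem add_lt_gamma {a b c : Ordinal.{u}} (ha : a < Γ_ c) (hb : b < Γ_ c) : a + b < Γ_ c := by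
  rw [← opow_gamma] at *
  exact isPrincipal_add_omega0_opow _ ha hb

/-- Below $\Gamma_{\theta+1}$ every ordinal that is not $0$ or some $\Gamma_\beta$ with
$\beta\le\theta$ is a sum or a Veblen value of smaller ordinals, so the recursion terminates at the
generators. -/
theorem closure_zero_of_lt_gamma {ψ : (β : Ordinal.{u}) → β < 0 → Ordinal.{u}} (α : Ordinal.{u})
    (hα : α < Γ_ (θ + 1)) : Closure θ 0 ψ α := by
  induction α using WellFoundedLT.induction with
  | ind α ih =>
    by_cases hp : IsPrincipal (· + ·) α
    · rcases isPrincipal_add_iff_zero_or_omega0_opow.1 hp with rfl | ⟨x, rfl⟩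
      · exact .zero
      · simp only at ih hα ⊢
        by_cases h1 : invVeblen₁ x < ω ^ x
        · rw [← veblen_invVeblen₁_invVeblen₂]
          exact .veblen _ _ (ih _ h1 (h1.trans hα))
            (ih _ (invVeblen₂_lt x) ((invVeblen₂_lt x).trans hα))
        -- Now $\omega^x\le$ `invVeblen₁ x` $\le x\le\omega^x$, so all three coincide. Then $x$ is
        -- $0$ or some $\Gamma_\beta$, and $0$ is not a fixed point of $\omega^{\cdot}$.
        · have h2 := right_le_opow x one_lt_omega0
          have h3 : invVeblen₁ x = x := le_antisymm (invVeblen₁_le x) (h2.trans (not_lt.1 h1))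
          have h4 : ω ^ x = x := le_antisymm ((not_lt.1 h1).trans_eq h3) h2
          rcases invVeblen₁_eq_iff.1 h3 with rfl | ⟨β, rfl⟩
          · simp at h4
          · rw [h4, gamma_lt_gamma] at hα
            rw [h4]
            exact .gamma β (Order.lt_succ_iff.1 hα)
    · obtain ⟨a, ha, b, hb, hab⟩ := exists_lt_add_of_not_isPrincipal_add hp
      rw [← hab]
      exact .add _ _ (ih a ha (ha.trans hα)) (ih b hb (hb.trans hα))

/-- At stage $0$ there are no values of $\psi$, and $\Gamma_{\theta+1}$ is closed under $+$ and
$\varphi$; so the closure cannot enter the gap between $\Gamma_{\theta+1}$ and $\Omega$. -/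
theorem closure_zero_bounds {ψ : (β : Ordinal.{u}) → β < 0 → Ordinal.{u}} {α : Ordinal.{u}}
    (h : Closure θ 0 ψ α) : α < Γ_ (θ + 1) ∨ Om θ ≤ α := by
  induction h with
  | zero => exact .inl gamma_pos
  | Om => exact .inr le_rfl
  | gamma β hβ => exact .inl (gamma_lt_gamma.2 (Order.lt_succ_iff.2 hβ))
  | add β γ _ _ ihβ ihγ =>
    rcases ihβ with ihβ | ihβ
    · rcases ihγ with ihγ | ihγ
      · exact .inl (add_lt_gamma ihβ ihγ)
      · exact .inr (ihγ.trans (le_add_self))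
    · exact .inr (ihβ.trans (le_self_add))
  | veblen β γ _ _ ihβ ihγ =>
    rcases ihβ with ihβ | ihβ
    · rcases ihγ with ihγ | ihγ
      · exact .inl (veblen_lt_gamma ihβ ihγ)
      · exact .inr (ihγ.trans (right_le_veblen ..))
    · exact .inr (ihβ.trans (left_le_veblen ..))
  | psi β hβ => exact absurd hβ (not_lt_zero (a := β))

/-- `ψ(0)` is the first strongly critical number after `Γ_θ`. -/
theorem psi_zero (θ : Ordinal.{u}) : psi θ 0 = Γ_ (θ + 1) := by
  rw [psi]
  have hmem : Γ_ (θ + 1) ∈ {β | ¬ Closure θ 0 (fun γ _ => psi θ γ) β} := fun h => by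
    rcases closure_zero_bounds h with h | h
    · exact lt_irrefl _ h
    · exact absurd (gamma_succ_lt_Om θ) (not_lt.2 h)
  refine le_antisymm (csInf_le' hmem) (le_csInf ⟨_, hmem⟩ fun b hb => ?_)
  by_contra hlt
  exact hb (closure_zero_of_lt_gamma b (not_le.1 hlt))

/-- The clauses of $R$ give $\Gamma_\beta$ directly only for $\beta\le\theta$; the next one is
$\psi(0)$, admitted because $0\in B(0)$. -/
theorem R_gamma_succ (θ : Ordinal.{u}) : R θ (Γ_ (θ + 1)) := by
  rw [← psi_zero]
  exact .psi 0 Closure.zero .zero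

/-- $B(\gamma)$ is closed under addition, so the least ordinal outside it is not a sum of two
smaller ones. This puts values of $\psi$ among the possible terms of a normal form. -/
theorem psi_principal (θ γ : Ordinal.{u}) : psi θ γ = 0 ∨ ∃ δ : Ordinal.{u}, psi θ γ = ω ^ δ := by
  have key : IsPrincipal (· + ·) (psi θ γ) := by
    by_contra hp
    obtain ⟨a, ha, b, hb, hab⟩ := exists_lt_add_of_not_isPrincipal_add hp
    rw [psi] at ha hb hab
    -- The infimum of the empty set would be $0$, which leaves no room for the summand $a$.
    have hne : {β | ¬ Closure θ γ (fun γ _ => psi θ γ) β}.Nonempty := by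
      by_contra h
      rw [Set.not_nonempty_iff_eq_empty.1 h, Ordinal.sInf_empty] at ha
      exact not_lt_zero (a := a) ha
    have h1 := csInf_mem hne
    rw [← hab] at h1
    exact h1 (.add _ _ (not_not.1 (notMem_of_lt_csInf' ha)) (not_not.1 (notMem_of_lt_csInf' hb)))
  rcases isPrincipal_add_iff_zero_or_omega0_opow.1 key with h | ⟨x, h⟩
  · exact .inl h
  · exact .inr ⟨x, h.symm⟩

end Ordinals

/-! ### Ordinals available as heights -/

/-- The ordinals of the notation system that belong to `H(∅)`. -/
def Avail (θ : Ordinal.{u}) (H : Set Ordinal.{u} → Set Ordinal.{u}) (α : Ordinal.{u}) : Prop :=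
  R θ α ∧ α ∈ H ∅

/-- An operator whose value at `∅` contains `Ω`. -/
structure Good (θ : Ordinal.{u}) (H : Set Ordinal.{u} → Set Ordinal.{u}) : Prop where
  op : IsOperator θ H
  om : Om θ ∈ H ∅

section Avail

variable {θ : Ordinal.{u}} {H : Set Ordinal.{u} → Set Ordinal.{u}} {Z : Set Ordinal.{u}}

theorem IsOperator.mono (h : IsOperator θ H) {Y Y' : Set Ordinal.{u}} (hY : Y ⊆ Y') :
    H Y ⊆ H Y' :=
  h.closed _ _ (hY.trans (h.subset Y'))

theorem Good.ext (h : Good θ H) (Z : Set Ordinal.{u}) : Good θ (ext H Z) where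
  op :=
    { zero_mem := fun _ => h.op.zero_mem _
      gamma_mem := fun _ => h.op.gamma_mem _
      sum_iff := fun _ => h.op.sum_iff _
      veblen_iff := fun _ => h.op.veblen_iff _
      subset := fun _ => Set.subset_union_left.trans (h.op.subset _)
      closed := fun _ _ hY => h.op.closed _ _
        (Set.union_subset hY (Set.subset_union_right.trans (h.op.subset _))) }
  om := h.op.mono (Set.empty_subset _) h.om

theorem Good.le_ext (h : Good θ H) (Z Y : Set Ordinal.{u}) : H Y ⊆ KPEmbed.ext H Z Y :=
  h.op.mono Set.subset_union_left

namespace Good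

theorem avail_zero (h : Good θ H) : Avail θ H 0 := ⟨.zero, h.op.zero_mem _⟩

theorem avail_Om (h : Good θ H) : Avail θ H (Om θ) := ⟨.Om, h.om⟩

theorem avail_gamma (h : Good θ H) {β : Ordinal.{u}} (hβ : β ≤ θ) : Avail θ H (Γ_ β) :=
  ⟨.gamma _ hβ, h.op.gamma_mem _ _ (hβ.trans (le_self_add))⟩

theorem avail_gamma_succ (h : Good θ H) : Avail θ H (Γ_ (θ + 1)) :=
  ⟨R_gamma_succ θ, h.op.gamma_mem _ _ le_rfl⟩

/-- Either $\gamma$ is a fixed point of $\omega^{\cdot}$, or $\varphi0\gamma$ is a normal form and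
(H3) applies. Membership in $R$ uses different clauses for exponents below $\Omega$ and for those
from $\Omega$ on. -/
theorem avail_opow (h : Good θ H) {γ : Ordinal.{u}} (hγ : Avail θ H γ) : Avail θ H (ω ^ γ) := by
  rcases (right_le_opow γ one_lt_omega0).eq_or_lt with h0 | h0
  · rwa [← h0]
  have nf : NFVeblen (ω ^ γ) 0 γ :=
    ⟨by rw [veblen_zero_apply], opow_pos _ omega0_pos, h0⟩
  have hR : R θ (ω ^ γ) := by
    by_cases hlt : γ < Om θ
    · exact .veblen _ 0 γ ((zero_le (a := γ)).trans_lt hlt) hlt nf .zero hγ.1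
    · exact .opow _ γ (not_lt.1 hlt) nf hγ.1
  exact ⟨hR, (h.op.veblen_iff _ _ _ _ hR nf).2 ⟨h.op.zero_mem _, hγ.2⟩⟩

/-- Available ordinals are those that have a normal form with available terms. -/
theorem avail_iff (h : Good θ H) {α : Ordinal.{u}} :
    Avail θ H α ↔ ∃ l : List Ordinal.{u}, (∀ β ∈ l, Avail θ H β ∧ ∃ γ : Ordinal.{u}, β = ω ^ γ) ∧
      l.Pairwise (· ≥ ·) ∧ α = l.sum := by
  constructor
  · intro hα
    have single : (∃ γ : Ordinal.{u}, α = ω ^ γ) → ∃ l : List Ordinal.{u},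
        (∀ β ∈ l, Avail θ H β ∧ ∃ γ : Ordinal.{u}, β = ω ^ γ) ∧
          l.Pairwise (· ≥ ·) ∧ α = l.sum := fun hp => ⟨[α], by simp [hα, hp]⟩
    have nil : α = 0 → ∃ l : List Ordinal.{u},
        (∀ β ∈ l, Avail θ H β ∧ ∃ γ : Ordinal.{u}, β = ω ^ γ) ∧
          l.Pairwise (· ≥ ·) ∧ α = l.sum := fun hp => ⟨[], by simp [hp]⟩
    have hR := hα.1
    cases hR with
    | zero => exact nil rfl
    | Om => exact single ⟨_, (opow_Om θ).symm⟩
    | gamma β hβ => exact single ⟨_, (opow_gamma β).symm⟩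
    | sum _ l hl hR =>
      exact ⟨l, fun β hβ => ⟨⟨hR β hβ, (h.op.sum_iff _ _ _ hα.1 hl).1 hα.2 β hβ⟩, hl.2.1 β hβ⟩,
        hl.2.2.1, hl.2.2.2⟩
    | veblen _ γ δ _ _ nf =>
      obtain ⟨x, hx⟩ := veblen_mem_range_opow γ δ
      exact single ⟨x, nf.1.trans hx.symm⟩
    | opow _ γ _ nf => exact single ⟨γ, by rw [nf.1, veblen_zero_apply]⟩
    | psi γ _ _ =>
      rcases psi_principal θ γ with h0 | h0
      · exact nil h0
      · exact single h0
  · rintro ⟨l, hl, hs, rfl⟩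
    match l, hl, hs with
    | [], _, _ => simpa using h.avail_zero
    | [x], hl, _ => simpa using (hl x (by simp)).1
    | x :: y :: l, hl, hs =>
      have nf : NFSum (x :: y :: l).sum (x :: y :: l) :=
        ⟨by simp, fun β hβ => (hl β hβ).2, hs, rfl⟩
      have hR : R θ (x :: y :: l).sum := .sum _ _ nf fun β hβ => (hl β hβ).1.1
      exact ⟨hR, (h.op.sum_iff _ _ _ hR nf).2 fun β hβ => (hl β hβ).1.2⟩

/-- (H2) speaks only of normal forms. The terms of $\alpha$ are therefore prefixed to $\beta$ one at
a time, the last one first; each either becomes the new leading term or is absorbed by the leading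
term already there. -/
theorem avail_add (h : Good θ H) {α β : Ordinal.{u}} (hα : Avail θ H α) (hβ : Avail θ H β) :
    Avail θ H (α + β) := by
  obtain ⟨l, hl, -, rfl⟩ := h.avail_iff.1 hα
  clear hα
  induction l with
  | nil => simpa using hβ
  | cons x l ih =>
    rw [List.sum_cons, add_assoc]
    obtain ⟨m, hm, hs, hsum⟩ := h.avail_iff.1 (ih fun β hβ => hl β (by simp [hβ]))
    rw [hsum]
    have hx := hl x (by simp)
    match m, hm, hs with
    | [], _, _ => simpa using hx.1
    | y :: m, hm, hs =>
      by_cases hxy : y ≤ x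
      · refine h.avail_iff.2 ⟨x :: y :: m, ?_, ?_, rfl⟩
        · intro β hβ
          rcases List.mem_cons.1 hβ with rfl | hβ
          · exact hx
          · exact hm β hβ
        · refine List.pairwise_cons.2 ⟨fun z hz => ?_, hs⟩
          rcases List.mem_cons.1 hz with rfl | hz
          · exact hxy
          · exact ((List.pairwise_cons.1 hs).1 z hz).trans hxy
      · obtain ⟨b, rfl⟩ := (hm y (by simp)).2
        have : x + ω ^ b = ω ^ b := (isPrincipal_add_omega0_opow b).add_eq_right (not_le.1 hxy)
        rw [List.sum_cons, ← add_assoc, this, ← List.sum_cons]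
        exact h.avail_iff.2 ⟨_, hm, hs, rfl⟩

theorem avail_one (h : Good θ H) : Avail θ H 1 := by
  simpa using h.avail_opow h.avail_zero

theorem avail_nat (h : Good θ H) (n : ℕ) : Avail θ H (n : Ordinal.{u}) := by
  induction n with
  | zero => simpa using h.avail_zero
  | succ n ih => simpa using h.avail_add ih h.avail_one

theorem avail_omega0 (h : Good θ H) : Avail θ H ω := by
  simpa using h.avail_opow h.avail_one

theorem avail_mul_nat (h : Good θ H) {α : Ordinal.{u}} (hα : Avail θ H α) (n : ℕ) :
    Avail θ H (α * n) := by
  induction n with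
  | zero => simpa using h.avail_zero
  | succ n ih => simpa [mul_add_one] using h.avail_add ih hα

end Good

end Avail

/-! ### Syntax -/

namespace Ref

variable {T : Type v} {S : Type w}

@[simp] theorem map_par (f : T → S) {n : ℕ} (t : T) : (par t : Ref T n).map f = par (f t) := rfl
@[simp] theorem subst_par {n m : ℕ} (σ : Fin n → Ref T m) (t : T) :
    (par t : Ref T n).subst σ = par t := rfl
@[simp] theorem shift_bv {n : ℕ} (i : Fin (n + 1)) :
    (bv i : Ref T (n + 1)).shift = bv i.succ := rfl
@[simp] theorem params_par {n : ℕ} (t : T) : (par t : Ref T n).params = {t} := rfl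
@[simp] theorem params_bv {n : ℕ} (i : Fin (n + 1)) : (bv i : Ref T (n + 1)).params = ∅ := rfl

/-- The bound variable with a given index. -/
def var : {n : ℕ} → Fin n → Ref T n
  | _ + 1, i => bv i

theorem subst_var {n : ℕ} (r : Ref T n) : r.subst var = r := by
  cases r <;> rfl

theorem map_subst (f : T → S) {n m : ℕ} (σ : Fin n → Ref T m) (r : Ref T n) :
    (r.subst σ).map f = (r.map f).subst fun i => (σ i).map f := by
  cases r <;> rfl

theorem subst_subst {n m k : ℕ} (σ : Fin n → Ref T m) (τ : Fin m → Ref T k) (r : Ref T n) :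
    (r.subst σ).subst τ = r.subst fun i => (σ i).subst τ := by
  cases r <;> rfl

theorem map_shift (f : T → S) {n : ℕ} (r : Ref T n) : r.shift.map f = (r.map f).shift := by
  cases r <;> rfl

theorem shift_subst {n m : ℕ} (σ : Fin n → Ref T m) (r : Ref T n) :
    r.shift.subst (liftSubst σ) = (r.subst σ).shift := by
  cases r <;> rfl

theorem params_subst {n m : ℕ} (σ : Fin n → Ref T m) (r : Ref T n) {t : T}
    (h : t ∈ (r.subst σ).params) : t ∈ r.params ∨ ∃ i, t ∈ (σ i).params := by
  cases r with
  | par s => exact .inl h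
  | bv i => exact .inr ⟨i, h⟩

theorem params_shift {n : ℕ} (r : Ref T n) : r.shift.params = r.params := by
  cases r <;> rfl

theorem map_congr {f g : T → S} {n : ℕ} {r : Ref T n} (h : ∀ t ∈ r.params, f t = g t) :
    r.map f = r.map g := by
  cases r with
  | par t => exact congrArg par (h t rfl)
  | bv i => rfl

theorem params_map {f : T → S} {n : ℕ} {r : Ref T n} {s : S} (h : s ∈ (r.map f).params) :
    ∃ t ∈ r.params, f t = s := by
  cases r with
  | par t => exact ⟨t, rfl, h.symm⟩
  | bv i => exact absurd h (Set.notMem_empty _)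

end Ref

theorem liftSubst_var {T : Type v} {n : ℕ} :
    liftSubst (Ref.var : Fin n → Ref T n) = Ref.var := by
  funext i
  refine Fin.cases rfl (fun j => ?_) i
  cases n with
  | zero => exact j.elim0
  | succ n => rfl

theorem liftSubst_map {T : Type v} {S : Type w} (f : T → S) {n m : ℕ} (σ : Fin n → Ref T m) :
    (fun i => (liftSubst σ i).map f) = liftSubst fun i => (σ i).map f := by
  funext i
  refine Fin.cases rfl (fun j => ?_) i
  exact Ref.map_shift f _

theorem liftSubst_subst {T : Type v} {n m k : ℕ} (σ : Fin n → Ref T m) (τ : Fin m → Ref T k) :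
    (fun i => (liftSubst σ i).subst (liftSubst τ)) = liftSubst fun i => (σ i).subst τ := by
  funext i
  refine Fin.cases rfl (fun j => ?_) i
  exact Ref.shift_subst τ _

theorem liftSubst_params {T : Type v} {n m : ℕ} {σ : Fin n → Ref T m} {t : T}
    (h : ∃ i, t ∈ (liftSubst σ i).params) : ∃ i, t ∈ (σ i).params := by
  obtain ⟨i, h⟩ := h
  induction i using Fin.cases with
  | zero => exact absurd h (Set.notMem_empty _)
  | succ j => exact ⟨j, by rwa [← Ref.params_shift]⟩

namespace Fml

variable {T : Type v} {S : Type w}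

theorem map_subst (f : T → S) {n : ℕ} (A : Fml T n) : ∀ {m : ℕ} (σ : Fin n → Ref T m),
    (A.subst σ).map f = (A.map f).subst fun i => (σ i).map f := by
  induction A <;> intro m σ <;> simp_all [map, subst, Ref.map_subst, liftSubst_map]

theorem subst_subst {n : ℕ} (A : Fml T n) : ∀ {m k : ℕ} (σ : Fin n → Ref T m)
    (τ : Fin m → Ref T k), (A.subst σ).subst τ = A.subst fun i => (σ i).subst τ := by
  induction A <;> intro m k σ τ <;> simp_all [subst, Ref.subst_subst, liftSubst_subst]

theorem subst_var {n : ℕ} (A : Fml T n) : A.subst Ref.var = A := by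
  induction A <;> simp_all [subst, Ref.subst_var, liftSubst_var]

theorem subst_elim0 (A : Fml T 0) (σ : Fin 0 → Ref T 0) : A.subst σ = A := by
  rw [show σ = Ref.var from funext fun i => i.elim0, subst_var]

@[simp] theorem neg_neg {n : ℕ} (A : Fml T n) : A.neg.neg = A := by
  induction A <;> simp_all [neg]

theorem neg_subst {n : ℕ} (A : Fml T n) : ∀ {m : ℕ} (σ : Fin n → Ref T m),
    (A.subst σ).neg = A.neg.subst σ := by
  induction A <;> intro m σ <;> simp_all [neg, subst]

@[simp] theorem neg_map (f : T → S) {n : ℕ} (A : Fml T n) : (A.map f).neg = A.neg.map f := by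
  induction A <;> simp_all [neg, map]

@[simp] theorem neg_inst (A : Fml T 1) (t : T) : (A.inst t).neg = A.neg.inst t := neg_subst A _

@[simp] theorem params_neg {n : ℕ} (A : Fml T n) : A.neg.params = A.params := by
  induction A <;> simp_all [neg, params]

theorem params_subst {n : ℕ} (A : Fml T n) : ∀ {m : ℕ} (σ : Fin n → Ref T m) {t : T},
    t ∈ (A.subst σ).params → t ∈ A.params ∨ ∃ i, t ∈ (σ i).params := by
  induction A with
  | mem r s | nmem r s =>
    intro m σ t h
    rcases h with h | h
    · exact (Ref.params_subst σ r h).imp_left .inl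
    · exact (Ref.params_subst σ s h).imp_left .inr
  | and A B ihA ihB | or A B ihA ihB =>
    intro m σ t h
    rcases h with h | h
    · exact (ihA σ h).imp_left .inl
    · exact (ihB σ h).imp_left .inr
  | ball r A ih | bex r A ih =>
    intro m σ t h
    rcases h with h | h
    · exact (Ref.params_subst σ r h).imp_left .inl
    · exact (ih _ h).imp .inr liftSubst_params
  | all A ih | ex A ih =>
    intro m σ t h
    exact (ih _ h).imp_right liftSubst_params

theorem params_inst {A : Fml T 1} {s t : T} (h : t ∈ (A.inst s).params) :
    t ∈ A.params ∨ t = s :=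
  (params_subst A _ h).imp_right fun ⟨_, hi⟩ => hi

theorem params_rel {n : ℕ} (A : Fml T n) : ∀ (z : Ref T n) {t : T},
    t ∈ (A.rel z).params → t ∈ A.params ∨ t ∈ z.params := by
  induction A with
  | mem r s | nmem r s => exact fun z t h => .inl h
  | and A B ihA ihB | or A B ihA ihB =>
    intro z t h
    rcases h with h | h
    · exact (ihA z h).imp_left .inl
    · exact (ihB z h).imp_left .inr
  | ball r A ih | bex r A ih =>
    intro z t h
    rcases h with h | h
    · exact .inl (.inl h)
    · exact (ih _ h).imp .inr fun h => by rwa [Ref.params_shift] at h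
  | all A ih | ex A ih =>
    intro z t h
    rcases h with h | h
    · exact .inr h
    · exact (ih _ h).imp_right fun h => by rwa [Ref.params_shift] at h

theorem params_map {f : T → S} {n : ℕ} (A : Fml T n) {s : S} (h : s ∈ (A.map f).params) :
    ∃ t ∈ A.params, f t = s := by
  induction A with
  | mem r t | nmem r t =>
    rcases h with h | h
    · obtain ⟨x, hx, e⟩ := Ref.params_map h
      exact ⟨x, .inl hx, e⟩
    · obtain ⟨x, hx, e⟩ := Ref.params_map h
      exact ⟨x, .inr hx, e⟩
  | and A B ihA ihB | or A B ihA ihB =>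
    rcases h with h | h
    · obtain ⟨x, hx, e⟩ := ihA h
      exact ⟨x, .inl hx, e⟩
    · obtain ⟨x, hx, e⟩ := ihB h
      exact ⟨x, .inr hx, e⟩
  | ball r A ih | bex r A ih =>
    rcases h with h | h
    · obtain ⟨x, hx, e⟩ := Ref.params_map h
      exact ⟨x, .inl hx, e⟩
    · obtain ⟨x, hx, e⟩ := ih h
      exact ⟨x, .inr hx, e⟩
  | all A ih | ex A ih => exact ih h

theorem map_congr {f g : T → S} {n : ℕ} (A : Fml T n) (h : ∀ t ∈ A.params, f t = g t) :
    A.map f = A.map g := by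
  induction A with
  | mem r t | nmem r t =>
    simp only [map]
    rw [Ref.map_congr fun x hx => h x (.inl hx), Ref.map_congr fun x hx => h x (.inr hx)]
  | and A B ihA ihB | or A B ihA ihB =>
    simp only [map]
    rw [ihA fun x hx => h x (.inl hx), ihB fun x hx => h x (.inr hx)]
  | ball r A ih | bex r A ih =>
    simp only [map]
    rw [Ref.map_congr fun x hx => h x (.inl hx), ih fun x hx => h x (.inr hx)]
  | all A ih | ex A ih =>
    simp only [map]
    rw [ih h]

@[simp] theorem isDelta0_neg {n : ℕ} (A : Fml T n) : A.neg.IsDelta0 ↔ A.IsDelta0 := by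
  induction A <;> simp_all [neg, IsDelta0]

@[simp] theorem isDelta0_subst {n : ℕ} (A : Fml T n) : ∀ {m : ℕ} (σ : Fin n → Ref T m),
    (A.subst σ).IsDelta0 ↔ A.IsDelta0 := by
  induction A <;> intro m σ <;> simp_all [subst, IsDelta0]

@[simp] theorem isDelta0_inst (A : Fml T 1) (t : T) : (A.inst t).IsDelta0 ↔ A.IsDelta0 :=
  isDelta0_subst A _

@[simp] theorem isDelta0_map (f : T → S) {n : ℕ} (A : Fml T n) :
    (A.map f).IsDelta0 ↔ A.IsDelta0 := by
  induction A <;> simp_all [map, IsDelta0]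

theorem isDelta0_rel {n : ℕ} (A : Fml T n) : ∀ z : Ref T n, (A.rel z).IsDelta0 := by
  induction A <;> intro z <;> simp_all [rel, IsDelta0]

/-- Lets a $\Delta_0$ matrix serve unchanged as the body of a comprehension term and inside $\exists
z A^z$. -/
theorem IsDelta0.rel_eq {n : ℕ} (A : Fml T n) : A.IsDelta0 → ∀ z : Ref T n, A.rel z = A := by
  induction A <;> intro h z <;> simp_all [rel, IsDelta0]

theorem IsDelta0.isSigma {n : ℕ} (A : Fml T n) : A.IsDelta0 → A.IsSigma := by
  induction A <;> intro h <;> simp_all [IsDelta0, IsSigma]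

/-- Replace all bound variables in scope by elements of `T`. -/
def close {n : ℕ} (A : Fml T n) (σ : Fin n → T) : Fml T 0 := A.subst fun i => .par (σ i)

/-- This identity keeps inductions on open formulas in the form "close under an assignment" when a
quantifier is instantiated. -/
theorem inst_subst_lift {n : ℕ} (A : Fml T (n + 1)) (σ : Fin n → T) (t : T) :
    (A.subst (liftSubst fun i => .par (σ i))).inst t = A.close (Fin.cons t σ) := by
  rw [inst, subst_subst, close]
  congr 1
  funext i
  exact Fin.cases rfl (fun j => rfl) i

theorem map_inst (f : T → S) (A : Fml T 1) (t : T) : (A.inst t).map f = (A.map f).inst (f t) :=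
  map_subst f A _

/-- `s ⊆ t` for elements of `T`. -/
abbrev sub (s t : T) : Fml T 0 := ball (.par s) (mem (.bv 0) (.par t))

/-- `¬ s ⊆ t` for elements of `T`. -/
abbrev nsub (s t : T) : Fml T 0 := bex (.par s) (nmem (.bv 0) (.par t))

end Fml

/-! ### Controlled terms and formulas -/

section Controlled

variable {X : ZFSet.{u}} {H H' : Set Ordinal.{u} → Set Ordinal.{u}}

/-- `t` is a term of `RS_Ω(X)` with `k(t) ⊆ H(∅)`. -/
def TOk (X : ZFSet.{u}) (H : Set Ordinal.{u} → Set Ordinal.{u}) (t : RTerm.{u}) : Prop :=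
  IsTerm X t ∧ kTerm X.rank t ⊆ H ∅

/-- All terms in the formula are terms of `RS_Ω(X)` with `k(t) ⊆ H(∅)`. -/
def FOk (X : ZFSet.{u}) (H : Set Ordinal.{u} → Set Ordinal.{u}) {n : ℕ} (A : Fml RTerm.{u} n) :
    Prop := ∀ t ∈ A.params, TOk X H t

theorem TOk.mono (hH : H ≤ H') {t : RTerm.{u}} (h : TOk X H t) : TOk X H' t :=
  ⟨h.1, h.2.trans (hH ∅)⟩

theorem FOk.mono (hH : H ≤ H') {n : ℕ} {A : Fml RTerm.{u} n} (h : FOk X H A) : FOk X H' A :=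
  fun t ht => (h t ht).mono hH

theorem FOk.neg {n : ℕ} {A : Fml RTerm.{u} n} (h : FOk X H A) : FOk X H A.neg := by
  rwa [FOk, Fml.params_neg]

theorem FOk.inst {A : Fml RTerm.{u} 1} (h : FOk X H A) {s : RTerm.{u}} (hs : TOk X H s) :
    FOk X H (A.inst s) := fun t ht => by
  rcases Fml.params_inst ht with ht | rfl
  · exact h t ht
  · exact hs

theorem FOk.and {n : ℕ} {A B : Fml RTerm.{u} n} (hA : FOk X H A) (hB : FOk X H B) :
    FOk X H (A.and B) := fun t ht => ht.elim (hA t) (hB t)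

theorem FOk.or {n : ℕ} {A B : Fml RTerm.{u} n} (hA : FOk X H A) (hB : FOk X H B) :
    FOk X H (A.or B) := fun t ht => ht.elim (hA t) (hB t)

theorem FOk.mem {s t : RTerm.{u}} (hs : TOk X H s) (ht : TOk X H t) :
    FOk X H (.mem (.par s) (.par t) : Fml RTerm.{u} 0) := fun r hr => by
  rcases hr with rfl | rfl
  · exact hs
  · exact ht

theorem FOk.sub {s t : RTerm.{u}} (hs : TOk X H s) (ht : TOk X H t) :
    FOk X H (Fml.sub s t) := fun r hr => by
  simp only [Fml.params, Ref.params_par, Ref.params_bv, Set.empty_union, Set.mem_union,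
    Set.mem_singleton_iff] at hr
  rcases hr with rfl | rfl
  · exact hs
  · exact ht

theorem FOk.eq {s t : RTerm.{u}} (hs : TOk X H s) (ht : TOk X H t) :
    FOk X H (Fml.eq (.par s) (.par t) : Fml RTerm.{u} 0) :=
  FOk.and (.sub hs ht) (.sub ht hs)

theorem IsTerm.inTC {x : ZFSet.{u}} (h : IsTerm X (.bar x)) : InTC X x := by
  cases h with
  | bar _ h => exact h

theorem InTC.mem {x y : ZFSet.{u}} (h : InTC X x) (hy : y ∈ x) : InTC X y :=
  Relation.ReflTransGen.head hy h

theorem InTC.rank_le {x : ZFSet.{u}} (h : InTC X x) : x.rank ≤ X.rank := by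
  induction h using Relation.ReflTransGen.head_induction_on with
  | refl => exact le_rfl
  | head h _ ih => exact (ZFSet.rank_lt_of_mem h).le.trans ih

/-- By $\in$-induction every set leads down to $\emptyset$. Hence $\bar\emptyset$ is a term for
every $X$ and can serve as a default value. -/
theorem inTC_empty (X : ZFSet.{u}) : InTC X ∅ := by
  induction X using ZFSet.inductionOn with
  | _ X ih =>
    rcases ZFSet.eq_empty_or_nonempty X with rfl | ⟨y, hy⟩
    · exact .refl
    · exact (ih y hy).tail hy

theorem kTerm_bar (θ : Ordinal.{u}) (x : ZFSet.{u}) : kTerm θ (.bar x) = {Γ_ x.rank} := by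
  ext α
  constructor
  · rintro ⟨s, hs, rfl⟩
    cases hs
    rfl
  · rintro rfl
    exact ⟨_, .refl _, rfl⟩

theorem kTerm_L (θ α : Ordinal.{u}) : kTerm θ (.L α) = {Γ_ (θ + 1) + α} := by
  ext α
  constructor
  · rintro ⟨s, hs, rfl⟩
    cases hs
    rfl
  · rintro rfl
    exact ⟨_, .refl _, rfl⟩

theorem TOk.bar (hH : Good X.rank H) {x : ZFSet.{u}} (hx : InTC X x) : TOk X H (.bar x) := by
  refine ⟨.bar x hx, ?_⟩
  rw [kTerm_bar, Set.singleton_subset_iff]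
  exact (hH.avail_gamma hx.rank_le).2

theorem TOk.L (hH : Good X.rank H) {α : Ordinal.{u}} (hα : Avail X.rank H α)
    (hlt : α < Om X.rank) : TOk X H (.L α) := by
  refine ⟨.L α hlt hα.1, ?_⟩
  rw [kTerm_L, Set.singleton_subset_iff]
  exact (hH.avail_add hH.avail_gamma_succ hα).2

theorem level_mem_kTerm (θ : Ordinal.{u}) (t : RTerm.{u}) : level θ t ∈ kTerm θ t :=
  ⟨t, .refl t, rfl⟩

theorem IsTerm.level_lt {t : RTerm.{u}} (h : IsTerm X t) : level X.rank t < Om X.rank := by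
  cases h with
  | bar x hx => exact gamma_lt_Om (hx.rank_le.trans_lt (lt_Om_self _))
  | L α hα _ => exact add_lt_Om (gamma_succ_lt_Om _) hα
  | compr α hα => exact add_lt_Om (gamma_succ_lt_Om _) hα

theorem TOk.avail_level {t : RTerm.{u}} (h : TOk X H t) :
    Avail X.rank H (level X.rank t) := by
  have hmem := h.2 (level_mem_kTerm _ t)
  refine ⟨?_, hmem⟩
  cases h.1 with
  | bar x hx => exact .gamma _ hx.rank_le
  | L α hα rα =>
    -- It is not known that $\alpha$ itself lies in $\mathcal H(\emptyset)$. For the constant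
    -- operator with value `Set.univ` availability is just membership in $R$, so closure under
    -- addition can be used for $R$ alone.
    have g : Good X.rank (fun _ => Set.univ) := by
      refine ⟨⟨?_, ?_, ?_, ?_, ?_, ?_⟩, ?_⟩ <;> simp
    exact (g.avail_add g.avail_gamma_succ ⟨rα, trivial⟩).1
  | compr α hα rα =>
    have g : Good X.rank (fun _ => Set.univ) := by
      refine ⟨⟨?_, ?_, ?_, ?_, ?_, ?_⟩, ?_⟩ <;> simp
    exact (g.avail_add g.avail_gamma_succ ⟨rα, trivial⟩).1

/-- The body of a comprehension term is `Δ₀`, and its terms are `L_α(X)` or of smaller level. -/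
theorem IsTerm.compr_body {α : Ordinal.{u}} {B : Fml RTerm.{u} 1} (h : IsTerm X (.compr α B)) :
    B.IsDelta0 ∧ ∀ t ∈ B.params, IsTerm X t ∧ (t = .L α ∨ level X.rank t < Γ_ (X.rank + 1) + α) := by
  cases h with
  | compr _ hα rα A hA hl =>
    refine ⟨Fml.isDelta0_rel _ _, fun t ht => ?_⟩
    rcases Fml.params_rel A _ ht with h | h
    · exact ⟨hA t h, .inr (hl t h)⟩
    · obtain rfl : t = .L α := h
      exact ⟨.L α hα rα, .inl rfl⟩

theorem TOk.compr_body {α : Ordinal.{u}} {B : Fml RTerm.{u} 1} (h : TOk X H (.compr α B)) :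
    FOk X H B := fun t ht =>
  ⟨(h.1.compr_body.2 t ht).1, fun _ ⟨s, hs, e⟩ => h.2 ⟨s, .compr s t α B ht hs, e⟩⟩

theorem TOk.compr (hH : Good X.rank H) {α : Ordinal.{u}} (hα : Avail X.rank H α)
    (hlt : α < Om X.rank) {A : Fml RTerm.{u} 1} (hA : FOk X H A)
    (hl : ∀ s ∈ A.params, level X.rank s < Γ_ (X.rank + 1) + α) :
    TOk X H (.compr α (A.rel (.par (.L α)))) := by
  refine ⟨.compr α hlt hα.1 A (fun s hs => (hA s hs).1) hl, ?_⟩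
  rintro _ ⟨s, hs, rfl⟩
  cases hs with
  | refl => exact (hH.avail_add hH.avail_gamma_succ hα).2
  | compr r _ _ hr h =>
    rcases Fml.params_rel A _ hr with hr | hr
    · exact (hA r hr).2 ⟨s, h, rfl⟩
    · obtain rfl : r = .L α := hr
      exact (TOk.L hH hα hlt).2 ⟨s, h, rfl⟩

/-- `C` is the formula `s ∈̇ t`; there is none if `t` is of the form `L_α(X)`. -/
def IsDot (s : RTerm.{u}) : RTerm.{u} → RFml.{u} → Prop
  | .bar x, C => C = .mem (.par s) (.par (.bar x))
  | .L _, _ => False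
  | .compr _ B, C => C = B.inst s

theorem IsDot.fok {s t : RTerm.{u}} {C : RFml.{u}} (h : IsDot s t C) (hs : TOk X H s)
    (ht : TOk X H t) : FOk X H C := by
  cases t with
  | bar x => cases h; exact .mem hs ht
  | L α => exact h.elim
  | compr α B => cases h; exact ht.compr_body.inst hs

theorem IsDot.isDelta0 {s t : RTerm.{u}} {C : RFml.{u}} (h : IsDot s t C) (ht : IsTerm X t) :
    C.IsDelta0 := by
  cases t with
  | bar x => cases h; trivial
  | L α => exact h.elim
  | compr α B => cases h; simpa using ht.compr_body.1

/-- Reduces the three shapes of $t$ to two: either there is exactly one guard $s\mathrel{\dot\in}t$,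
joined by a connective, or $t$ is some $\mathbb L_\alpha(X)$ and the guard disappears. -/
theorem dotImp_cases (s t : RTerm.{u}) (A : RFml.{u}) :
    (∃ C, IsDot s t C ∧ (∀ C', IsDot s t C' → C' = C) ∧ dotImp s t A = .or C.neg A ∧
      dotAnd s t A = .and C A) ∨
    ((∀ C, ¬ IsDot s t C) ∧ dotImp s t A = A ∧ dotAnd s t A = A) := by
  cases t with
  | bar x => exact .inl ⟨_, rfl, fun _ h => h, rfl, rfl⟩
  | L α => exact .inr ⟨fun _ h => h, rfl, rfl⟩
  | compr α B => exact .inl ⟨_, rfl, fun _ h => h, rfl, rfl⟩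

theorem FOk.dotImp {s t : RTerm.{u}} {A : RFml.{u}} (hs : TOk X H s) (ht : TOk X H t)
    (hA : FOk X H A) : FOk X H (dotImp s t A) := by
  rcases dotImp_cases s t A with ⟨C, hC, -, e, -⟩ | ⟨-, e, -⟩ <;> rw [e]
  · exact (hC.fok hs ht).neg.or hA
  · exact hA

theorem FOk.dotAnd {s t : RTerm.{u}} {A : RFml.{u}} (hs : TOk X H s) (ht : TOk X H t)
    (hA : FOk X H A) : FOk X H (dotAnd s t A) := by
  rcases dotImp_cases s t A with ⟨C, hC, -, -, e⟩ | ⟨-, -, e⟩ <;> rw [e]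
  · exact (hC.fok hs ht).and hA
  · exact hA

theorem kSeq_subset (hH : Good X.rank H) {Γ : Finset RFml.{u}} (hΓ : ∀ A ∈ Γ, FOk X H A) :
    kSeq X.rank Γ ⊆ H ∅ := by
  rintro α ⟨A, hA, ⟨t, ht, hα⟩ | ⟨-, rfl⟩⟩
  · exact (hΓ A hA t ht).2 hα
  · exact hH.om

theorem controlled_of_fok (hH : Good X.rank H) {Γ : Finset RFml.{u}}
    (hΓ : ∀ A ∈ Γ, FOk X H A) {α : Ordinal.{u}} (hα : Avail X.rank H α) : Controlled X H α Γ :=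
  ⟨fun A hA t ht => (hΓ A hA t ht).1, hα.1, hα.2, kSeq_subset hH hΓ⟩

/-- A formula contains finitely many terms, each with an available level below $\Omega$. The bound
$M$ is the stage at which witnesses for the axioms are built, and the starting point of the
$\Delta_0$ tautologies. -/
theorem exists_level_lt (hH : Good X.rank H) {n : ℕ} (A : Fml RTerm.{u} n) (hA : FOk X H A) :
    ∃ M, Avail X.rank H M ∧ M < Om X.rank ∧ ∀ t ∈ A.params, level X.rank t < M := by
  have key : ∀ P Q : Set RTerm.{u},
      (∃ M, Avail X.rank H M ∧ M < Om X.rank ∧ ∀ t ∈ P, level X.rank t < M) →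
      (∃ M, Avail X.rank H M ∧ M < Om X.rank ∧ ∀ t ∈ Q, level X.rank t < M) →
      ∃ M, Avail X.rank H M ∧ M < Om X.rank ∧ ∀ t ∈ P ∪ Q, level X.rank t < M := by
    rintro P Q ⟨M, h1, h2, h3⟩ ⟨N, k1, k2, k3⟩
    refine ⟨max M N, ?_, max_lt h2 k2, ?_⟩
    · rcases max_choice M N with e | e <;> rw [e] <;> assumption
    · rintro t (ht | ht)
      · exact (h3 t ht).trans_le (le_max_left _ _)
      · exact (k3 t ht).trans_le (le_max_right _ _)
  have ref : ∀ {n : ℕ} (r : Ref RTerm.{u} n), (∀ t ∈ r.params, TOk X H t) →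
      ∃ M, Avail X.rank H M ∧ M < Om X.rank ∧ ∀ t ∈ r.params, level X.rank t < M := by
    intro n r hr
    cases r with
    | par t =>
      have ht := hr t rfl
      refine ⟨level X.rank t + 1, hH.avail_add (ht.avail_level) hH.avail_one,
        (isSuccLimit_Om _).succ_lt ht.1.level_lt, ?_⟩
      rintro _ rfl
      exact Order.lt_succ _
    | bv i => exact ⟨0, hH.avail_zero, zero_le.trans_lt (lt_Om_self _), fun t ht => ht.elim⟩
  induction A with
  | mem r t | nmem r t =>
    exact key _ _ (ref r fun x hx => hA x (.inl hx)) (ref t fun x hx => hA x (.inr hx))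
  | and A B ihA ihB | or A B ihA ihB =>
    exact key _ _ (ihA fun x hx => hA x (.inl hx)) (ihB fun x hx => hA x (.inr hx))
  | ball r A ih | bex r A ih =>
    exact key _ _ (ref r fun x hx => hA x (.inl hx)) (ih fun x hx => hA x (.inr hx))
  | all A ih | ex A ih => exact ih hA

end Controlled

/-! ### Ranks -/

section Rank

variable {X : ZFSet.{u}}

/-- The number of connectives and quantifiers, with every occurrence of a term `t` in an atom or a
bound contributing a multiple of `w t`. -/
def wsize {T : Type v} (w : T → ℕ) : {n : ℕ} → Fml T n → ℕ
  | _, .mem s t => 2 * wref s + wref t + 1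
  | _, .nmem s t => 2 * wref s + wref t + 1
  | _, .and A B => wsize w A + wsize w B + 1
  | _, .or A B => wsize w A + wsize w B + 1
  | _, .ball t A => wref t + wsize w A + 1
  | _, .bex t A => wref t + wsize w A + 1
  | _, .all A => wsize w A + 1
  | _, .ex A => wsize w A + 1
where
  /-- The contribution of an argument place. -/
  wref : {n : ℕ} → Ref T n → ℕ
  | _, .par t => w t
  | _, .bv _ => 0

theorem wsize_pos {T : Type v} (w : T → ℕ) {n : ℕ} (A : Fml T n) : 1 ≤ wsize w A := by
  cases A <;> simp [wsize]

theorem wsize_neg {T : Type v} (w : T → ℕ) {n : ℕ} (A : Fml T n) :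
    wsize w A.neg = wsize w A := by
  induction A <;> simp_all [wsize, Fml.neg]

theorem wref_shift {T : Type v} (w : T → ℕ) {n : ℕ} (r : Ref T n) :
    wsize.wref w r.shift = wsize.wref w r := by
  cases r <;> rfl

theorem wref_subst {T : Type v} (w : T → ℕ) {n m : ℕ} (σ : Fin n → Ref T m)
    (hσ : ∀ i, wsize.wref w (σ i) = 0) (r : Ref T n) :
    wsize.wref w (r.subst σ) = wsize.wref w r := by
  cases r with
  | par t => rfl
  | bv i => exact hσ i

theorem wref_liftSubst {T : Type v} (w : T → ℕ) {n m : ℕ} (σ : Fin n → Ref T m)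
    (hσ : ∀ i, wsize.wref w (σ i) = 0) (i : Fin (n + 1)) :
    wsize.wref w (liftSubst σ i) = 0 := by
  refine Fin.cases rfl (fun j => ?_) i
  exact (wref_shift w _).trans (hσ j)

theorem wsize_subst {T : Type v} (w : T → ℕ) {n : ℕ} (A : Fml T n) : ∀ {m : ℕ}
    (σ : Fin n → Ref T m), (∀ i, wsize.wref w (σ i) = 0) → wsize w (A.subst σ) = wsize w A := by
  induction A with
  | mem r s | nmem r s => intro m σ hσ; simp [wsize, Fml.subst, wref_subst w σ hσ]
  | and A B ihA ihB | or A B ihA ihB =>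
    intro m σ hσ; simp [wsize, Fml.subst, ihA σ hσ, ihB σ hσ]
  | ball r A ih | bex r A ih =>
    intro m σ hσ
    simp [wsize, Fml.subst, wref_subst w σ hσ, ih _ (wref_liftSubst w σ hσ)]
  | all A ih | ex A ih => intro m σ hσ; simp [wsize, Fml.subst, ih _ (wref_liftSubst w σ hσ)]

theorem wsize_inst {T : Type v} (w : T → ℕ) (A : Fml T 1) (t : T) (ht : w t = 0) :
    wsize w (A.inst t) = wsize w A := wsize_subst w A _ fun _ => ht

theorem wref_mono {T : Type v} {w w' : T → ℕ} {n : ℕ} (r : Ref T n)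
    (h : ∀ t ∈ r.params, w t ≤ w' t) : wsize.wref w r ≤ wsize.wref w' r := by
  cases r with
  | par t => exact h t rfl
  | bv i => exact le_rfl

theorem wsize_mono {T : Type v} {w w' : T → ℕ} {n : ℕ} (A : Fml T n)
    (h : ∀ t ∈ A.params, w t ≤ w' t) : wsize w A ≤ wsize w' A := by
  induction A with
  | mem r s | nmem r s =>
    have h1 := wref_mono r fun t ht => h t (.inl ht)
    have h2 := wref_mono s fun t ht => h t (.inr ht)
    simp only [wsize]; omega
  | and A B ihA ihB | or A B ihA ihB =>
    have h1 := ihA fun t ht => h t (.inl ht)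
    have h2 := ihB fun t ht => h t (.inr ht)
    simp only [wsize]; omega
  | ball r A ih | bex r A ih =>
    have h1 := wref_mono r fun t ht => h t (.inl ht)
    have h2 := ih fun t ht => h t (.inr ht)
    simp only [wsize]; omega
  | all A ih | ex A ih =>
    have h2 := ih h
    simp only [wsize]; omega

/-- The number of atoms, connectives and quantifiers. -/
abbrev Fml.size {T : Type v} {n : ℕ} (A : Fml T n) : ℕ := wsize (fun _ => 0) A

theorem Fml.size_subst {T : Type v} {n m : ℕ} (A : Fml T n) (σ : Fin n → Ref T m) :
    (A.subst σ).size = A.size :=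
  wsize_subst _ A σ fun i => by cases σ i <;> rfl

theorem wref_zero {T : Type v} {n : ℕ} (r : Ref T n) : wsize.wref (fun _ => 0) r = 0 := by
  cases r <;> rfl

theorem Fml.size_map {T : Type v} {S : Type w} (f : T → S) {n : ℕ} (A : Fml T n) :
    (A.map f).size = A.size := by
  induction A <;> simp_all [Fml.size, wsize, Fml.map, wref_zero]

theorem add_nat_lt_Om {θ a : Ordinal.{u}} (h : a < Om θ) (n : ℕ) : a + n < Om θ :=
  add_lt_Om h ((natCast_lt_omega0 n).trans (omega0_lt_Om θ))

theorem rkRef_lt {n : ℕ} (r : Ref RTerm.{u} n)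
    (hr : ∀ t ∈ r.params, rkTerm X.rank t < Om X.rank) : rkRef X.rank r < Om X.rank := by
  cases r with
  | par t => simpa [rkRef] using hr t rfl
  | bv i =>
    rw [rkRef]
    exact gamma_lt_Om (zero_le.trans_lt (lt_Om_self _))

/-- Replaces the case distinction on the bound by one estimate; the ranks are needed only as upper
bounds for cuts. -/
theorem rkFml_quantifier_le (θ : Ordinal.{u}) {n : ℕ} (r : Ref RTerm.{u} n)
    (A : Fml RTerm.{u} (n + 1)) :
    rkFml θ (.ball r A) ≤ max (rkRef θ r + 3) (rkFml θ A + 2) ∧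
      rkFml θ (.bex r A) ≤ max (rkRef θ r + 3) (rkFml θ A + 2) := by
  rcases r with t | i
  · cases t with
    | bar x => simp [rkFml, rkRef, rkTerm]
    | L α => constructor <;> rw [rkFml] <;> first | exact max_le_max_right _ le_self_add | (rintro _ _ _ rfl h; cases h) | simp
    | compr α B =>
      constructor <;> rw [rkFml] <;> first | exact max_le_max_right _ le_self_add | (rintro _ _ _ rfl h; cases h) | simp
  · simp [rkFml, rkRef]

/-- Only unbounded quantifiers force the rank up to $\Omega$; all other clauses add finite amounts.
Consequently $\Delta_0$ cuts are free as soon as $\rho\ge\Omega$. -/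
theorem rkFml_lt_of_isDelta0 {n : ℕ} (A : Fml RTerm.{u} n) (hA : A.IsDelta0)
    (ht : ∀ t ∈ A.params, rkTerm X.rank t < Om X.rank) : rkFml X.rank A < Om X.rank := by
  induction A with
  | mem r s | nmem r s =>
    have h1 := rkRef_lt r fun t h => ht t (.inl h)
    have h2 := rkRef_lt s fun t h => ht t (.inr h)
    rw [rkFml]
    exact max_lt (by exact_mod_cast add_nat_lt_Om h2 1) (by exact_mod_cast add_nat_lt_Om h1 6)
  | and A B ihA ihB | or A B ihA ihB =>
    rw [rkFml]
    have := max_lt (ihA hA.1 fun t h => ht t (.inl h)) (ihB hA.2 fun t h => ht t (.inr h))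
    exact_mod_cast add_nat_lt_Om this 1
  | ball r A ih =>
    have h1 := rkRef_lt r fun t h => ht t (.inl h)
    have h2 := ih hA fun t h => ht t (.inr h)
    exact (rkFml_quantifier_le _ r A).1.trans_lt
      (max_lt (by exact_mod_cast add_nat_lt_Om h1 3) (by exact_mod_cast add_nat_lt_Om h2 2))
  | bex r A ih =>
    have h1 := rkRef_lt r fun t h => ht t (.inl h)
    have h2 := ih hA fun t h => ht t (.inr h)
    exact (rkFml_quantifier_le _ r A).2.trans_lt
      (max_lt (by exact_mod_cast add_nat_lt_Om h1 3) (by exact_mod_cast add_nat_lt_Om h2 2))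
  | all A | ex A => exact hA.elim

theorem IsTerm.rkTerm_lt {t : RTerm.{u}} (h : IsTerm X t) : rkTerm X.rank t < Om X.rank := by
  have hmul : ∀ α, α < Om X.rank → Γ_ (X.rank + 1) + ω * α < Om X.rank := fun α hα => by
    refine add_lt_Om (gamma_succ_lt_Om _) ?_
    rw [Om, Cardinal.lt_ord] at hα ⊢
    rw [card_mul, card_omega0]
    exact Cardinal.mul_lt_of_lt (isRegular_succ_max _).1 (aleph0_lt_succ_max _) hα
  induction h with
  | bar x hx =>
    rw [rkTerm]
    exact gamma_lt_Om (hx.rank_le.trans_lt (lt_Om_self _))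
  | L α hα =>
    rw [rkTerm]
    exact hmul α hα
  | compr α hα rα A hA hl ih =>
    rw [rkTerm]
    refine max_lt (by exact_mod_cast add_nat_lt_Om (hmul α hα) 1) ?_
    have : rkFml X.rank (A.rel (.par (.L α))) < Om X.rank := by
      refine rkFml_lt_of_isDelta0 _ (Fml.isDelta0_rel _ _) fun t ht => ?_
      rcases Fml.params_rel A _ ht with h | h
      · exact ih t h
      · obtain rfl : t = .L α := h
        rw [rkTerm]
        exact hmul α hα
    exact_mod_cast add_nat_lt_Om this 2

/-- Atoms and bounds stay below $\Omega$, and each connective or quantifier adds at most $2$. -/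
theorem rkFml_le {n : ℕ} (A : Fml RTerm.{u} n) (ht : ∀ t ∈ A.params, IsTerm X t) :
    rkFml X.rank A ≤ Om X.rank + (2 * A.size : ℕ) := by
  have base : ∀ {a : Ordinal.{u}} (k m : ℕ), a ≤ Om X.rank + (k : ℕ) → k + 2 ≤ m →
      a + 2 ≤ Om X.rank + (m : ℕ) := fun {a} k m ha hkm => by
    refine (add_le_add_left ha 2).trans ?_
    rw [add_assoc]
    gcongr
    exact_mod_cast hkm
  have one : ∀ {a : Ordinal.{u}}, a + 1 ≤ a + 2 := fun {a} => by
    gcongr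
    exact one_le_two
  induction A with
  | mem r s | nmem r s =>
    refine (rkFml_lt_of_isDelta0 _ ?_ fun t h => (ht t h).rkTerm_lt).le.trans le_self_add
    trivial
  | and A B ihA ihB | or A B ihA ihB =>
    have h1 := ihA fun t h => ht t (.inl h)
    have h2 := ihB fun t h => ht t (.inr h)
    rw [rkFml]
    have h3 := wsize_pos (fun _ => 0) A
    have h4 := wsize_pos (fun _ => 0) B
    refine one.trans ?_
    rcases max_choice (rkFml X.rank A) (rkFml X.rank B) with e | e <;> rw [e]
    · exact base _ _ h1 (by simp only [wsize, Fml.size]; omega)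
    · exact base _ _ h2 (by simp only [wsize, Fml.size]; omega)
  | ball r A ih =>
    have h1 := rkRef_lt r fun t h => (ht t (.inl h)).rkTerm_lt
    have h2 := ih fun t h => ht t (.inr h)
    refine (rkFml_quantifier_le _ r A).1.trans (max_le ?_ ?_)
    · exact (add_nat_lt_Om h1 3).le.trans le_self_add
    · exact base _ _ h2 (by simp only [wsize, Fml.size]; omega)
  | bex r A ih =>
    have h1 := rkRef_lt r fun t h => (ht t (.inl h)).rkTerm_lt
    have h2 := ih fun t h => ht t (.inr h)
    refine (rkFml_quantifier_le _ r A).2.trans (max_le ?_ ?_)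
    · exact (add_nat_lt_Om h1 3).le.trans le_self_add
    · exact base _ _ h2 (by simp only [wsize, Fml.size]; omega)
  | all A ih | ex A ih =>
    have h2 := ih ht
    rw [rkFml]
    refine max_le le_self_add (one.trans ?_)
    exact base _ _ h2 (by simp only [wsize, Fml.size]; omega)

end Rank

/-! ### Derived rules -/

section Rules

variable {X : ZFSet.{u}} {ρ : Ordinal.{u}} {H H' : Set Ordinal.{u} → Set Ordinal.{u}}
  {b : Ordinal.{u}} {n m : ℕ} {Γ : Finset RFml.{u}}

/-- `Γ` is derivable with every available height `α ≥ b + n`, provided that its terms are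
controlled by `H` and `b ≥ Ω` is available. -/
def Pf (X : ZFSet.{u}) (ρ : Ordinal.{u}) (H : Set Ordinal.{u} → Set Ordinal.{u}) (b : Ordinal.{u})
    (n : ℕ) (Γ : Finset RFml.{u}) : Prop :=
  Good X.rank H → (∀ A ∈ Γ, FOk X H A) → Avail X.rank H b → Om X.rank ≤ b →
    ∀ α, Avail X.rank H α → b + n ≤ α → RSDer X ρ H α Γ

theorem Good.avail_add_nat (hH : Good X.rank H) (hb : Avail X.rank H b) (n : ℕ) :
    Avail X.rank H (b + n) := hH.avail_add hb (hH.avail_nat n)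

theorem Avail.mono {θ α : Ordinal.{u}} (hH : H ≤ H') (h : Avail θ H α) : Avail θ H' α :=
  ⟨h.1, hH _ h.2⟩

theorem fok_insert {A : RFml.{u}} (hΓ : ∀ A ∈ Γ, FOk X H A) (hA : FOk X H A) :
    ∀ B ∈ insert A Γ, FOk X H B := fun B hB => by
  rcases Finset.mem_insert.1 hB with rfl | hB
  · exact hA
  · exact hΓ B hB

theorem add_nat_lt_of_succ_le {α : Ordinal.{u}} (h : b + (n + 1 : ℕ) ≤ α) : b + n < α := by
  refine lt_of_lt_of_le ?_ h
  gcongr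
  exact Nat.lt_succ_self n

namespace Pf

/-- Makes the side conditions built into `Pf` available while the derivation is being constructed.
-/
theorem intro (h : Good X.rank H → (∀ A ∈ Γ, FOk X H A) → Avail X.rank H b → Pf X ρ H b n Γ) :
    Pf X ρ H b n Γ := fun hH hΓ hb => h hH hΓ hb hH hΓ hb

theorem lift {b' : Ordinal.{u}} {n' : ℕ} (hb' : Avail X.rank H b') (hΩ : Om X.rank ≤ b')
    (hle : b' + n' ≤ b + n) (h : Pf X ρ H b' n' Γ) : Pf X ρ H b n Γ :=
  fun hH hΓ _ _ α hα hbα => h hH hΓ hb' hΩ α hα (hle.trans hbα)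

theorem le (h : Pf X ρ H b m Γ) (hnm : m ≤ n) : Pf X ρ H b n Γ :=
  fun hH hΓ hb hΩ α hα hbα => h hH hΓ hb hΩ α hα (le_trans (by gcongr) hbα)

/-- As in the rules below, the principal formula only has to be a member of $\Gamma$; in the rules
it also stays in the premises. Sequents thus only grow on the way up, and no weakening lemma is
needed. -/
theorem axMem {x y : ZFSet.{u}} (h : x ∈ y)
    (hΓ : (.mem (.par (.bar x)) (.par (.bar y)) : RFml.{u}) ∈ Γ) : Pf X ρ H b n Γ :=
  fun hH hok _ _ α hα _ => by
    have hc := controlled_of_fok hH hok hα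
    rw [← Finset.insert_eq_of_mem hΓ] at hc ⊢
    exact .axMem Γ x y hc h

theorem axNmem {x y : ZFSet.{u}} (h : x ∉ y)
    (hΓ : (.nmem (.par (.bar x)) (.par (.bar y)) : RFml.{u}) ∈ Γ) : Pf X ρ H b n Γ :=
  fun hH hok _ _ α hα _ => by
    have hc := controlled_of_fok hH hok hα
    rw [← Finset.insert_eq_of_mem hΓ] at hc ⊢
    exact .axNmem Γ x y hc h

theorem and {A B : RFml.{u}} (h : A.and B ∈ Γ) (hA : Pf X ρ H b n (insert A Γ))
    (hB : Pf X ρ H b n (insert B Γ)) : Pf X ρ H b (n + 1) Γ :=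
  fun hH hok hb hΩ α hα hle => by
    have hc := controlled_of_fok hH hok hα
    have hn := hH.avail_add_nat hb n
    have hlt := add_nat_lt_of_succ_le hle
    rw [← Finset.insert_eq_of_mem h] at hc ⊢
    exact .and Γ A B hc _ _ hlt hlt
      (hA hH (fok_insert hok fun t ht => hok _ h t (.inl ht)) hb hΩ _ hn le_rfl)
      (hB hH (fok_insert hok fun t ht => hok _ h t (.inr ht)) hb hΩ _ hn le_rfl)

theorem orLeft {A B : RFml.{u}} (h : A.or B ∈ Γ) (hA : Pf X ρ H b n (insert A Γ)) :
    Pf X ρ H b (n + 1) Γ :=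
  fun hH hok hb hΩ α hα hle => by
    have hc := controlled_of_fok hH hok hα
    have hn := hH.avail_add_nat hb n
    have hlt := add_nat_lt_of_succ_le hle
    rw [← Finset.insert_eq_of_mem h] at hc ⊢
    exact .or Γ A B A hc (.inl rfl) _ hlt
      (hA hH (fok_insert hok fun t ht => hok _ h t (.inl ht)) hb hΩ _ hn le_rfl)

theorem orRight {A B : RFml.{u}} (h : A.or B ∈ Γ) (hB : Pf X ρ H b n (insert B Γ)) :
    Pf X ρ H b (n + 1) Γ :=
  fun hH hok hb hΩ α hα hle => by
    have hc := controlled_of_fok hH hok hα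
    have hn := hH.avail_add_nat hb n
    have hlt := add_nat_lt_of_succ_le hle
    rw [← Finset.insert_eq_of_mem h] at hc ⊢
    exact .or Γ A B B hc (.inr rfl) _ hlt
      (hB hH (fok_insert hok fun t ht => hok _ h t (.inr ht)) hb hΩ _ hn le_rfl)

theorem or {A B : RFml.{u}} (h : A.or B ∈ Γ) (hAB : Pf X ρ H b n (insert B (insert A Γ))) :
    Pf X ρ H b (n + 2) Γ :=
  orLeft h (orRight (Finset.mem_insert_of_mem h) hAB)

theorem cut (A : RFml.{u}) (hA : FOk X H A) (hρ : rkFml X.rank A < ρ)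
    (h₀ : Pf X ρ H b n (insert A Γ)) (h₁ : Pf X ρ H b n (insert A.neg Γ)) :
    Pf X ρ H b (n + 1) Γ :=
  fun hH hok hb hΩ α hα hle => by
    have hn := hH.avail_add_nat hb n
    exact .cut Γ A (controlled_of_fok hH hok hα) hρ _ (add_nat_lt_of_succ_le hle)
      (h₀ hH (fok_insert hok hA) hb hΩ _ hn le_rfl)
      (h₁ hH (fok_insert hok hA.neg) hb hΩ _ hn le_rfl)

theorem cut_of_isDelta0 (hρ : Om X.rank ≤ ρ) (A : RFml.{u}) (hA : FOk X H A) (h0 : A.IsDelta0)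
    (h₀ : Pf X ρ H b n (insert A Γ)) (h₁ : Pf X ρ H b n (insert A.neg Γ)) :
    Pf X ρ H b (n + 1) Γ :=
  cut A hA ((rkFml_lt_of_isDelta0 A h0 fun t ht => (hA t ht).1.rkTerm_lt).trans_le hρ) h₀ h₁

theorem sigmaRef {A : RFml.{u}} (h : A.exRel ∈ Γ) (hA : A.IsSigma) (hok : FOk X H A)
    (hp : Pf X ρ H b n (insert A Γ)) : Pf X ρ H b (n + 1) Γ :=
  fun hH hΓ hb hΩ α hα hle => by
    have hc := controlled_of_fok hH hΓ hα
    have hn := hH.avail_add_nat hb n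
    have hlt := add_nat_lt_of_succ_le hle
    rw [← Finset.insert_eq_of_mem h] at hc ⊢
    exact .sigmaRef Γ A hc hA (hΩ.trans_lt (lt_of_le_of_lt le_self_add hlt)) _ hlt
      (hp hH (fok_insert hΓ hok) hb hΩ _ hn le_rfl)

/-- The side condition on witnesses is automatic: levels lie below $\Omega$, and all heights in use
are at least $\Omega$. -/
theorem level_lt_of_isTerm {s : RTerm.{u}} (hs : IsTerm X s) (hΩ : Om X.rank ≤ b)
    {α : Ordinal.{u}} (hle : b + n ≤ α) : level X.rank s < Γ_ (X.rank + 1) + α :=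
  hs.level_lt.trans_le ((hΩ.trans (le_self_add.trans hle)).trans le_add_self)

theorem ex {A : Fml RTerm.{u} 1} (h : .ex A ∈ Γ) (s : RTerm.{u}) (hs : TOk X H s)
    (hp : Pf X ρ H b n (insert (A.inst s) Γ)) : Pf X ρ H b (n + 1) Γ :=
  fun hH hΓ hb hΩ α hα hle => by
    have hc := controlled_of_fok hH hΓ hα
    have hn := hH.avail_add_nat hb n
    have hlt := add_nat_lt_of_succ_le hle
    have hA : FOk X H A := hΓ _ h
    rw [← Finset.insert_eq_of_mem h] at hc ⊢
    exact .ex Γ s A hc hs.1 (level_lt_of_isTerm hs.1 hΩ hle) _ hlt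
      (hp hH (fok_insert hΓ (hA.inst hs)) hb hΩ _ hn le_rfl)

theorem tok_ext (hH : Good X.rank H) {s : RTerm.{u}} (hs : IsTerm X s) :
    TOk X (ext H (kTerm X.rank s)) s :=
  ⟨hs, Set.subset_union_right.trans (hH.op.subset _)⟩

/-- The premise is asked for every operator above $H$ that controls $s$, not just for `ext H (kTerm
X.rank s)`. Nested applications then compose by transitivity of `≤`. -/
theorem all {A : Fml RTerm.{u} 1} (h : .all A ∈ Γ)
    (hp : ∀ s H', H ≤ H' → TOk X H' s → Pf X ρ H' b n (insert (A.inst s) Γ)) :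
    Pf X ρ H b (n + 1) Γ :=
  fun hH hΓ hb hΩ α hα hle => by
    have hc := controlled_of_fok hH hΓ hα
    have hn := hH.avail_add_nat hb n
    have hlt := add_nat_lt_of_succ_le hle
    have hA : FOk X H A := hΓ _ h
    rw [← Finset.insert_eq_of_mem h] at hc ⊢
    refine .all Γ A hc (fun _ => b + n) (fun _ _ => hlt) fun s hs => ?_
    have hle' : H ≤ ext H (kTerm X.rank s) := fun Y => hH.le_ext _ Y
    have hs' := tok_ext hH hs
    exact hp s _ hle' hs' (hH.ext _)
      (fok_insert (fun B hB => (hΓ B hB).mono hle') ((hA.mono hle').inst hs'))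
      (hb.mono hle') hΩ _ (hn.mono hle') le_rfl

theorem bex_dotAnd {t : RTerm.{u}} {A : Fml RTerm.{u} 1} (h : .bex (.par t) A ∈ Γ) (s : RTerm.{u})
    (hs : TOk X H s) (hst : level X.rank s < level X.rank t)
    (hp : Pf X ρ H b n (insert (dotAnd s t (A.inst s)) Γ)) : Pf X ρ H b (n + 1) Γ :=
  fun hH hΓ hb hΩ α hα hle => by
    have hc := controlled_of_fok hH hΓ hα
    have hn := hH.avail_add_nat hb n
    have hlt := add_nat_lt_of_succ_le hle
    have ht : TOk X H t := hΓ _ h t (.inl rfl)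
    have hA : FOk X H A := fun r hr => hΓ _ h r (.inr hr)
    rw [← Finset.insert_eq_of_mem h] at hc ⊢
    exact .bex Γ t s A hc hs.1 hst (level_lt_of_isTerm hs.1 hΩ hle) _ hlt
      (hp hH (fok_insert hΓ (.dotAnd hs ht (hA.inst hs))) hb hΩ _ hn le_rfl)

theorem ball_dotImp {t : RTerm.{u}} {A : Fml RTerm.{u} 1} (h : .ball (.par t) A ∈ Γ)
    (hp : ∀ s H', H ≤ H' → TOk X H' s → level X.rank s < level X.rank t →
      Pf X ρ H' b n (insert (dotImp s t (A.inst s)) Γ)) :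
    Pf X ρ H b (n + 1) Γ :=
  fun hH hΓ hb hΩ α hα hle => by
    have hc := controlled_of_fok hH hΓ hα
    have hn := hH.avail_add_nat hb n
    have hlt := add_nat_lt_of_succ_le hle
    have ht : TOk X H t := hΓ _ h t (.inl rfl)
    have hA : FOk X H A := fun r hr => hΓ _ h r (.inr hr)
    rw [← Finset.insert_eq_of_mem h] at hc ⊢
    refine .ball Γ t A hc (fun _ => b + n) (fun _ _ _ => hlt) fun s hs hst => ?_
    have hle' : H ≤ ext H (kTerm X.rank s) := fun Y => hH.le_ext _ Y
    have hs' := tok_ext hH hs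
    exact hp s _ hle' hs' hst (hH.ext _)
      (fok_insert (fun B hB => (hΓ B hB).mono hle')
        (.dotImp hs' (ht.mono hle') ((hA.mono hle').inst hs')))
      (hb.mono hle') hΩ _ (hn.mono hle') le_rfl

theorem mem_dotAnd_of_not_isBasic {r t : RTerm.{u}} (hbas : ¬ IsBasic r t)
    (h : .mem (.par r) (.par t) ∈ Γ) (s : RTerm.{u})
    (hs : TOk X H s) (hst : level X.rank s < level X.rank t)
    (hp : Pf X ρ H b n (insert (dotAnd s t (.eq (.par r) (.par s))) Γ)) :
    Pf X ρ H b (n + 1) Γ :=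
  fun hH hΓ hb hΩ α hα hle => by
    have hc := controlled_of_fok hH hΓ hα
    have hn := hH.avail_add_nat hb n
    have hlt := add_nat_lt_of_succ_le hle
    have hr : TOk X H r := hΓ _ h r (.inl rfl)
    have ht : TOk X H t := hΓ _ h t (.inr rfl)
    rw [← Finset.insert_eq_of_mem h] at hc ⊢
    exact .mem Γ r t s hc hbas hs.1 hst (level_lt_of_isTerm hs.1 hΩ hle) _ hlt
      (hp hH (fok_insert hΓ (.dotAnd hs ht (.eq hr hs))) hb hΩ _ hn le_rfl)

theorem nmem_dotImp_of_not_isBasic {r t : RTerm.{u}} (hbas : ¬ IsBasic r t)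
    (h : .nmem (.par r) (.par t) ∈ Γ)
    (hp : ∀ s H', H ≤ H' → TOk X H' s → level X.rank s < level X.rank t →
      Pf X ρ H' b n (insert (dotImp s t (Fml.neg (.eq (.par r) (.par s)))) Γ)) :
    Pf X ρ H b (n + 1) Γ :=
  fun hH hΓ hb hΩ α hα hle => by
    have hc := controlled_of_fok hH hΓ hα
    have hn := hH.avail_add_nat hb n
    have hlt := add_nat_lt_of_succ_le hle
    have hr : TOk X H r := hΓ _ h r (.inl rfl)
    have ht : TOk X H t := hΓ _ h t (.inr rfl)
    rw [← Finset.insert_eq_of_mem h] at hc ⊢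
    refine .nmem Γ r t hc hbas (fun _ => b + n) (fun _ _ _ => hlt) fun s hs hst => ?_
    have hle' : H ≤ ext H (kTerm X.rank s) := fun Y => hH.le_ext _ Y
    have hs' := tok_ext hH hs
    exact hp s _ hle' hs' hst (hH.ext _)
      (fok_insert (fun B hB => (hΓ B hB).mono hle')
        (.dotImp hs' (ht.mono hle') (FOk.eq (hr.mono hle') hs').neg))
      (hb.mono hle') hΩ _ (hn.mono hle') le_rfl

end Pf

end Rules

-- Guarded rules and tautologies for $\Delta_0$ formulas

section Taut

variable {X : ZFSet.{u}} {ρ : Ordinal.{u}} {H H' : Set Ordinal.{u} → Set Ordinal.{u}}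
  {b : Ordinal.{u}} {n m : ℕ} {Γ : Finset RFml.{u}}

/-- The levels of the terms $\bar u$ are at most $\Gamma_\theta$, and all other terms start at
$\Gamma_{\theta+1}$. -/
theorem exists_bar_of_level_lt {q : RTerm.{u}} {x : ZFSet.{u}} (hq : IsTerm X q)
    (hx : IsTerm X (.bar x)) (h : level X.rank q < level X.rank (.bar x)) : ∃ y, q = .bar y := by
  have hlt : level X.rank (.bar x) < Γ_ (X.rank + 1) :=
    gamma_lt_gamma.2 (Order.lt_succ_iff.2 hx.inTC.rank_le)
  cases q with
  | bar y => exact ⟨y, rfl⟩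
  | L α => exact absurd (h.trans hlt) (not_lt.2 le_self_add)
  | compr α B => exact absurd (h.trans hlt) (not_lt.2 le_self_add)

/-- The sequent contains the negation of `q ∈̇ t`, if there is such a formula. -/
def DotHyp (q t : RTerm.{u}) (Γ : Finset RFml.{u}) : Prop := ∀ C, IsDot q t C → C.neg ∈ Γ

theorem DotHyp.mono {q t : RTerm.{u}} {Γ Γ' : Finset RFml.{u}} (h : DotHyp q t Γ) (hΓ : Γ ⊆ Γ') :
    DotHyp q t Γ' := fun C hC => hΓ (h C hC)

/-- The sequents that contain both `q ∈̇ t` and its negation are derivable. -/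
def DotTaut (X : ZFSet.{u}) (ρ : Ordinal.{u}) (H : Set Ordinal.{u} → Set Ordinal.{u})
    (b : Ordinal.{u}) (n : ℕ) (q t : RTerm.{u}) : Prop :=
  ∀ C Γ, IsDot q t C → C ∈ Γ → C.neg ∈ Γ → Pf X ρ H b n Γ

namespace Pf

/-- Turns the guard of a premise into the hypothesis `DotHyp`. For $\mathbb L_\alpha(X)$ there is
nothing to decompose and `DotHyp` is vacuous, so later proofs need not distinguish shapes of $t$. -/
theorem dotImp {q t : RTerm.{u}} {A : RFml.{u}} (h : dotImp q t A ∈ Γ)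
    (hp : ∀ Γ', Γ ⊆ Γ' → DotHyp q t Γ' → A ∈ Γ' → Pf X ρ H b n Γ') : Pf X ρ H b (n + 2) Γ := by
  rcases dotImp_cases q t A with ⟨C, -, hC, e, -⟩ | ⟨hC, e, -⟩ <;> rw [e] at h
  · refine or h (hp _ ?_ (fun C' hC' => ?_) (by simp))
    · exact (Finset.subset_insert _ _).trans (Finset.subset_insert _ _)
    · rw [hC C' hC']
      simp
  · exact (hp Γ subset_rfl (fun C hC' => (hC C hC').elim) h).le (by omega)

theorem dotAnd {q t : RTerm.{u}} {A : RFml.{u}} (h : dotAnd q t A ∈ Γ) (hq : DotHyp q t Γ)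
    (hT : DotTaut X ρ H b n q t) (hp : Pf X ρ H b n (insert A Γ)) : Pf X ρ H b (n + 1) Γ := by
  rcases dotImp_cases q t A with ⟨C, hC, -, -, e⟩ | ⟨hC, -, e⟩ <;> rw [e] at h
  · exact and h (hT C _ hC (by simp) (Finset.mem_insert_of_mem (hq C hC))) hp
  · rw [Finset.insert_eq_of_mem h] at hp
    exact hp.le (by omega)

theorem ball {t : RTerm.{u}} {A : Fml RTerm.{u} 1} (h : .ball (.par t) A ∈ Γ)
    (hp : ∀ s H' Γ', H ≤ H' → TOk X H' s → level X.rank s < level X.rank t → Γ ⊆ Γ' →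
      DotHyp s t Γ' → A.inst s ∈ Γ' → Pf X ρ H' b n Γ') : Pf X ρ H b (n + 3) Γ :=
  ball_dotImp h fun s H' hH' hs hst => dotImp (by simp) fun Γ' hΓ' =>
    hp s H' Γ' hH' hs hst ((Finset.subset_insert _ _).trans hΓ')

theorem bex {t : RTerm.{u}} {A : Fml RTerm.{u} 1} (h : .bex (.par t) A ∈ Γ) (s : RTerm.{u})
    (hs : TOk X H s) (hst : level X.rank s < level X.rank t) (hq : DotHyp s t Γ)
    (hT : DotTaut X ρ H b n s t) (hp : ∀ Γ', Γ ⊆ Γ' → A.inst s ∈ Γ' → Pf X ρ H b n Γ') :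
    Pf X ρ H b (n + 2) Γ :=
  bex_dotAnd h s hs hst <| dotAnd (Finset.mem_insert_self _ _) (hq.mono (Finset.subset_insert _ _)) hT <|
    hp _ ((Finset.subset_insert _ _).trans (Finset.subset_insert _ _))
      (Finset.mem_insert_self _ _)

theorem sub_bar_self {x : ZFSet.{u}} (h : Fml.sub (.bar x) (.bar x) ∈ Γ) :
    Pf X ρ H b (n + 3) Γ := by
  refine intro fun _ hΓ _ => ball h fun s H' Γ' hH hs hst hΓ' hq hmem => ?_
  obtain ⟨y, rfl⟩ := exists_bar_of_level_lt hs.1 (hΓ _ h _ (.inl rfl)).1 hst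
  by_cases hy : y ∈ x
  · exact axMem hy hmem
  · exact axNmem hy (hq _ rfl)

theorem nsub_bar {x y z : ZFSet.{u}} (hx : z ∈ x) (hy : z ∉ y)
    (h : Fml.nsub (.bar x) (.bar y) ∈ Γ) : Pf X ρ H b (n + 2) Γ := by
  refine intro fun hH hΓ _ => bex_dotAnd h (.bar z)
    (.bar hH ((hΓ _ h _ (.inl rfl)).1.inTC.mem hx))
    (gamma_lt_gamma.2 (ZFSet.rank_lt_of_mem hx)) (and (Finset.mem_insert_self _ _) ?_ ?_)
  · exact axMem hx (by simp)
  · exact axNmem hy (Finset.mem_insert_self _ _)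

/-- Rule `(∉)`, also for basic formulas. -/
theorem nmem (hρ : Om X.rank ≤ ρ) {r t : RTerm.{u}} (h : .nmem (.par r) (.par t) ∈ Γ)
    (hp : ∀ s H' Γ', H ≤ H' → TOk X H' s → level X.rank s < level X.rank t → Γ ⊆ Γ' →
      DotHyp s t Γ' → Fml.nsub r s ∈ Γ' → Fml.nsub s r ∈ Γ' → Pf X ρ H' b n Γ') :
    Pf X ρ H b (n + 5) Γ := by
  by_cases hb : IsBasic r t
  · obtain ⟨⟨x, rfl⟩, ⟨y, rfl⟩⟩ := hb
    by_cases hxy : x ∈ y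
    · refine intro fun hH hΓ _ => ?_
      have hr : TOk X H (.bar x) := hΓ _ h _ (.inl rfl)
      -- For $x\in y$ the required term is $s=\bar x$. The cut places $\bar x\not\subseteq\bar x$ in
      -- the sequent, where it serves as both halves of $r\ne s$, and $r\notin t$ itself is the
      -- negated guard.
      refine cut_of_isDelta0 hρ (Fml.sub (.bar x) (.bar x)) (.sub hr hr) trivial ?_ ?_
      · exact sub_bar_self (n := n + 1) (Finset.mem_insert_self _ _)
      · refine (hp (.bar x) H _ le_rfl hr (gamma_lt_gamma.2 (ZFSet.rank_lt_of_mem hxy))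
          (Finset.subset_insert _ _) ?_ (Finset.mem_insert_self _ _)
          (Finset.mem_insert_self _ _)).le (by omega)
        rintro _ rfl
        exact Finset.mem_insert_of_mem h
    · exact axNmem hxy h
  · refine nmem_dotImp_of_not_isBasic hb h fun s H' hH' hs hst =>
      dotImp (Finset.mem_insert_self _ _) fun Γ' hΓ' hq hm => or hm (hp s H' _ hH' hs hst ?_ (hq.mono ?_) ?_ ?_)
    · exact ((Finset.subset_insert _ _).trans hΓ').trans
        ((Finset.subset_insert _ _).trans (Finset.subset_insert _ _))
    · exact (Finset.subset_insert _ _).trans (Finset.subset_insert _ _)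
    · exact Finset.mem_insert_of_mem (Finset.mem_insert_self _ _)
    · exact Finset.mem_insert_self _ _

/-- Rule `(∈)`, also for basic formulas, in the presence of `s ∉̇ t`. -/
theorem mem (hρ : Om X.rank ≤ ρ) {r t : RTerm.{u}} (h : .mem (.par r) (.par t) ∈ Γ) (s : RTerm.{u})
    (hs : TOk X H s) (hst : level X.rank s < level X.rank t) (hq : DotHyp s t Γ)
    (hT : DotTaut X ρ H b (n + 1) s t) (h₁ : ∀ Γ', Γ ⊆ Γ' → Fml.sub r s ∈ Γ' → Pf X ρ H b n Γ')
    (h₂ : ∀ Γ', Γ ⊆ Γ' → Fml.sub s r ∈ Γ' → Pf X ρ H b n Γ') : Pf X ρ H b (n + 3) Γ := by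
  by_cases hb : IsBasic r t
  · obtain ⟨⟨x, rfl⟩, ⟨y, rfl⟩⟩ := hb
    refine intro fun hH hΓ _ => ?_
    have hr : TOk X H (.bar x) := hΓ _ h _ (.inl rfl)
    obtain ⟨z, rfl⟩ := exists_bar_of_level_lt hs.1 (hΓ _ h _ (.inr rfl)).1 hst
    by_cases hzy : z ∈ y
    · by_cases hxz : x = z
      · subst hxz
        exact axMem hzy h
      -- By extensionality some $v$ separates $x$ from $z$. One of the two inclusions is then false,
      -- its negation follows from the axioms, and a cut against `h₁` or `h₂` removes it.
      · rw [ZFSet.ext_iff, not_forall] at hxz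
        obtain ⟨v, hv⟩ := hxz
        by_cases hvx : v ∈ x
        · have hvz : v ∉ z := fun hvz => hv ⟨fun _ => hvz, fun _ => hvx⟩
          refine cut_of_isDelta0 hρ (Fml.sub (.bar x) (.bar z)) (.sub hr hs) trivial
            ((h₁ _ (Finset.subset_insert _ _) (Finset.mem_insert_self _ _)).le (by omega)) ?_
          exact nsub_bar hvx hvz (Finset.mem_insert_self _ _)
        · have hvz : v ∈ z := by
            by_contra hvz
            exact hv ⟨fun h => absurd h hvx, fun h => absurd h hvz⟩
          refine cut_of_isDelta0 hρ (Fml.sub (.bar z) (.bar x)) (.sub hs hr) trivial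
            ((h₂ _ (Finset.subset_insert _ _) (Finset.mem_insert_self _ _)).le (by omega)) ?_
          exact nsub_bar hvz hvx (Finset.mem_insert_self _ _)
    · exact axNmem hzy (hq _ rfl)
  · refine mem_dotAnd_of_not_isBasic hb h s hs hst (dotAnd (Finset.mem_insert_self _ _)
      (hq.mono (Finset.subset_insert _ _)) hT (and (Finset.mem_insert_self _ _) (h₁ _ ?_ ?_)
        (h₂ _ ?_ ?_)))
    · exact ((Finset.subset_insert _ _).trans (Finset.subset_insert _ _)).trans
        (Finset.subset_insert _ _)
    · exact Finset.mem_insert_self _ _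
    · exact ((Finset.subset_insert _ _).trans (Finset.subset_insert _ _)).trans
        (Finset.subset_insert _ _)
    · exact Finset.mem_insert_self _ _

end Pf

theorem dotTaut_bar {q : RTerm.{u}} {x : ZFSet.{u}}
    (hst : level X.rank q < level X.rank (.bar x)) : DotTaut X ρ H b n q (.bar x) := by
  rintro _ Γ rfl h h'
  refine Pf.intro fun _ hΓ _ => ?_
  obtain ⟨y, rfl⟩ := exists_bar_of_level_lt (hΓ _ h _ (.inl rfl)).1 (hΓ _ h _ (.inr rfl)).1 hst
  by_cases hy : y ∈ x
  · exact .axMem hy h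
  · exact .axNmem hy h'

/-- The weight of a term, without regard to its level. -/
def termWeight : RTerm.{u} → ℕ
  | .bar _ => 1
  | .L _ => 1
  | .compr _ B => wsize (fun _ => 1) B + 1

/-- The weight of terms relative to a bound `M` for the levels: terms of smaller level do not
count. -/
noncomputable def topWeight (θ M : Ordinal.{u}) (t : RTerm.{u}) : ℕ :=
  if level θ t < M then 0 else termWeight t

theorem topWeight_of_lt {θ M : Ordinal.{u}} {t : RTerm.{u}} (h : level θ t < M) :
    topWeight θ M t = 0 := if_pos h

theorem topWeight_pos {θ M : Ordinal.{u}} {t : RTerm.{u}} (h : ¬ level θ t < M) :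
    1 ≤ topWeight θ M t := by
  rw [topWeight, if_neg h]
  cases t <;> simp [termWeight]

/-- $\omega^M$ is additive principal, so descending to a smaller $M'$ pays for any finite number of
steps. -/
theorem base_lt_base {c M M' : Ordinal.{u}} (h : M' < M) (hM : ω ≤ M) (j : ℕ) :
    c + ω ^ M' + (j : ℕ) ≤ c + ω ^ M + n := by
  refine le_trans ?_ (le_self_add : c + ω ^ M ≤ _)
  rw [add_assoc]
  gcongr
  refine (isPrincipal_add_omega0_opow M ((opow_lt_opow_iff_right one_lt_omega0).2 h) ?_).le
  exact (natCast_lt_omega0 j).trans_le (hM.trans (right_le_opow _ one_lt_omega0))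

theorem omega0_le_level (θ : Ordinal.{u}) (t : RTerm.{u}) : ω ≤ level θ t := by
  cases t with
  | bar x => exact (omega0_lt_gamma _).le
  | L α => exact (omega0_lt_gamma _).le.trans le_self_add
  | compr α B => exact (omega0_lt_gamma _).le.trans le_self_add

theorem Good.avail_base (hH : Good X.rank H) {M : Ordinal.{u}} (hM : Avail X.rank H M) :
    Avail X.rank H (Om X.rank + ω ^ M) := hH.avail_add hH.avail_Om (hH.avail_opow hM)

/-- The outer induction is on the bound $M$ of the levels, the inner one on a weight in which terms
of level below $M$ count nothing. Instantiating a bounded quantifier inserts such a term, so the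
weight drops. A guard $B(q)$ for a term of level $M$ weighs less than the term, since that weight
includes the body. Atoms unfold into inclusions; once all levels are below $M$, the outer hypothesis
takes over. The factor $20$ generously covers the rules used per unit of weight. -/
theorem taut_delta0_base (hρ : Om X.rank ≤ ρ) (M : Ordinal.{u}) :
    ∀ (k : ℕ) (H : Set Ordinal.{u} → Set Ordinal.{u}) (A : RFml.{u}) (Γ : Finset RFml.{u}),
      Avail X.rank H M → A.IsDelta0 → (∀ t ∈ A.params, level X.rank t ≤ M) →
      wsize (topWeight X.rank M) A ≤ k → A ∈ Γ → A.neg ∈ Γ →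
      Pf X ρ H (Om X.rank + ω ^ M) (20 * k) Γ := by
  induction M using WellFoundedLT.induction with
  | ind M ihM =>
  intro k
  induction k with
  | zero =>
    intro H A Γ _ _ _ hk
    exact absurd hk (by have := wsize_pos (topWeight X.rank M) A; omega)
  | succ k ihk =>
  have lower : ∀ (H : Set Ordinal.{u} → Set Ordinal.{u}) (A : RFml.{u}) (Γ : Finset RFml.{u})
      (M' : Ordinal.{u}) (n : ℕ), M' < M → ω ≤ M → Avail X.rank H M' → A.IsDelta0 →
      (∀ t ∈ A.params, level X.rank t ≤ M') → A ∈ Γ → A.neg ∈ Γ →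
      Pf X ρ H (Om X.rank + ω ^ M) n Γ := by
    intro H A Γ M' n hlt hω hM' h0 hp h1 h2
    refine Pf.intro fun hH _ _ => (ihM M' hlt _ H A Γ hM' h0 hp le_rfl h1 h2).lift
      (hH.avail_base hM') le_self_add (base_lt_base hlt hω _)
  have lowAtom : ∀ (H : Set Ordinal.{u} → Set Ordinal.{u}) (r t : RTerm.{u})
      (Γ : Finset RFml.{u}) (n : ℕ), level X.rank r < M → level X.rank t < M →
      .mem (.par r) (.par t) ∈ Γ → .nmem (.par r) (.par t) ∈ Γ →
      Pf X ρ H (Om X.rank + ω ^ M) n Γ := by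
    intro H r t Γ n hr ht h1 h2
    refine Pf.intro fun hH hΓ _ => lower H (.mem (.par r) (.par t)) Γ
      (max (level X.rank r) (level X.rank t)) n (max_lt hr ht)
      ((omega0_le_level _ r).trans hr.le) ?_ trivial ?_ h1 h2
    · rcases max_choice (level X.rank r) (level X.rank t) with e | e <;> rw [e]
      · exact (hΓ _ h1 r (.inl rfl)).avail_level
      · exact (hΓ _ h1 t (.inr rfl)).avail_level
    · rintro _ (rfl | rfl)
      · exact le_max_left _ _
      · exact le_max_right _ _
  have dotT : ∀ (H : Set Ordinal.{u} → Set Ordinal.{u}) (q t : RTerm.{u}) (n : ℕ),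
      Avail X.rank H M → TOk X H t → level X.rank q < level X.rank t → level X.rank t ≤ M →
      topWeight X.rank M t ≤ k → 20 * k ≤ n → DotTaut X ρ H (Om X.rank + ω ^ M) n q t := by
    intro H q t n hM ht hqt htM hw hn
    cases t with
    | bar x => exact dotTaut_bar hqt
    | L α => exact fun C Γ hC => hC.elim
    | compr α B =>
      rintro _ Γ rfl h1 h2
      have hlev : ∀ s ∈ (B.inst q).params, level X.rank s ≤ level X.rank (.compr α B) := by
        intro s hs
        rcases Fml.params_inst hs with hs | rfl
        · rcases (ht.1.compr_body.2 s hs).2 with rfl | h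
          · exact le_rfl
          · exact h.le
        · exact hqt.le
      have h0 : (B.inst q).IsDelta0 := by simpa using ht.1.compr_body.1
      rcases htM.lt_or_eq with hlt | heq
      · exact lower H _ Γ _ n hlt ((omega0_le_level _ _).trans htM) ht.avail_level h0 hlev h1 h2
      -- Here $t$ has level exactly $M$. The term $q$ weighs nothing, and a parameter of $B$ is
      -- either $\mathbb L_\alpha(X)$, of weight $1$, or of level below $M$, of weight $0$.
      · refine (ihk H (B.inst q) Γ hM h0 (fun s hs => (hlev s hs).trans htM) ?_ h1 h2).le hn
        rw [wsize_inst _ _ _ (topWeight_of_lt (hqt.trans_eq heq))]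
        rw [topWeight, if_neg (not_lt.2 heq.ge)] at hw
        refine (wsize_mono B fun s hs => ?_).trans (Nat.le_of_succ_le hw)
        rcases (ht.1.compr_body.2 s hs).2 with rfl | h
        · rw [topWeight]
          split <;> simp [termWeight]
        · rw [topWeight_of_lt (h.trans_eq heq)]
          exact zero_le
  have atom : ∀ (H : Set Ordinal.{u} → Set Ordinal.{u}) (r t : RTerm.{u}) (Γ : Finset RFml.{u}),
      Avail X.rank H M → level X.rank r ≤ M → level X.rank t ≤ M →
      2 * topWeight X.rank M r + topWeight X.rank M t ≤ k →
      .mem (.par r) (.par t) ∈ Γ → .nmem (.par r) (.par t) ∈ Γ →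
      Pf X ρ H (Om X.rank + ω ^ M) (20 * (k + 1)) Γ := by
    intro H r t Γ hM hr ht hw h1 h2
    have subT : ∀ (H' : Set Ordinal.{u} → Set Ordinal.{u}) (p p' : RTerm.{u})
        (Γ' : Finset RFml.{u}), H ≤ H' → level X.rank p ≤ M → topWeight X.rank M p ≤ k →
        (level X.rank p' < M ∨ level X.rank p' ≤ M ∧ topWeight X.rank M p' + 1 ≤ k) →
        Fml.sub p p' ∈ Γ' → Fml.nsub p p' ∈ Γ' →
        Pf X ρ H' (Om X.rank + ω ^ M) (20 * k + 5) Γ' := by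
      intro H' p p' Γ' hH' hp hwp hp' g1 g2
      refine Pf.intro fun hH hΓ _ => Pf.ball g1 fun y H2 Γ2 hH2 hy hyp hΓ2 hq hmem =>
        Pf.bex (hΓ2 g2) y hy hyp hq (dotT H2 y p _ (hM.mono (hH'.trans hH2))
          ((hΓ _ g1 p (.inl rfl)).mono hH2) hyp hp hwp le_rfl) fun Γ3 hΓ3 hnm => ?_
      have hyM := hyp.trans_le hp
      rcases hp' with hp' | ⟨hp', hw'⟩
      · exact lowAtom H2 y p' Γ3 _ hyM hp' (hΓ3 hmem) hnm
      · refine ihk H2 (.mem (.par y) (.par p')) Γ3 (hM.mono (hH'.trans hH2)) trivial ?_ ?_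
          (hΓ3 hmem) hnm
        · rintro _ (rfl | rfl)
          · exact hyM.le
          · exact hp'
        · simp only [wsize, wsize.wref, topWeight_of_lt hyM]
          omega
    refine Pf.intro fun hH hΓ _ => ?_
    refine Pf.le (m := 20 * k + 5 + 3 + 5) (Pf.nmem hρ h2
      fun s H' Γ' hH' hs hst hΓ' hq hn1 hn2 => ?_) (by omega)
    have hsM := hst.trans_le ht
    refine Pf.mem hρ (hΓ' h1) s hs hst hq (dotT H' s t _ (hM.mono hH')
      ((hΓ _ h1 t (.inr rfl)).mono hH') hst ht (by omega) (by omega)) ?_ ?_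
    · intro Γ2 hΓ2 hsub
      exact subT H' r s Γ2 hH' hr (by omega) (.inl hsM) hsub (hΓ2 hn1)
    · intro Γ2 hΓ2 hsub
      refine subT H' s r Γ2 hH' hsM.le (by rw [topWeight_of_lt hsM]; exact zero_le) ?_ hsub
        (hΓ2 hn2)
      -- If $r$ has level $M$, it weighs at least $1$; the factor $2$ for the left side of an atom
      -- then pays for the step from $r\in t$ to $y\in r$.
      by_cases hrM : level X.rank r < M
      · exact .inl hrM
      · have := topWeight_pos hrM
        exact .inr ⟨hr, by omega⟩
  have quant : ∀ (H : Set Ordinal.{u} → Set Ordinal.{u}) (t : RTerm.{u}) (A : Fml RTerm.{u} 1)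
      (Γ : Finset RFml.{u}), Avail X.rank H M → A.IsDelta0 → level X.rank t ≤ M →
      (∀ s ∈ A.params, level X.rank s ≤ M) →
      topWeight X.rank M t + wsize (topWeight X.rank M) A ≤ k →
      .ball (.par t) A ∈ Γ → .bex (.par t) A.neg ∈ Γ →
      Pf X ρ H (Om X.rank + ω ^ M) (20 * (k + 1)) Γ := by
    intro H t A Γ hM h0 ht hp hw h1 h2
    refine Pf.intro fun hH hΓ _ => Pf.le (m := 20 * k + 2 + 3) (Pf.ball h1
      fun s H' Γ' hH' hs hst hΓ' hq hA => Pf.bex (hΓ' h2) s hs hst hq (dotT H' s t _ (hM.mono hH')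
        ((hΓ _ h1 t (.inl rfl)).mono hH') hst ht (by omega) le_rfl) fun Γ2 hΓ2 hnA => ?_) (by omega)
    refine ihk H' (A.inst s) Γ2 (hM.mono hH') (by simpa using h0) ?_ ?_ (hΓ2 hA) (by simpa using hnA)
    · intro r hr
      rcases Fml.params_inst hr with hr | rfl
      · exact hp r hr
      · exact (hst.trans_le ht).le
    · rw [wsize_inst _ _ _ (topWeight_of_lt (hst.trans_le ht))]
      omega
  have conn : ∀ (H : Set Ordinal.{u} → Set Ordinal.{u}) (A B : RFml.{u})
      (Γ : Finset RFml.{u}), Avail X.rank H M → A.IsDelta0 → B.IsDelta0 →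
      (∀ s ∈ A.params, level X.rank s ≤ M) → (∀ s ∈ B.params, level X.rank s ≤ M) →
      wsize (topWeight X.rank M) A + wsize (topWeight X.rank M) B ≤ k →
      .and A B ∈ Γ → .or A.neg B.neg ∈ Γ →
      Pf X ρ H (Om X.rank + ω ^ M) (20 * (k + 1)) Γ := by
    intro H A B Γ hM hA hB hpA hpB hw h1 h2
    refine Pf.le (m := 20 * k + 1 + 2) (Pf.or h2 (Pf.and (Finset.mem_insert_of_mem (Finset.mem_insert_of_mem h1)) ?_ ?_)) (by omega)
    · exact ihk H A _ hM hA hpA (by omega) (by simp) (by simp)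
    · exact ihk H B _ hM hB hpB (by omega) (by simp) (by simp)
  intro H A Γ hM h0 hp hk h1 h2
  cases A with
  | mem r t =>
    obtain ⟨r⟩ := r
    obtain ⟨t⟩ := t
    simp only [wsize, wsize.wref] at hk
    exact atom H r t Γ hM (hp _ (.inl rfl)) (hp _ (.inr rfl)) (by omega) h1 h2
  -- For the dual connectives the roles of $A$ and $\neg A$ are exchanged.
  | nmem r t =>
    obtain ⟨r⟩ := r
    obtain ⟨t⟩ := t
    simp only [wsize, wsize.wref] at hk
    exact atom H r t Γ hM (hp _ (.inl rfl)) (hp _ (.inr rfl)) (by omega) h2 h1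
  | and A B =>
    simp only [wsize] at hk
    exact conn H A B Γ hM h0.1 h0.2 (fun s hs => hp s (.inl hs)) (fun s hs => hp s (.inr hs))
      (by omega) h1 h2
  | or A B =>
    simp only [wsize] at hk
    exact conn H A.neg B.neg Γ hM (by simpa using h0.1) (by simpa using h0.2)
      (fun s hs => hp s (.inl (by simpa using hs))) (fun s hs => hp s (.inr (by simpa using hs)))
      (by rw [wsize_neg, wsize_neg]; omega) h2 (by simpa using h1)
  | ball t A =>
    obtain ⟨t⟩ := t
    simp only [wsize, wsize.wref] at hk
    exact quant H t A Γ hM h0 (hp _ (.inl rfl)) (fun s hs => hp s (.inr hs)) (by omega) h1 h2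
  | bex t A =>
    obtain ⟨t⟩ := t
    simp only [wsize, wsize.wref] at hk
    exact quant H t A.neg Γ hM (by simpa [Fml.IsDelta0] using h0) (hp _ (.inl rfl))
      (fun s hs => hp s (.inr (by simpa using hs))) (by rw [wsize_neg]; omega) h2 (by simpa using h1)
  | all A => exact h0.elim
  | ex A => exact h0.elim

/-- `A, ¬A` is derivable for every `Δ₀` formula `A`. -/
theorem taut_delta0 (hρ : Om X.rank ≤ ρ) (hb : Om X.rank * (2 : ℕ) ≤ b) {A : RFml.{u}}
    (h0 : A.IsDelta0) (h1 : A ∈ Γ) (h2 : A.neg ∈ Γ) : Pf X ρ H b n Γ := by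
  refine Pf.intro fun hH hΓ _ => ?_
  obtain ⟨M, hM, hMΩ, hlt⟩ := exists_level_lt hH A (hΓ A h1)
  refine (taut_delta0_base hρ M _ H A Γ hM h0 (fun t ht => (hlt t ht).le) le_rfl h1 h2).lift
    (hH.avail_base hM) le_self_add (le_trans ?_ (hb.trans le_self_add))
  -- Since $M<\Omega$, also $\omega^M$ plus a finite number is below $\Omega$; the second copy of
  -- $\Omega$ absorbs it.
  rw [show ((2 : ℕ) : Ordinal.{u}) = 1 + 1 by norm_num, mul_add, mul_one, add_assoc]
  gcongr
  refine (add_nat_lt_Om ?_ _).le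
  rw [← opow_Om]
  exact (opow_lt_opow_iff_right one_lt_omega0).2 hMΩ

/-- Guards are $\Delta_0$, so from height $\Omega\cdot 2$ on the side condition of the guarded rules
is automatic. -/
theorem dotTaut (hρ : Om X.rank ≤ ρ) (hb : Om X.rank * (2 : ℕ) ≤ b) {q t : RTerm.{u}}
    (ht : IsTerm X t) : DotTaut X ρ H b n q t :=
  fun _ _ hC h1 h2 => taut_delta0 hρ hb (hC.isDelta0 ht) h1 h2

end Taut

-- Laws of equality and tautologies for all formulas

section Equality

variable {X : ZFSet.{u}} {ρ : Ordinal.{u}} {H H' : Set Ordinal.{u} → Set Ordinal.{u}}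
  {b : Ordinal.{u}} {n m : ℕ} {Γ : Finset RFml.{u}}

theorem Om_mul_mono {θ : Ordinal.{u}} {i j : ℕ} (h : i ≤ j) (hb : Om θ * (j : ℕ) ≤ b) :
    Om θ * (i : ℕ) ≤ b := by
  refine le_trans ?_ hb
  gcongr

theorem Om_mul_succ (θ : Ordinal.{u}) (i : ℕ) : Om θ * ((i + 1 : ℕ) : Ordinal.{u}) = Om θ * i + Om θ := by
  rw [Nat.cast_succ, mul_add_one]

theorem Om_le_of_mul_le {θ : Ordinal.{u}} {i : ℕ} (hb : Om θ * ((i + 1 : ℕ) : Ordinal.{u}) ≤ b) : Om θ ≤ b := by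
  rw [Om_mul_succ] at hb
  exact le_add_self.trans hb

theorem opow_level_add_le {s : RTerm.{u}} (hs : IsTerm X s) {i : ℕ} (j : ℕ)
    (hb : Om X.rank * ((i + 1 : ℕ) : Ordinal.{u}) ≤ b) :
    Om X.rank * i + ω ^ level X.rank s + (j : ℕ) ≤ b + n := by
  refine le_trans ?_ (hb.trans le_self_add)
  rw [Om_mul_succ, add_assoc]
  gcongr
  refine (add_nat_lt_Om ?_ _).le
  rw [← opow_Om]
  exact (opow_lt_opow_iff_right one_lt_omega0).2 hs.level_lt

theorem Good.avail_level_base (hH : Good X.rank H) {s : RTerm.{u}} (hs : TOk X H s) (i : ℕ) :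
    Avail X.rank H (Om X.rank * i + ω ^ level X.rank s) :=
  hH.avail_add (hH.avail_mul_nat hH.avail_Om i) (hH.avail_opow hs.avail_level)

namespace Pf

/-- Lift a derivation whose height depends on the level of a term. -/
theorem of_level {s : RTerm.{u}} (hs : TOk X H s) {i j : ℕ}
    (hb : Om X.rank * ((i + 2 : ℕ) : Ordinal.{u}) ≤ b)
    (h : Pf X ρ H (Om X.rank * ((i + 1 : ℕ) : Ordinal.{u}) + ω ^ level X.rank s) j Γ) :
    Pf X ρ H b n Γ :=
  intro fun hH _ _ => h.lift (hH.avail_level_base hs (i + 1))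
    ((Om_le_of_mul_le le_rfl).trans le_self_add) (opow_level_add_le hs.1 j hb)

/-- The descent in inductions on levels: the finite count $j$ is forgotten when the level of the
controlling term decreases. -/
theorem of_level_lt {s t : RTerm.{u}} (hs : TOk X H s)
    (hst : level X.rank s < level X.rank t) {i j : ℕ}
    (h : Pf X ρ H (Om X.rank * ((i + 1 : ℕ) : Ordinal.{u}) + ω ^ level X.rank s) j Γ) :
    Pf X ρ H (Om X.rank * ((i + 1 : ℕ) : Ordinal.{u}) + ω ^ level X.rank t) n Γ :=
  intro fun hH _ _ => h.lift (hH.avail_level_base hs (i + 1))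
    ((Om_le_of_mul_le le_rfl).trans le_self_add) (base_lt_base hst (omega0_le_level _ t) j)

/-- From $q\mathrel{\dot\in}s$ one gets $q\in s$ with $q$ itself as the witness; the two halves of
$q=q$ are the induction hypothesis. -/
theorem sub_self_base (hρ : Om X.rank ≤ ρ) (s : RTerm.{u}) (h : Fml.sub s s ∈ Γ) :
    Pf X ρ H (Om X.rank * ((1 + 1 : ℕ) : Ordinal.{u}) + ω ^ level X.rank s) 6 Γ := by
  induction hl : level X.rank s using WellFoundedLT.induction generalizing s H Γ with
  | ind l ih =>
  subst hl
  refine intro fun hH hΓ _ => ball (n := 3) h fun q H' Γ' hH' hq hqs hΓ' hhyp hmem => ?_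
  exact mem hρ hmem q hq hqs hhyp (dotTaut hρ le_self_add (hΓ _ h s (.inl rfl)).1)
    (fun Γ2 _ h2 => of_level_lt hq hqs (ih _ hqs q h2 rfl))
    (fun Γ2 _ h2 => of_level_lt hq hqs (ih _ hqs q h2 rfl))

/-- `s ⊆ s`. -/
theorem sub_self (hρ : Om X.rank ≤ ρ) (hb : Om X.rank * (3 : ℕ) ≤ b) {s : RTerm.{u}}
    (h : Fml.sub s s ∈ Γ) : Pf X ρ H b n Γ :=
  intro fun _ hΓ _ => of_level (i := 1) (hΓ _ h s (.inl rfl)) hb (sub_self_base hρ s h)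

/-- The transitivity of inclusion, from the congruence of `∈` on its left for the elements of the
middle term. -/
theorem sub_trans_of (hρ : Om X.rank ≤ ρ) (hb : Om X.rank * (2 : ℕ) ≤ b) {a s c : RTerm.{u}}
    (hE : ∀ (H' : Set Ordinal.{u} → Set Ordinal.{u}) (y x : RTerm.{u}) (Γ' : Finset RFml.{u}),
      level X.rank y < level X.rank s → TOk X H' y → Fml.nsub y x ∈ Γ' → Fml.nsub x y ∈ Γ' →
      .nmem (.par y) (.par c) ∈ Γ' → .mem (.par x) (.par c) ∈ Γ' → Pf X ρ H' b n Γ')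
    (h₁ : Fml.nsub a s ∈ Γ) (h₂ : Fml.nsub s c ∈ Γ) (h₃ : Fml.sub a c ∈ Γ) :
    Pf X ρ H b (n + 12) Γ := by
  refine intro fun hH hΓ _ => ball (n := n + 9) h₃ fun x H1 Γ1 hH1 hx hxa hΓ1 hq1 hmem => ?_
  refine bex (n := n + 7) (hΓ1 h₁) x hx hxa hq1 (dotTaut hρ hb (hΓ _ h₁ a (.inl rfl)).1)
    fun Γ2 hΓ2 hnm => ?_
  refine nmem (n := n + 2) hρ hnm fun y H3 Γ3 hH3 hy hys hΓ3 hq3 hxy hyx => ?_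
  refine bex (hΓ3 (hΓ2 (hΓ1 h₂))) y hy hys hq3 (dotTaut hρ hb (hΓ _ h₂ s (.inl rfl)).1)
    fun Γ4 hΓ4 hnm' => ?_
  exact hE H3 y x Γ4 hys hy (hΓ4 hyx) (hΓ4 hxy) hnm' (hΓ4 (hΓ3 (hΓ2 hmem)))

/-- From $s\in r$ one obtains $p\mathrel{\dot\in}r$ with $s=p$, and $t=p$ follows from $t\subseteq
s\subseteq p$ and $p\subseteq s\subseteq t$. In both chains $s$ is the middle term, so congruence is
used only for terms of level below $|s|$, and an induction on $|s|$ with $t$ and $r$ arbitrary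
suffices. -/
theorem mem_congr_left_base (hρ : Om X.rank ≤ ρ) (s t r : RTerm.{u}) (h₁ : Fml.nsub s t ∈ Γ)
    (h₂ : Fml.nsub t s ∈ Γ) (h₃ : .nmem (.par s) (.par r) ∈ Γ) (h₄ : .mem (.par t) (.par r) ∈ Γ) :
    Pf X ρ H (Om X.rank * ((1 + 1 : ℕ) : Ordinal.{u}) + ω ^ level X.rank s) 20 Γ := by
  induction hl : level X.rank s using WellFoundedLT.induction generalizing s t r H Γ with
  | ind l ih =>
  subst hl
  refine intro fun hH hΓ _ => nmem (n := 15) hρ h₃ fun p H1 Γ1 hH1 hp hpr hΓ1 hq1 hsp hps => ?_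
  refine mem (n := 12) hρ (hΓ1 h₄) p hp hpr hq1
    (dotTaut hρ le_self_add (hΓ _ h₃ r (.inr rfl)).1) ?_ ?_
  · intro Γ2 hΓ2 hsub
    refine sub_trans_of (n := 0) hρ le_self_add (fun H' y x Γ' hys hy k1 k2 k3 k4 => ?_)
      (hΓ2 (hΓ1 h₂)) (hΓ2 hsp) hsub
    exact of_level_lt hy hys (ih _ hys y x p k1 k2 k3 k4 rfl)
  · intro Γ2 hΓ2 hsub
    refine sub_trans_of (n := 0) hρ le_self_add (fun H' y x Γ' hys hy k1 k2 k3 k4 => ?_)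
      (hΓ2 hps) (hΓ2 (hΓ1 h₁)) hsub
    exact of_level_lt hy hys (ih _ hys y x t k1 k2 k3 k4 rfl)

/-- `s = t → s ∈ r → t ∈ r`. -/
theorem mem_congr_left (hρ : Om X.rank ≤ ρ) (hb : Om X.rank * (3 : ℕ) ≤ b) {s t r : RTerm.{u}}
    (h₁ : Fml.nsub s t ∈ Γ) (h₂ : Fml.nsub t s ∈ Γ) (h₃ : .nmem (.par s) (.par r) ∈ Γ)
    (h₄ : .mem (.par t) (.par r) ∈ Γ) : Pf X ρ H b n Γ :=
  intro fun _ hΓ _ => of_level (i := 1) (hΓ _ h₁ s (.inl rfl)) hb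
    (mem_congr_left_base hρ s t r h₁ h₂ h₃ h₄)

/-- `s ⊆ t → x ∈ s → x ∈ t`. -/
theorem mem_congr_right (hρ : Om X.rank ≤ ρ) (hb : Om X.rank * (3 : ℕ) ≤ b) {s t x : RTerm.{u}}
    (h₁ : Fml.nsub s t ∈ Γ) (h₂ : .nmem (.par x) (.par s) ∈ Γ) (h₃ : .mem (.par x) (.par t) ∈ Γ) :
    Pf X ρ H b (n + 7) Γ := by
  refine intro fun hH hΓ _ => nmem (n := n + 2) hρ h₂ fun y H1 Γ1 hH1 hy hys hΓ1 hq1 hxy hyx => ?_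
  refine bex (hΓ1 h₁) y hy hys hq1 (dotTaut hρ (Om_mul_mono (by norm_num) hb)
    (hΓ _ h₁ s (.inl rfl)).1) fun Γ2 hΓ2 hnm => ?_
  exact mem_congr_left hρ hb (hΓ2 hyx) (hΓ2 hxy) hnm (hΓ2 (hΓ1 h₃))

/-- `s ∈̇ t → s ∈ t`. -/
theorem mem_of_dotHyp (hρ : Om X.rank ≤ ρ) (hb : Om X.rank * (3 : ℕ) ≤ b) {s t : RTerm.{u}}
    (hs : TOk X H s) (hst : level X.rank s < level X.rank t) (hq : DotHyp s t Γ)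
    (h : .mem (.par s) (.par t) ∈ Γ) : Pf X ρ H b (n + 3) Γ :=
  intro fun _ hΓ _ => mem hρ h s hs hst hq
    (dotTaut hρ (Om_mul_mono (by norm_num) hb) (hΓ _ h t (.inr rfl)).1)
    (fun _ _ h => sub_self hρ hb h) (fun _ _ h => sub_self hρ hb h)

/-- The common step for bounded quantifiers with equal bounds: an element $p$ of the bound $r'$ has
to be matched with an admissible witness for the bound $r$. -/
theorem quantifier_congr (hρ : Om X.rank ≤ ρ) (hb : Om X.rank * (3 : ℕ) ≤ b) {r r' : RTerm.{u}}
    {P Q : Fml RTerm.{u} 1} (hr : r = r' ∨ Fml.nsub r' r ∈ Γ) (h₁ : .ball (.par r') P ∈ Γ)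
    (h₂ : .bex (.par r) Q ∈ Γ)
    (hp : ∀ (H' : Set Ordinal.{u} → Set Ordinal.{u}) (p q : RTerm.{u}) (Γ' : Finset RFml.{u}),
      Γ ⊆ Γ' → Fml.nsub p q ∈ Γ' → Fml.nsub q p ∈ Γ' → P.inst p ∈ Γ' → Q.inst q ∈ Γ' →
      Pf X ρ H' b n Γ') :
    Pf X ρ H b (n + 20) Γ := by
  have hb2 := Om_mul_mono (i := 2) (by norm_num) hb
  refine intro fun hH hΓ _ => ball (n := n + 17) h₁ fun p H1 Γ1 hH1 hp1 hpr hΓ1 hq1 hP => ?_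
  have tr' : TOk X H1 r' := (hΓ _ h₁ r' (.inl rfl)).mono hH1
  have tr : TOk X H1 r := (hΓ _ h₂ r (.inl rfl)).mono hH1
  -- The level of $p$ need not be below $|r|$, so $p$ cannot be the witness. Decomposing $p\in r$ by
  -- $(\notin)$ yields an equal term $q$ that satisfies the guard of $r$.
  refine cut_of_isDelta0 (n := n + 16) hρ (.mem (.par p) (.par r)) (.mem hp1 tr) trivial ?_ ?_
  · rcases hr with rfl | hr
    · exact mem_of_dotHyp (n := n + 13) hρ hb hp1 hpr (hq1.mono (Finset.subset_insert _ _))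
        (Finset.mem_insert_self _ _)
    · refine cut_of_isDelta0 (n := n + 15) hρ (.mem (.par p) (.par r')) (.mem hp1 tr') trivial ?_ ?_
      · exact mem_of_dotHyp (n := n + 12) hρ hb hp1 hpr
          ((hq1.mono (Finset.subset_insert _ _)).mono (Finset.subset_insert _ _))
          (Finset.mem_insert_self _ _)
      · exact mem_congr_right (n := n + 8) hρ hb
          (Finset.mem_insert_of_mem (Finset.mem_insert_of_mem (hΓ1 hr)))
          (Finset.mem_insert_self _ _) (Finset.mem_insert_of_mem (Finset.mem_insert_self _ _))
  · refine nmem (n := n + 11) hρ (Finset.mem_insert_self _ _)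
      fun q H2 Γ2 hH2 hq2 hqr hΓ2 hyp2 hpq hqp => ?_
    have hΓ12 : Γ1 ⊆ Γ2 := (Finset.subset_insert _ _).trans hΓ2
    exact bex (n := n + 9) (hΓ12 (hΓ1 h₂)) q hq2 hqr hyp2 (dotTaut hρ hb2 tr.1) fun Γ3 hΓ3 hQ =>
      (hp H2 p q Γ3 ((hΓ1.trans hΓ12).trans hΓ3) (hΓ3 hpq) (hΓ3 hqp) (hΓ3 (hΓ12 hP)) hQ).le
        (by omega)

end Pf

/-- Close an argument place. -/
def Ref.close {T : Type v} (σ : Fin n → T) (r : Ref T n) : T :=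
  match n, r, σ with
  | _, .par t, _ => t
  | _, .bv i, σ => σ i

theorem Ref.subst_close {T : Type v} (σ : Fin n → T) (r : Ref T n) :
    (r.subst fun i => .par (σ i) : Ref T 0) = .par (r.close σ) := by
  cases r <;> rfl

/-- The terms `s` and `t` are identical, or `Γ` contains `s ⊈ t` and `t ⊈ s`. -/
def EqHyp (Γ : Finset RFml.{u}) (s t : RTerm.{u}) : Prop :=
  s = t ∨ Fml.nsub s t ∈ Γ ∧ Fml.nsub t s ∈ Γ

theorem EqHyp.symm {s t : RTerm.{u}} (h : EqHyp Γ s t) : EqHyp Γ t s :=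
  h.imp Eq.symm And.symm

theorem EqHyp.mono {Γ' : Finset RFml.{u}} (hΓ : Γ ⊆ Γ') {s t : RTerm.{u}} (h : EqHyp Γ s t) :
    EqHyp Γ' s t := h.imp_right fun h => ⟨hΓ h.1, hΓ h.2⟩

theorem EqHyp.ref {σ τ : Fin n → RTerm.{u}} (h : ∀ i, EqHyp Γ (σ i) (τ i))
    (r : Ref RTerm.{u} n) : EqHyp Γ (r.close σ) (r.close τ) := by
  cases r with
  | par t => exact .inl rfl
  | bv i => exact h i

theorem EqHyp.cons {σ τ : Fin n → RTerm.{u}} (h : ∀ i, EqHyp Γ (σ i) (τ i)) {s t : RTerm.{u}}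
    (hst : EqHyp Γ s t) (i : Fin (n + 1)) :
    EqHyp Γ ((Fin.cons s σ : Fin (n + 1) → RTerm.{u}) i)
      ((Fin.cons t τ : Fin (n + 1) → RTerm.{u}) i) :=
  Fin.cases hst h i

namespace Pf

theorem mem_congr (hρ : Om X.rank ≤ ρ) (hb : Om X.rank * (3 : ℕ) ≤ b) {r r' s s' : RTerm.{u}}
    (hr : EqHyp Γ r r') (hs : EqHyp Γ s s') (h₁ : .nmem (.par r) (.par s) ∈ Γ)
    (h₂ : .mem (.par r') (.par s') ∈ Γ) : Pf X ρ H b (n + 8) Γ := by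
  have hb2 := Om_mul_mono (i := 2) (by norm_num) hb
  refine intro fun hH hΓ _ => cut_of_isDelta0 (n := n + 7) hρ (.mem (.par r') (.par s))
    (.mem (hΓ _ h₂ r' (.inl rfl)) (hΓ _ h₁ s (.inr rfl))) trivial ?_ ?_
  · rcases hr with rfl | hr
    · exact taut_delta0 (A := .mem (.par r) (.par s)) hρ hb2 trivial (Finset.mem_insert_self _ _)
        (Finset.mem_insert_of_mem h₁)
    · exact mem_congr_left hρ hb (Finset.mem_insert_of_mem hr.1) (Finset.mem_insert_of_mem hr.2)
        (Finset.mem_insert_of_mem h₁) (Finset.mem_insert_self _ _)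
  · rcases hs with rfl | hs
    · exact taut_delta0 (A := .mem (.par r') (.par s)) hρ hb2 trivial (Finset.mem_insert_of_mem h₂)
        (Finset.mem_insert_self _ _)
    · exact mem_congr_right hρ hb (Finset.mem_insert_of_mem hs.1) (Finset.mem_insert_self _ _)
        (Finset.mem_insert_of_mem h₂)

/-- Formulas with equal terms are equivalent. -/
theorem congr (hρ : Om X.rank ≤ ρ) (hb : Om X.rank * (3 : ℕ) ≤ b) (A : Fml RTerm.{u} n)
    {σ τ : Fin n → RTerm.{u}} (hστ : ∀ i, EqHyp Γ (σ i) (τ i)) (h₁ : A.neg.close σ ∈ Γ)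
    (h₂ : A.close τ ∈ Γ) : Pf X ρ H b (20 * A.size) Γ := by
  induction A generalizing H Γ with
  | mem r s =>
    simp only [Fml.close, Fml.neg, Fml.subst, Ref.subst_close] at h₁ h₂
    exact (mem_congr (n := 0) hρ hb (EqHyp.ref hστ r) (EqHyp.ref hστ s) h₁ h₂).le
      (by simp only [Fml.size, wsize]; omega)
  | nmem r s =>
    simp only [Fml.close, Fml.neg, Fml.subst, Ref.subst_close] at h₁ h₂
    exact (mem_congr (n := 0) hρ hb (EqHyp.ref hστ r).symm (EqHyp.ref hστ s).symm h₂ h₁).le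
      (by simp only [Fml.size, wsize]; omega)
  | and A B ihA ihB =>
    refine le (m := 20 * (A.size + B.size) + 1 + 2) (or (A := A.neg.close σ) (B := B.neg.close σ) h₁
      (and (A := A.close τ) (B := B.close τ)
        (Finset.mem_insert_of_mem (Finset.mem_insert_of_mem h₂)) ?_ ?_))
      (by simp only [Fml.size, wsize]; omega)
    · exact (ihA (fun i => (hστ i).mono fun _ h => by simp [h]) (by simp) (by simp)).le (by omega)
    · exact (ihB (fun i => (hστ i).mono fun _ h => by simp [h]) (by simp) (by simp)).le (by omega)
  | or A B ihA ihB =>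
    refine le (m := 20 * (A.size + B.size) + 1 + 2) (or (A := A.close τ) (B := B.close τ) h₂
      (and (A := A.neg.close σ) (B := B.neg.close σ)
        (Finset.mem_insert_of_mem (Finset.mem_insert_of_mem h₁)) ?_ ?_))
      (by simp only [Fml.size, wsize]; omega)
    · exact (ihA (fun i => (hστ i).mono fun _ h => by simp [h]) (by simp) (by simp)).le (by omega)
    · exact (ihB (fun i => (hστ i).mono fun _ h => by simp [h]) (by simp) (by simp)).le (by omega)
  -- The bodies receive equal but possibly different terms $p$ and $q$; this forces a statement
  -- about two assignments.
  | ball r A ih =>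
    simp only [Fml.close, Fml.neg, Fml.subst, Ref.subst_close] at h₁ h₂
    refine le (m := 20 * A.size + 20) (quantifier_congr hρ hb
      ((EqHyp.ref hστ r).imp_right And.right) h₂ h₁ fun H' p q Γ' hΓ' hpq hqp hP hQ => ?_)
      (by simp only [Fml.size, wsize]; omega)
    rw [Fml.inst_subst_lift] at hP hQ
    exact ih (EqHyp.cons (fun i => (hστ i).mono hΓ') (.inr ⟨hqp, hpq⟩)) hQ hP
  | bex r A ih =>
    simp only [Fml.close, Fml.neg, Fml.subst, Ref.subst_close] at h₁ h₂
    refine le (m := 20 * A.size + 20) (quantifier_congr hρ hb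
      ((EqHyp.ref hστ r).symm.imp_right And.right) h₁ h₂ fun H' p q Γ' hΓ' hpq hqp hP hQ => ?_)
      (by simp only [Fml.size, wsize]; omega)
    rw [Fml.inst_subst_lift] at hP hQ
    exact ih (EqHyp.cons (fun i => (hστ i).mono hΓ') (.inr ⟨hpq, hqp⟩)) hP hQ
  | all A ih =>
    simp only [Fml.close, Fml.neg, Fml.subst] at h₁ h₂
    refine le (m := 20 * A.size + 1 + 1) (all h₂ fun p H' hH' hp =>
      ex (Finset.mem_insert_of_mem h₁) p hp ?_) (by simp only [Fml.size, wsize]; omega)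
    rw [Fml.inst_subst_lift, Fml.inst_subst_lift]
    exact ih (σ := Fin.cons p σ) (τ := Fin.cons p τ)
      (EqHyp.cons (fun i => (hστ i).mono fun _ h => by simp [h]) (.inl rfl)) (by simp)
      (by simp)
  | ex A ih =>
    simp only [Fml.close, Fml.neg, Fml.subst] at h₁ h₂
    refine le (m := 20 * A.size + 1 + 1) (all h₁ fun p H' hH' hp =>
      ex (Finset.mem_insert_of_mem h₂) p hp ?_) (by simp only [Fml.size, wsize]; omega)
    rw [Fml.inst_subst_lift, Fml.inst_subst_lift]
    exact ih (σ := Fin.cons p σ) (τ := Fin.cons p τ)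
      (EqHyp.cons (fun i => (hστ i).mono fun _ h => by simp [h]) (.inl rfl)) (by simp)
      (by simp)

/-- `A, ¬A` is derivable. -/
theorem taut (hρ : Om X.rank ≤ ρ) (hb : Om X.rank * (3 : ℕ) ≤ b) (A : RFml.{u}) (h₁ : A ∈ Γ)
    (h₂ : A.neg ∈ Γ) : Pf X ρ H b (20 * A.size) Γ := by
  -- Without free variables both assignments are empty and congruence becomes the tautology, with no
  -- restriction to $\Delta_0$.
  refine congr hρ hb A (σ := Fin.elim0) (τ := Fin.elim0) (fun i => i.elim0) ?_ ?_ <;>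
    rwa [Fml.close, Fml.subst_elim0]

/-- `s = t → A(s) → A(t)`. -/
theorem inst_congr (hρ : Om X.rank ≤ ρ) (hb : Om X.rank * (3 : ℕ) ≤ b) (A : Fml RTerm.{u} 1)
    {s t : RTerm.{u}} (hst : EqHyp Γ s t) (h₁ : A.neg.inst s ∈ Γ) (h₂ : A.inst t ∈ Γ) :
    Pf X ρ H b (20 * A.size) Γ :=
  congr hρ hb A (fun _ => hst) h₁ h₂

end Pf

end Equality

-- The non-logical axioms of KP

section Axioms

variable {X : ZFSet.{u}} {ρ : Ordinal.{u}} {H H' : Set Ordinal.{u} → Set Ordinal.{u}}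
  {b : Ordinal.{u}} {n m : ℕ} {Γ : Finset RFml.{u}}

theorem Fml.at'_subst {T : Type v} {k l : ℕ} (B : Fml T 1) (x : Ref T k) (σ : Fin k → Ref T l) :
    (B.at' x).subst σ = B.at' (x.subst σ) := Fml.subst_subst B _ σ

theorem Fml.at'_bv {T : Type v} (B : Fml T 1) : B.at' (.bv 0 : Ref T 1) = B := by
  rw [Fml.at', show (fun _ => .bv 0 : Fin 1 → Ref T 1) = Ref.var from
    funext fun i => by rw [Subsingleton.elim i 0]; rfl, Fml.subst_var]

theorem Fml.map_at' {T : Type v} {S : Type w} (f : T → S) {k : ℕ} (B : Fml T 1) (x : Ref T k) :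
    (B.at' x).map f = (B.map f).at' (x.map f) := Fml.map_subst f B _

namespace Pf

/-- One more copy of $\Omega$ hides a finite height that depends on the formula, which makes the
later bounds uniform. -/
theorem of_mul {i j : ℕ} (hb : Om X.rank * ((i + 2 : ℕ) : Ordinal.{u}) ≤ b)
    (h : Pf X ρ H (Om X.rank * ((i + 1 : ℕ) : Ordinal.{u})) j Γ) : Pf X ρ H b n Γ :=
  intro fun hH _ _ => h.lift (hH.avail_mul_nat hH.avail_Om _) (Om_le_of_mul_le le_rfl) <| by
    refine le_trans ?_ (hb.trans le_self_add)
    rw [Om_mul_succ X.rank (i + 1)]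
    gcongr
    exact ((natCast_lt_omega0 j).trans (omega0_lt_Om _)).le

/-- `A, ¬A` is derivable. -/
theorem taut_of_le (hρ : Om X.rank ≤ ρ) (hb : Om X.rank * (4 : ℕ) ≤ b) (A : RFml.{u}) (h₁ : A ∈ Γ)
    (h₂ : A.neg ∈ Γ) : Pf X ρ H b n Γ :=
  of_mul (i := 2) hb (taut hρ le_rfl A h₁ h₂)

/-- `s ∈ L_α(X)`. -/
theorem mem_L (hρ : Om X.rank ≤ ρ) (hb : Om X.rank * (3 : ℕ) ≤ b) {s : RTerm.{u}} {α : Ordinal.{u}}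
    (hs : level X.rank s < level X.rank (.L α)) (h : .mem (.par s) (.par (.L α)) ∈ Γ) :
    Pf X ρ H b (n + 3) Γ :=
  intro fun _ hΓ _ => mem_of_dotHyp hρ hb (hΓ _ h s (.inl rfl)) hs (fun _ hC => hC.elim) h

/-- The witness is $\mathbb L_M(X)$ with $M$ above all parameters; its level $\Gamma_{\theta+1}+M$
is at least $M$. -/
theorem pairing (hρ : Om X.rank ≤ ρ) (hb : Om X.rank * (4 : ℕ) ≤ b) {r s : RTerm.{u}}
    (h : .ex (.and (.mem (.par r) (.bv 0)) (.mem (.par s) (.bv 0))) ∈ Γ) :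
    Pf X ρ H b (n + 5) Γ := by
  refine intro fun hH hΓ _ => ?_
  obtain ⟨M, hM, hMΩ, hlt⟩ := exists_level_lt hH _ (hΓ _ h)
  have hb3 := Om_mul_mono (i := 3) (by norm_num) hb
  refine ex (n := n + 4) h (.L M) (.L hH hM hMΩ) (and (n := n + 3)
    (A := .mem (.par r) (.par (.L M))) (B := .mem (.par s) (.par (.L M)))
    (Finset.mem_insert_self _ _) ?_ ?_)
  · exact mem_L hρ hb3 ((hlt r (.inl (.inl rfl))).trans_le le_add_self) (Finset.mem_insert_self _ _)
  · exact mem_L hρ hb3 ((hlt s (.inr (.inl rfl))).trans_le le_add_self) (Finset.mem_insert_self _ _)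

/-- Levels decrease along bounded quantifiers, so a stage above $|r|$ contains all elements of
elements of $r$. -/
theorem union (hρ : Om X.rank ≤ ρ) (hb : Om X.rank * (4 : ℕ) ≤ b) {r : RTerm.{u}}
    (h : .ex (.ball (.par r) (.ball (.bv 0) (.mem (.bv 0) (.bv 2)))) ∈ Γ) :
    Pf X ρ H b (n + 10) Γ := by
  refine intro fun hH hΓ _ => ?_
  obtain ⟨M, hM, hMΩ, hlt⟩ := exists_level_lt hH _ (hΓ _ h)
  have hb3 := Om_mul_mono (i := 3) (by norm_num) hb
  refine ex (n := n + 9) h (.L M) (.L hH hM hMΩ) (ball (n := n + 6) (t := r)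
    (A := .ball (.bv 0) (.mem (.bv 0) (.par (.L M)))) (Finset.mem_insert_self _ _)
    fun y H1 Γ1 _ _ hyr _ _ hy => ?_)
  refine ball (n := n + 3) (t := y) (A := .mem (.bv 0) (.par (.L M))) hy
    fun x H2 Γ2 _ _ hxy _ _ hx => ?_
  exact mem_L hρ hb3 (((hxy.trans hyr).trans (hlt r (.inl rfl))).trans_le le_add_self) hx

/-- The witness is $[x\in\mathbb L_M(X)\mid x\in r\wedge B(x)]$. Its guard is exactly the formula
demanded of its elements, so one half is a tautology; for the other half each $q\mathrel{\dot\in}r$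
witnesses its own membership. -/
theorem separation (hρ : Om X.rank ≤ ρ) (hb : Om X.rank * (4 : ℕ) ≤ b) {r : RTerm.{u}}
    {B : Fml RTerm.{u} 1} (hB : B.IsDelta0)
    (h : .ex (.and (.ball (.bv 0) (.and (.mem (.bv 0) (.par r)) (B.at' (.bv 0))))
      (.ball (.par r) (.imp (B.at' (.bv 0)) (.mem (.bv 0) (.bv 1))))) ∈ Γ) :
    Pf X ρ H b (n + 20) Γ := by
  refine intro fun hH hΓ _ => ?_
  have hb2 := Om_mul_mono (i := 2) (by norm_num) hb
  have hb3 := Om_mul_mono (i := 3) (by norm_num) hb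
  set C : Fml RTerm.{u} 1 := .and (.mem (.bv 0) (.par r)) B with hC
  have hC0 : C.IsDelta0 := ⟨trivial, hB⟩
  have hsub : C.params ⊆ (Fml.ex (.and (.ball (.bv 0) (.and (.mem (.bv 0) (.par r)) (B.at' (.bv 0))))
      (.ball (.par r) (.imp (B.at' (.bv 0)) (.mem (.bv 0) (.bv 1))))) : RFml.{u}).params := by
    intro t ht
    rcases ht with (ht | rfl) | ht
    · exact ht.elim
    · exact .inr (.inl rfl)
    · refine .inl (.inr (.inr ?_))
      have key : B.params = ((B.at' (.bv 0 : Ref RTerm.{u} 2)).subst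
          (fun _ => .bv 0 : Fin 2 → Ref RTerm.{u} 1)).params := by
        rw [Fml.at'_subst]
        exact congrArg Fml.params B.at'_bv.symm
      rw [key] at ht
      rcases Fml.params_subst _ _ ht with ht | ⟨_, ht⟩
      · exact ht
      · exact ht.elim
  obtain ⟨M, hM, hMΩ, hlt⟩ := exists_level_lt hH _ (hΓ _ h)
  have hy := TOk.compr hH hM hMΩ (A := C) (fun t ht => hΓ _ h t (hsub ht))
    fun t ht => (hlt t (hsub ht)).trans_le le_add_self
  rw [hC0.rel_eq] at hy
  have hry : level X.rank r < level X.rank (.compr M C) :=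
    (hlt r (hsub (.inl (.inr rfl)))).trans_le le_add_self
  refine ex (n := n + 19) h (.compr M C) hy (and (n := n + 18)
    (A := .ball (.par (.compr M C)) C)
    (B := .ball (.par r) (.imp B (.mem (.bv 0) (.par (.compr M C))))) ?_ ?_ ?_)
  · refine Finset.mem_insert.2 (.inl ?_)
    simp only [Fml.inst, Fml.subst, Fml.imp, ← Fml.neg_subst, Fml.at'_subst]
    rw [hC]
    congr 3
    · exact B.at'_bv.symm
    · exact congrArg Fml.neg B.at'_bv.symm
  · refine ball (n := n + 15) (Finset.mem_insert_self _ _) fun q H1 Γ1 _ _ _ _ hq hA => ?_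
    exact taut_delta0 hρ hb2 ((C.isDelta0_inst q).2 hC0) hA (hq _ rfl)
  · refine ball (n := n + 15) (Finset.mem_insert_self _ _) fun q H1 Γ1 _ hq hqr _ hyp hA => ?_
    refine or (n := n + 13) (A := (B.neg).inst q) (B := .mem (.par q) (.par (.compr M C))) hA ?_
    -- The rule `mem` would require the negated guard in the sequent; here the guard itself has to
    -- be derived from its two conjuncts.
    refine mem_dotAnd_of_not_isBasic (n := n + 12) (by rintro ⟨-, y, hy⟩; cases hy)
      (Finset.mem_insert_self _ _) q hq (hqr.trans hry) ?_
    refine and (n := n + 11) (A := C.inst q) (B := .eq (.par q) (.par q))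
      (Finset.mem_insert_self _ _) ?_ ?_
    · refine and (n := n + 10) (A := .mem (.par q) (.par r)) (B := B.inst q)
        (Finset.mem_insert_self _ _) ?_ ?_
      · exact mem_of_dotHyp (n := n + 7) hρ hb3 hq hqr
          (hyp.mono fun _ h => by simp [h]) (Finset.mem_insert_self _ _)
      · exact taut_delta0 hρ hb2 ((B.isDelta0_inst q).2 hB) (Finset.mem_insert_self _ _)
          (by simp)
    · exact and (n := n + 10) (Finset.mem_insert_self _ _)
        (sub_self hρ hb3 (Finset.mem_insert_self _ _)) (sub_self hρ hb3 (Finset.mem_insert_self _ _))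


/-- Induction on $|s|$ derives $F(s)$ from progressiveness, which is instantiated at $s$; the
hypothesis covers the elements of $s$. The base $\Omega\cdot 4$ admits all tautologies without
further cost. -/
theorem set_induction (hρ : Om X.rank ≤ ρ) (hb : Om X.rank * (5 : ℕ) ≤ b) (F : Fml RTerm.{u} 1)
    (h : .imp (.all (.imp (.ball (.bv 0) (F.at' (.bv 0))) F)) (.all F) ∈ Γ) :
    Pf X ρ H b (n + 3) Γ := by
  have main : ∀ (l : Ordinal.{u}) (H : Set Ordinal.{u} → Set Ordinal.{u}) (s : RTerm.{u})
      (Γ : Finset RFml.{u}), level X.rank s = l → TOk X H s →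
      (Fml.all (.imp (.ball (.bv 0) (F.at' (.bv 0))) F) : RFml.{u}).neg ∈ Γ → F.inst s ∈ Γ →
      Pf X ρ H (Om X.rank * ((3 + 1 : ℕ) : Ordinal.{u}) + ω ^ level X.rank s) 5 Γ := by
    intro l
    induction l using WellFoundedLT.induction with
    | ind l ih =>
    rintro H s Γ rfl hs h₁ h₂
    refine ex (n := 4) h₁ s hs (and (n := 3) (A := .ball (.par s) F) (B := F.neg.inst s) ?_ ?_ ?_)
    · refine Finset.mem_insert.2 (.inl ?_)
      refine congrArg (fun A => Fml.and (.ball (.par s) A) (F.neg.inst s)) ?_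
      rw [Fml.neg_neg, Fml.at'_subst]
      exact F.at'_bv.symm
    · refine ball (n := 0) (Finset.mem_insert_self _ _) fun q H1 Γ1 hH1 hq hqs hΓ1 _ hF => ?_
      exact of_level_lt hq hqs (ih _ hqs H1 q Γ1 rfl hq (hΓ1 (by simp [h₁])) hF)
    · exact taut_of_le hρ le_self_add (F.inst s) (by simp [h₂]) (by simp)
  refine or (n := n + 1) h (all (n := n) (Finset.mem_insert_self _ _) fun s H' hH' hs => ?_)
  exact of_level (i := 3) hs hb (main _ H' s _ rfl hs (by simp) (by simp))

theorem infinity (hρ : Om X.rank ≤ ρ) (hb : Om X.rank * (4 : ℕ) ≤ b)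
    (h : .ex (.and (.bex (.bv 0) (.mem (.bv 0) (.bv 1)))
      (.ball (.bv 0) (.bex (.bv 1) (.mem (.bv 1) (.bv 0))))) ∈ Γ) : Pf X ρ H b (n + 10) Γ := by
  have hb3 := Om_mul_mono (i := 3) (by norm_num) hb
  have nat_lt : ∀ k : ℕ, level X.rank (.L k) < level X.rank (.L ω) := fun k => by
    simp only [level]
    gcongr
    exact natCast_lt_omega0 k
  have nat_ok : ∀ (H' : Set Ordinal.{u} → Set Ordinal.{u}) (k : ℕ), Good X.rank H' →
      TOk X H' (.L k) := fun H' k hH => .L hH (hH.avail_nat k)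
    ((natCast_lt_omega0 k).trans (omega0_lt_Om _))
  refine intro fun hH hΓ _ => ex (n := n + 9) h (.L ω) (.L hH hH.avail_omega0 (omega0_lt_Om _))
    (and (n := n + 8) (A := .bex (.par (.L ω)) (.mem (.bv 0) (.par (.L ω))))
      (B := .ball (.par (.L ω)) (.bex (.par (.L ω)) (.mem (.bv 1) (.bv 0))))
      (Finset.mem_insert_self _ _) ?_ ?_)
  · refine bex (n := n + 6) (Finset.mem_insert_self _ _) (.L (0 : ℕ)) (nat_ok H 0 hH) (nat_lt 0)
      (fun _ hC => hC.elim) (fun _ _ hC => hC.elim) fun Γ1 _ h1 => ?_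
    exact mem_L (n := n + 3) hρ hb3 (nat_lt 0) h1
  · refine ball (n := n + 5) (Finset.mem_insert_self _ _) fun q H1 Γ1 _ hq hqs _ _ h1 => ?_
    have hlt : level X.rank q < Γ_ (X.rank + 1) + ω := hqs
    -- Any $q$ below level $\Gamma_{\theta+1}+\omega$ lies at or below some $\Gamma_{\theta+1}+k$
    -- with $k$ finite, hence belongs to $\mathbb L_{k+1}(X)$.
    obtain ⟨d, hd, hle⟩ := (lt_add_iff omega0_ne_zero).1 hlt
    obtain ⟨k, rfl⟩ := lt_omega0.1 hd
    have hqk : level X.rank q < level X.rank (.L ((k + 1 : ℕ) : Ordinal.{u})) := by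
      refine hle.trans_lt ?_
      simp only [level]
      gcongr
      exact Nat.lt_succ_self k
    refine intro fun hH1 _ _ => bex (n := n + 3) (A := .mem (.par q) (.bv 0)) h1
      (.L ((k + 1 : ℕ) : Ordinal.{u})) (nat_ok H1 _ hH1) (nat_lt _)
      (fun _ hC => hC.elim) (fun _ _ hC => hC.elim) fun Γ2 _ h2 => ?_
    exact mem_L hρ hb3 hqk h2

/-- The hypothesis of the axiom is itself a $\Sigma$ formula, and relativizing it to $z$ changes
only the quantifier on $y$. So the axiom is ($\Sigma$-Ref) applied to the tautology for that
formula. -/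
theorem collection (hρ : Om X.rank ≤ ρ) (hb : Om X.rank * (4 : ℕ) ≤ b) {r : RTerm.{u}}
    {G : Fml RTerm.{u} 2} (hG : G.IsDelta0)
    (h : .imp (.ball (.par r) (.ex G))
      (.ex (.ball (.par r) (.bex (.bv 1) (G.subst ![.bv 0, .bv 1])))) ∈ Γ) :
    Pf X ρ H b (n + 3) Γ := by
  refine intro fun _ hΓ _ => or (n := n + 1) h (sigmaRef (A := .ball (.par r) (.ex G)) ?_
    (Fml.IsDelta0.isSigma G hG) ?_ ?_)
  · refine Finset.mem_insert.2 (.inl ?_)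
    simp only [Fml.exRel, Fml.subst, Fml.rel, Ref.subst_par, Ref.shift_bv]
    rw [(Fml.IsDelta0.rel_eq _ ((Fml.isDelta0_subst G _).2 hG))]
    refine congrArg (fun σ => Fml.ex (.ball (.par r) (.bex (.bv 1) (G.subst σ)))) ?_
    funext i
    match i with
    | 0 => rfl
    | 1 => rfl
  · exact fun t ht => hΓ _ h t (.inl (by simpa [Fml.params, Fml.neg] using ht))
  · exact taut_of_le hρ hb _ (Finset.mem_insert_self _ _)
      (Finset.mem_insert_of_mem (Finset.mem_insert_of_mem (Finset.mem_insert_self _ _)))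

end Pf

end Axioms

/-! ### The embedding -/

section Embedding

variable {X : ZFSet.{u}} {ρ : Ordinal.{u}} {H : Set Ordinal.{u} → Set Ordinal.{u}}

/-- Allows the bound on cut ranks to be read off from the Gödel number alone. -/
theorem Fml.size_le_code {k : ℕ} (A : Fml ℕ k) : A.size ≤ A.code + 1 := by
  have key : ∀ t x y : ℕ, t + (x + y) ≤ Nat.pair t (Nat.pair x y) := fun t x y =>
    (Nat.add_le_add_left (Nat.add_le_pair x y) t).trans (Nat.add_le_pair t _)
  induction A with
  | mem r s | nmem r s => simp [Fml.size, wsize, wref_zero]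
  | and A B ihA ihB =>
    have := key 2 A.code B.code
    simp only [Fml.size, wsize, Fml.code] at *
    omega
  | or A B ihA ihB =>
    have := key 3 A.code B.code
    simp only [Fml.size, wsize, Fml.code] at *
    omega
  | ball r A ih =>
    have := key 4 r.code A.code
    simp only [Fml.size, wsize, Fml.code, wref_zero] at *
    omega
  | bex r A ih =>
    have := key 5 r.code A.code
    simp only [Fml.size, wsize, Fml.code, wref_zero] at *
    omega
  | all A ih =>
    have := Nat.add_le_pair 6 A.code
    simp only [Fml.size, wsize, Fml.code] at *
    omega
  | ex A ih =>
    have := Nat.add_le_pair 7 A.code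
    simp only [Fml.size, wsize, Fml.code] at *
    omega

theorem fok_map {ν : ℕ → RTerm.{u}} (hν : ∀ i, TOk X H (ν i)) {k : ℕ} (A : Fml ℕ k) :
    FOk X H (A.map ν) := fun t ht => by
  obtain ⟨i, -, rfl⟩ := Fml.params_map A ht
  exact hν i

theorem rkFml_map_lt {ν : ℕ → RTerm.{u}} (hν : ∀ i, TOk X H (ν i)) {c : ℕ}
    (hρ : Om X.rank + (2 * c + 20 : ℕ) ≤ ρ) (A : KPFml) (hA : A.size ≤ c + 5) :
    rkFml X.rank (A.map ν) < ρ := by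
  refine (rkFml_le _ fun t ht => (fok_map hν A t ht).1).trans_lt (lt_of_lt_of_le ?_ hρ)
  rw [Fml.size_map]
  gcongr
  omega

theorem mem_insert_map {ν ν' : ℕ → RTerm.{u}} {Δ : Finset KPFml} {Γ : Finset RFml.{u}} {A : KPFml}
    (h : ∀ B ∈ Δ, B.map ν ∈ Γ) (hν : ∀ B ∈ Δ, B.map ν = B.map ν') :
    ∀ B ∈ insert A Δ, B.map ν' ∈ insert (A.map ν') Γ := fun B hB => by
  rcases Finset.mem_insert.1 hB with rfl | hB
  · exact Finset.mem_insert_self _ _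
  · rw [← hν B hB]
    exact Finset.mem_insert_of_mem (h B hB)

theorem map_update_of_fresh {ν : ℕ → RTerm.{u}} {a : ℕ} {k : ℕ} {A : Fml ℕ k} (h : a ∉ A.params)
    (s : RTerm.{u}) : A.map ν = A.map (Function.update ν a s) :=
  Fml.map_congr A fun t ht => by
    rw [Function.update_of_ne]
    rintro rfl
    exact h ht

/-- The statement is generalized for the induction: over the assignment, because eigenvariables are
reassigned; over the operator, because it grows at universal rules; and over a larger sequent
$\Gamma$, because principal formulas are kept. -/
theorem Pf.of_KPDer {Δ : Finset KPFml} (d : KPDer Δ)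
    (hρ : Om X.rank + (2 * d.code + 20 : ℕ) ≤ ρ) (ν : ℕ → RTerm.{u})
    (hν : ∀ i, TOk X H (ν i)) (Γ : Finset RFml.{u}) (hΓ : ∀ A ∈ Δ, A.map ν ∈ Γ) :
    Pf X ρ H (Om X.rank * (6 : ℕ)) (30 * d.code + 30) Γ := by
  have key : ∀ t x y : ℕ, t + (x + y) ≤ Nat.pair t (Nat.pair x y) := fun t x y =>
    (Nat.add_le_add_left (Nat.add_le_pair x y) t).trans (Nat.add_le_pair t _)
  have b6 : ∀ i : ℕ, i ≤ 6 → Om X.rank * (i : ℕ) ≤ Om X.rank * (6 : ℕ) :=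
    fun i hi => Om_mul_mono hi le_rfl
  have hmono : ∀ {x y : ℕ}, x ≤ y → Om X.rank + (2 * y + 20 : ℕ) ≤ ρ →
      Om X.rank + (2 * x + 20 : ℕ) ≤ ρ := fun {x y} hxy h => by
    refine le_trans ?_ h
    gcongr
  have hρ0 : Om X.rank ≤ ρ := le_self_add.trans hρ
  have hb3 := b6 3 (by norm_num)
  have hb4 := b6 4 (by norm_num)
  have hb5 := b6 5 (by norm_num)
  induction d generalizing H ν Γ with
  | logAx Δ A =>
    exact taut_of_le hρ0 hb4 (A.map ν) (hΓ _ (by simp))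
      (by rw [Fml.neg_map]; exact hΓ _ (by simp))
  | extAx Δ a c B =>
    have h := hΓ _ (Finset.mem_insert_self _ _)
    refine le (m := 6) (or (n := 4)
      (A := (Fml.and (.eq (.par (ν a)) (.par (ν c))) ((B.map ν).inst (ν a)) : RFml.{u}).neg)
      (B := (B.map ν).inst (ν c)) ?_ ?_) (by omega)
    · simp only [Fml.imp, Fml.map, Fml.map_inst, Fml.neg, ← Fml.neg_map] at h
      exact h
    · refine or (n := 2) (A := (Fml.eq (.par (ν a)) (.par (ν c)) : RFml.{u}).neg)
        (B := ((B.map ν).inst (ν a)).neg) (by simp [Fml.neg]) ?_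
      refine or (n := 0) (A := Fml.nsub (ν a) (ν c)) (B := Fml.nsub (ν c) (ν a))
        (Finset.mem_insert_of_mem (Finset.mem_insert_self _ _)) ?_
      exact of_mul (i := 2) hb4 (inst_congr hρ0 le_rfl (B.map ν) (s := ν a) (t := ν c)
        (.inr (by simp)) (by simp) (by simp))
  | pairAx Δ a c => exact (pairing (n := 0) hρ0 hb4 (hΓ _ (Finset.mem_insert_self _ _))).le (by omega)
  | unionAx Δ a => exact (union (n := 0) hρ0 hb4 (hΓ _ (Finset.mem_insert_self _ _))).le (by omega)
  | sepAx Δ a B hB =>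
    refine (separation (n := 0) (B := B.map ν) (r := ν a) hρ0 hb4 (by simpa using hB) ?_).le
      (by omega)
    have h := hΓ _ (Finset.mem_insert_self _ _)
    simp only [sepAx, Fml.map, Fml.imp, Fml.map_at', ← Fml.neg_map] at h
    exact h
  | indAx Δ F =>
    refine (set_induction (n := 0) hρ0 hb5 (F.map ν) ?_).le (by omega)
    have h := hΓ _ (Finset.mem_insert_self _ _)
    simp only [indAx, Fml.map, Fml.imp, Fml.map_at', ← Fml.neg_map] at h
    exact h
  | infAx Δ => exact (infinity (n := 0) hρ0 hb4 (hΓ _ (Finset.mem_insert_self _ _))).le (by omega)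
  | collAx Δ a G hG =>
    refine (collection (n := 0) (r := ν a) (G := G.map ν) hρ0 hb4 (by simpa using hG) ?_).le
      (by omega)
    have h := hΓ _ (Finset.mem_insert_self _ _)
    simp only [collAx, Fml.map, Fml.imp, ← Fml.neg_map, Fml.map_subst] at h
    have e : (fun i => Ref.map ν ((![.bv 0, .bv 1] : Fin 2 → Ref ℕ 3) i)) = ![.bv 0, .bv 1] := by
      funext i
      match i with
      | 0 => rfl
      | 1 => rfl
    rw [e] at h
    exact h
  | and Δ A B d e ihd ihe =>
    have h := hΓ _ (Finset.mem_insert_self _ _)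
    have hc := key 8 (seqCode Δ) (Nat.pair (Nat.pair A.code B.code) (Nat.pair d.code e.code))
    have hc1 := Nat.add_le_pair (Nat.pair A.code B.code) (Nat.pair d.code e.code)
    have hc2 := Nat.add_le_pair d.code e.code
    simp only [KPDer.code] at hρ ⊢
    have hΔ : ∀ B ∈ Δ, B.map ν ∈ Γ := fun B hB => hΓ B (Finset.mem_insert_of_mem hB)
    refine le (m := 30 * (d.code + e.code) + 30 + 1) (and (A := A.map ν) (B := B.map ν) h ?_ ?_)
      (by omega)
    · exact (ihd (hmono (by omega) hρ) ν hν _ (mem_insert_map hΔ fun _ _ => rfl)).le (by omega)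
    · exact (ihe (hmono (by omega) hρ) ν hν _ (mem_insert_map hΔ fun _ _ => rfl)).le (by omega)
  | orLeft Δ A B d ih =>
    have h := hΓ _ (Finset.mem_insert_self _ _)
    have hc := key 9 (seqCode Δ) (Nat.pair (Nat.pair A.code B.code) d.code)
    have hc1 := Nat.add_le_pair (Nat.pair A.code B.code) d.code
    simp only [KPDer.code] at hρ ⊢
    have hΔ : ∀ B ∈ Δ, B.map ν ∈ Γ := fun B hB => hΓ B (Finset.mem_insert_of_mem hB)
    exact (orLeft (A := A.map ν) (B := B.map ν) h
      (ih (hmono (by omega) hρ) ν hν _ (mem_insert_map hΔ fun _ _ => rfl))).le (by omega)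
  | orRight Δ A B d ih =>
    have h := hΓ _ (Finset.mem_insert_self _ _)
    have hc := key 10 (seqCode Δ) (Nat.pair (Nat.pair A.code B.code) d.code)
    have hc1 := Nat.add_le_pair (Nat.pair A.code B.code) d.code
    simp only [KPDer.code] at hρ ⊢
    have hΔ : ∀ B ∈ Δ, B.map ν ∈ Γ := fun B hB => hΓ B (Finset.mem_insert_of_mem hB)
    exact (orRight (A := A.map ν) (B := B.map ν) h
      (ih (hmono (by omega) hρ) ν hν _ (mem_insert_map hΔ fun _ _ => rfl))).le (by omega)
  | bex Δ a c F d ih =>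
    have h : .bex (.par (ν c)) (F.map ν) ∈ Γ := hΓ _ (Finset.mem_insert_self _ _)
    have hc := key 11 (seqCode Δ) (Nat.pair (Nat.pair a (Nat.pair c F.code)) d.code)
    have hc1 := Nat.add_le_pair (Nat.pair a (Nat.pair c F.code)) d.code
    have hc2 := key a c F.code
    have hs : F.size + 2 ≤ (KPDer.bex Δ a c F d).code + 5 := by
      have := F.size_le_code
      simp only [KPDer.code]
      omega
    simp only [KPDer.code] at hs hρ ⊢
    have hΔ : ∀ B ∈ Δ, B.map ν ∈ Γ := fun B hB => hΓ B (Finset.mem_insert_of_mem hB)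
    -- The term `ν a` may have a level too large for a witness. After the cut, $(\notin)$ supplies
    -- an equal term $q$ with $q\mathrel{\dot\in}$ `ν c`, and congruence carries $F$ over to it.
    refine le (m := 30 * d.code + 30 + 9 + 1) (cut ((Fml.and (vmem a c) (F.inst a)).map ν)
      (fok_map hν _) (rkFml_map_lt hν hρ _ ?_) ?_ ?_) (by omega)
    · have := Fml.size_subst F (fun _ => (.par a : Ref ℕ 0))
      refine le_trans ?_ hs
      simp only [Fml.size, wsize, Fml.inst, wref_zero] at this ⊢
      omega
    · exact (ih (hmono (by omega) hρ) ν hν _ (mem_insert_map hΔ fun _ _ => rfl)).le (by omega)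
    · refine or (n := 30 * d.code + 30 + 7) (A := .nmem (.par (ν a)) (.par (ν c)))
        (B := (F.map ν).neg.inst (ν a)) ?_ ?_
      · refine Finset.mem_insert.2 (.inl ?_)
        simp only [Fml.map, Fml.neg, Fml.map_inst, Fml.neg_inst, Ref.map_par]
      · refine nmem (n := 30 * d.code + 30 + 2) hρ0
          (Finset.mem_insert_of_mem (Finset.mem_insert_self _ _))
          fun q H1 Γ1 hH1 hq hqc hΓ1 hyp h1 h2 => ?_
        refine bex (n := 30 * d.code + 30) (t := ν c) (A := F.map ν) (hΓ1 (by simp [h])) q hq hqc hyp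
          (dotTaut hρ0 (b6 2 (by norm_num)) (hν c).1) fun Γ2 hΓ2 h3 => ?_
        exact of_mul (i := 2) hb4 (inst_congr hρ0 le_rfl (F.map ν) (s := ν a) (t := q)
          (.inr ⟨hΓ2 h1, hΓ2 h2⟩) (hΓ2 (hΓ1 (by simp))) h3)
  | ex Δ a F d ih =>
    have h : .ex (F.map ν) ∈ Γ := hΓ _ (Finset.mem_insert_self _ _)
    have hc := key 12 (seqCode Δ) (Nat.pair (Nat.pair a F.code) d.code)
    have hc1 := Nat.add_le_pair (Nat.pair a F.code) d.code
    simp only [KPDer.code] at hρ ⊢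
    have hΔ : ∀ B ∈ Δ, B.map ν ∈ Γ := fun B hB => hΓ B (Finset.mem_insert_of_mem hB)
    refine (ex (n := 30 * d.code + 30) h (ν a) (hν a) ?_).le (by omega)
    rw [← Fml.map_inst]
    exact ih (hmono (by omega) hρ) ν hν _ (mem_insert_map hΔ fun _ _ => rfl)
  | ball Δ a c F ha d ih =>
    have h : .ball (.par (ν c)) (F.map ν) ∈ Γ := hΓ _ (Finset.mem_insert_self _ _)
    have hc := key 13 (seqCode Δ) (Nat.pair (Nat.pair a (Nat.pair c F.code)) d.code)
    have hc1 := Nat.add_le_pair (Nat.pair a (Nat.pair c F.code)) d.code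
    have hc2 := key a c F.code
    have hs : F.size + 2 ≤ (KPDer.ball Δ a c F ha d).code + 5 := by
      have := F.size_le_code
      simp only [KPDer.code]
      omega
    simp only [KPDer.code] at hs hρ ⊢
    have hΔ : ∀ B ∈ Δ, B.map ν ∈ Γ := fun B hB => hΓ B (Finset.mem_insert_of_mem hB)
    have haF : a ∉ F.params := fun h => ha _ (Finset.mem_insert_self _ _) (.inr h)
    -- Freshness also excludes the bound, so reassigning $a$ leaves `ν c` unchanged.
    have hac : c ≠ a := fun h => ha _ (Finset.mem_insert_self _ _) (.inl h.symm)
    refine le (m := 30 * d.code + 30 + 5 + 3) (ball h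
      fun s H1 Γ1 hH1 hs1 hsc hΓ1 hyp hF => ?_) (by omega)
    have hν' : ∀ i, TOk X H1 (Function.update ν a s i) := fun i => by
      rcases eq_or_ne i a with rfl | hi
      · rwa [Function.update_self]
      · rw [Function.update_of_ne hi]
        exact (hν i).mono hH1
    -- The KP premise is guarded by $\in$ and the infinitary rule by $\dot\in$. The cut passes
    -- between them, since $s\mathrel{\dot\in}t$ implies $s\in t$.
    refine cut (n := 30 * d.code + 30 + 4)
      ((Fml.imp (vmem a c) (F.inst a)).map (Function.update ν a s))
      (fok_map hν' _) (rkFml_map_lt hν' hρ _ ?_) ?_ ?_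
    · have := Fml.size_subst F (fun _ => (.par a : Ref ℕ 0))
      refine le_trans ?_ hs
      simp only [Fml.size, wsize, Fml.imp, Fml.neg, Fml.inst, wref_zero] at this ⊢
      omega
    · exact (ih (hmono (by omega) hρ) _ hν' _ (mem_insert_map (fun B hB => hΓ1 (hΔ B hB))
        fun B hB => map_update_of_fresh (ha B (Finset.mem_insert_of_mem hB)) s)).le (by omega)
    · refine and (n := 30 * d.code + 30 + 3) (A := .mem (.par s) (.par (ν c)))
        (B := ((F.map ν).inst s).neg) ?_ ?_ ?_
      · refine Finset.mem_insert.2 (.inl ?_)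
        simp only [Fml.map, Fml.imp, Fml.neg, Fml.map_inst, Ref.map_par, Function.update_self,
          Function.update_of_ne hac, ← map_update_of_fresh haF s]
      · exact mem_of_dotHyp hρ0 hb3 hs1 hsc (hyp.mono fun _ h => by simp [h])
          (Finset.mem_insert_self _ _)
      · exact taut_of_le hρ0 hb4 ((F.map ν).inst s) (by simp [hF]) (Finset.mem_insert_self _ _)
  | all Δ a F ha d ih =>
    have h : .all (F.map ν) ∈ Γ := hΓ _ (Finset.mem_insert_self _ _)
    have hc := key 14 (seqCode Δ) (Nat.pair (Nat.pair a F.code) d.code)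
    have hc1 := Nat.add_le_pair (Nat.pair a F.code) d.code
    simp only [KPDer.code] at hρ ⊢
    have hΔ : ∀ B ∈ Δ, B.map ν ∈ Γ := fun B hB => hΓ B (Finset.mem_insert_of_mem hB)
    have haF : a ∉ F.params := ha _ (Finset.mem_insert_self _ _)
    refine (all (n := 30 * d.code + 30) h fun s H1 hH1 hs1 => ?_).le (by omega)
    have hν' : ∀ i, TOk X H1 (Function.update ν a s i) := fun i => by
      rcases eq_or_ne i a with rfl | hi
      · rwa [Function.update_self]
      · rw [Function.update_of_ne hi]
        exact (hν i).mono hH1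
    have e : (F.map ν).inst s = (F.inst a).map (Function.update ν a s) := by
      rw [Fml.map_inst, Function.update_self, ← map_update_of_fresh haF s]
    rw [e]
    exact ih (hmono (by omega) hρ) _ hν' _ (mem_insert_map hΔ
      fun B hB => map_update_of_fresh (ha B (Finset.mem_insert_of_mem hB)) s)
  | cut Δ A d e ihd ihe =>
    have hc := key 15 (seqCode Δ) (Nat.pair A.code (Nat.pair d.code e.code))
    have hc1 := key A.code d.code e.code
    have hs := A.size_le_code
    simp only [KPDer.code] at hρ ⊢
    refine le (m := 30 * (d.code + e.code) + 30 + 1) (cut (A.map ν) (fok_map hν _)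
      (rkFml_map_lt hν hρ _ (by omega)) ?_ ?_) (by omega)
    · exact (ihd (hmono (by omega) hρ) ν hν _ (mem_insert_map hΓ fun _ _ => rfl)).le (by omega)
    · rw [Fml.neg_map]
      exact (ihe (hmono (by omega) hρ) ν hν _ (mem_insert_map hΓ fun _ _ => rfl)).le (by omega)

end Embedding

end KPEmbed

-- The bound $m$ and the final estimate

open KPEmbed in
theorem mainTheorem8 :
    ∃ m : ℕ → ℕ, Computable m ∧
      ∀ (Γ : Finset KPFml) (d : KPDer Γ) (n : ℕ) (a : Fin n → ℕ), Function.Injective a →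
        (∀ A ∈ Γ, A.params ⊆ Set.range a) →
        ∀ (X : ZFSet.{u}) (H : Set Ordinal.{u} → Set Ordinal.{u}),
          IsOperator X.rank H → Om X.rank ∈ H ∅ →
          ∀ s : Fin n → RTerm.{u}, (∀ i, IsTerm X (s i)) →
            RSDer X (Om X.rank + (m d.code : Ordinal.{u}))
              (ext H (⋃ i, kTerm X.rank (s i)))
              (Om X.rank * ω ^ (m d.code : Ordinal.{u}))
              (substSeq a s Γ) := by
  -- The value is dictated by the cut ranks: twice the size of a cut formula, with slack for the
  -- cuts added in translating the bounded rules. For the height it only matters that $m\ge 1$.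
  refine ⟨fun c => 2 * c + 20, ?_, ?_⟩
  · exact (Primrec.nat_add.comp (Primrec.nat_mul.comp (Primrec.const 2) Primrec.id)
      (Primrec.const 20)).to_comp
  intro Γ d n a ha _ X H hop hΩ s hs
  have hH : Good X.rank (ext H (⋃ i, kTerm X.rank (s i))) := Good.ext ⟨hop, hΩ⟩ _
  have hν : ∀ j, TOk X (ext H (⋃ i, kTerm X.rank (s i)))
      (Function.extend a s (fun _ => RTerm.bar ∅) j) := fun j => by
    by_cases hj : ∃ i, a i = j
    · obtain ⟨i, rfl⟩ := hj
      rw [ha.extend_apply]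
      exact ⟨hs i, ((Set.subset_iUnion (fun i => kTerm X.rank (s i)) i).trans
        Set.subset_union_right).trans (hop.subset _)⟩
    · rw [Function.extend_apply' _ _ _ hj]
      exact .bar hH (inTC_empty X)
  -- Written as a single power of $\omega$, the height is visibly available.
  have hheight : Om X.rank * ω ^ ((2 * d.code + 20 : ℕ) : Ordinal.{u}) =
      ω ^ (Om X.rank + ((2 * d.code + 20 : ℕ) : Ordinal.{u})) := by
    rw [opow_add, opow_Om]
  refine Pf.of_KPDer d le_rfl _ hν _ (fun A hA => Finset.mem_image_of_mem _ hA) hH ?_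
    (hH.avail_mul_nat hH.avail_Om 6) (Om_le_of_mul_le (i := 5) le_rfl) _ ?_ ?_
  · intro A hA
    obtain ⟨B, -, rfl⟩ := Finset.mem_image.1 hA
    exact fok_map hν B
  · rw [hheight]
    exact hH.avail_opow (hH.avail_add_nat hH.avail_Om _)
  · have h1 : Om X.rank * (6 : ℕ) + (30 * d.code + 30 : ℕ) ≤ Om X.rank * (7 : ℕ) := by
      rw [Om_mul_succ X.rank 6]
      gcongr
      exact ((natCast_lt_omega0 _).trans (omega0_lt_Om _)).le
    refine h1.trans ?_
    gcongr
    refine (natCast_lt_omega0 7).le.trans ?_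
    conv_lhs => rw [← opow_one ω]
    refine opow_le_opow_right omega0_pos ?_
    exact_mod_cast (by omega : 1 ≤ 2 * d.code + 20)
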